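/- Manifolds are smooth, Hausdorff and second countable, of constant dimension, and (unless said otherwise) possibly with boundary; $\lambda(V)=\Lambda^{\mathrm{top}}_{\mathbb R}V$. **Relative orientations.** A relative orientation $\mathfrak o$ of a continuous map $\varphi:A\to B$ of manifolds is an orientation of the line bundle $\varphi^*\lambda(TB)^*\otimes\lambda(TA)$, i.e. a continuous choice of homotopy classes $\mathfrak o_u$ of isomorphisms $\lambda(T_uA)\to\lambda(T_{\varphi(u)}B)$. It induces a relative orientation $\partial\mathfrak o$ of $\varphi|_{\partial A}$ by composing with $\lambda(T_u\partial A)\to\lambda(T_uA)$, $\eta\mapsto\eta\wedge\nu$, where $\nu$ is an outward normal vector (in the last position). **Pseudocycles.** The limit set of a continuous map $f:\mathcal Z\to Y$ is $\Omega(f)=\bigcap_{K\subset\mathcal Z\text{ compact}}\overline{f(\mathcal Z\setminus K)}$. The map $f$ is a bordered $\mathbb Z_2$-pseudocycle with boundary $f|_{\mathcal Z_0}$, where $\mathcal Z_0\subset\partial\mathcal Z$, if $\overline{f(\mathcal Z)}$ is compact and there is a smooth map $h:\mathcal Z'\to Y$ from a manifold without boundary with $\dim\mathcal Z'\le\dim\mathcal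 Z-2$ (the empty manifold is allowed in every dimension), $\Omega(f)\subset h(\mathcal Z')$ and $f(\partial\mathcal Z\setminus\mathcal Z_0)\subset\partial Y\cup h(\mathcal Z')$. Two bordered $\mathbb Z_2$-pseudocycles $f:\mathcal Z\to Y$ and $g:\Upsilon\to Y$ are transverse if they are smooth, $f$ and $f|_{\partial\mathcal Z}$ are both transverse to both $g$ and $g|_{\partial\Upsilon}$, and there are smooth maps $h_1:\mathcal Z'\to Y$ and $h_2:\Upsilon'\to Y$ from manifolds without boundary such that $\dim\mathcal Z'\le\dim\mathcal Z-2$, $\dim\Upsilon'\le\dim\Upsilon-2$, $\Omega(f)\subset h_1(\mathcal Z')$, $\Omega(g)\subset h_2(\Upsilon')$, $h_1$ is transverse to $g$ and $g|_{\partial\Upsilon}$, $h_2$ is transverse to $f$ and $f|_{\partial\mathcal Z}$, and $h_1$ is transverse to $h_2$. **Signs.** Let $Y=X\times\mathcal M$ be a product of manifolds, $f=(f_1,f_2):\mathcal Z\to Y$, $g=(g_1,g_2):\Upsilon\to Y$, and let $\mathfrak o_1$, $\mathfrak o_2$ be relative orientations of $f_1:\mathcal Z\to X$ and of $g_2:\Upsilon\to\mathcal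 M$. If $f(u)=g(P)$ and $T_u\mathcal Z\oplus T_P\Upsilon\to T_{f(u)}Y$, $(v,w)\mapsto d_uf(v)+d_Pg(w)$, is an isomorphism, the sign of $(u,P)$ with respect to $\mathfrak o_1,\mathfrak o_2$ is $+1$ if the top exterior power $\lambda(T_u\mathcal Z)\otimes\lambda(T_P\Upsilon)\to\lambda(T_{f_1(u)}X)\otimes\lambda(T_{g_2(P)}\mathcal M)$ of this isomorphism lies in the homotopy class determined by $(\mathfrak o_1)_u$ and $(\mathfrak o_2)_P$, and $-1$ otherwise. For a finite fiber product all of whose points have this property, $|\cdot|^{\pm}_{\mathfrak o_1,\mathfrak o_2}$ is the sum of the signs of its points. The same conventions apply to $f,\,g|_{\partial\Upsilon}$ with $\mathfrak o_1,\partial\mathfrak o_2$ and to $f|_{\partial\mathcal Z},\,g$ with $\partial\mathfrak o_1,\mathfrak o_2$. **Lemma.** Let $\mathcal Z,\Upsilon,X,\mathcal M,Y,f,g,\mathfrak o_1,\mathfrak o_2$ be as above, with $\dim\mathcal Z+\dim\Upsilon=\dim Y+1$. If $f$ and $g$ are transverse bordered $\mathbb Z_2$-pseudocycles, then the fiber products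 $$\mathcal Z\,{}_f\!\times_g(\partial\Upsilon)=\{(u,P)\in\mathcal Z\times\partial\Upsilon: f(u)=g(P)\},\qquad (\partial\mathcal Z)\,{}_f\!\times_g\Upsilon=\{(u,P)\in\partial\mathcal Z\times\Upsilon: f(u)=g(P)\}$$ are finite sets and $$\big|\mathcal Z\,{}_f\!\times_g(\partial\Upsilon)\big|^{\pm}_{\mathfrak o_1,\partial\mathfrak o_2}=(-1)^{\dim\Upsilon}\,\big|(\partial\mathcal Z)\,{}_f\!\times_g\Upsilon\big|^{\pm}_{\partial\mathfrak o_1,\mathfrak o_2}.$$ -/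

import Mathlib

open Set Module
open scoped Manifold ContDiff Topology

noncomputable section

namespace Steenrod

/-! ### Manifolds with boundary -/

section Boundary

variable {E : Type*} [NormedAddCommGroup E] [NormedSpace ℝ E] {H : Type*} [TopologicalSpace H]

/-- A model for manifolds possibly with boundary: its image is a closed linear half-space
`{0 ≤ ℓ}`. The case `ℓ = 0` is that of manifolds without boundary, in any dimension
(including `0`). Corners are excluded. -/
def IsBorderedModel (I : ModelWithCorners ℝ E H) : Prop :=
  ∃ l : E →L[ℝ] ℝ, range I = {x | 0 ≤ l x}

/-- The tangent space of `∂Z` at a boundary point `u`, inside `T_u Z = E`: the boundary hyperplane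
of the model half-space. -/
def boundaryTangent (I : ModelWithCorners ℝ E H) : Submodule ℝ E :=
  Submodule.span ℝ (frontier (range I))

/-- A tangent vector at a boundary point that points strictly out of the manifold. -/
def IsOutward (I : ModelWithCorners ℝ E H) (ν : E) : Prop :=
  -ν ∈ interior (range I)

end Boundary

/-! ### Linear algebra of relative orientations -/

section Linear

/-- The sign of (any representative of) `θ` on the tuple `v`. For `n = 0` this is the sign of `θ`. -/
def orientSign {V : Type*} [AddCommGroup V] [Module ℝ V] {n : ℕ}
    (θ : Orientation ℝ V (Fin n)) (v : Fin n → V) : SignType :=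
  SignType.sign (θ.someVector v)

/-- A homotopy class of isomorphisms `λ(V) → λ(W)` of top exterior powers, given by its action on
orientations. -/
structure LinearRelOrientation (V W : Type*) [AddCommGroup V] [Module ℝ V]
    [AddCommGroup W] [Module ℝ W] (n m : ℕ) where
  toFun : Orientation ℝ V (Fin n) → Orientation ℝ W (Fin m)
  map_neg : ∀ θ, toFun (-θ) = -toFun θ

/-- For bases `v` of `V` and `w` of `W`: the class contains an isomorphism that takes
`v₁ ∧ ⋯ ∧ vₙ` to a positive multiple of `w₁ ∧ ⋯ ∧ wₘ`. -/
def LinearRelOrientation.Pos {V W : Type*} [AddCommGroup V] [Module ℝ V]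
    [AddCommGroup W] [Module ℝ W] {n m : ℕ} (σ : LinearRelOrientation V W n m)
    (v : Fin n → V) (w : Fin m → W) : Prop :=
  ∃ θ, 0 < orientSign θ v * orientSign (σ.toFun θ) w

/-- `(b₁, …, bₙ₋₁, ν)`. -/
def appendLast {V : Type*} {n : ℕ} (b : Fin (n - 1) → V) (ν : V) : Fin n → V :=
  fun i => if h : (i : ℕ) < n - 1 then b ⟨i, h⟩ else ν

/-- The induced class `∂σ : λ(T∂Z) → λ(TZ) → λ(W)` on the boundary hyperplane; the first arrow is
the co-orientation of `∂Z` by the outer normal, through `λ(TZ) = λ(T∂Z) ⊗ λ(N)`, that is with the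
outer normal in the last position. -/
def LinearRelOrientation.BoundaryPos {E H W : Type*} [NormedAddCommGroup E] [NormedSpace ℝ E]
    [TopologicalSpace H] [AddCommGroup W] [Module ℝ W] {n m : ℕ}
    (I : ModelWithCorners ℝ E H) (σ : LinearRelOrientation E W n m)
    (b : Fin (n - 1) → boundaryTangent I) (w : Fin m → W) : Prop :=
  ∃ ν, IsOutward I ν ∧ σ.Pos (appendLast (fun i => (b i : E)) ν) w

open Classical in
/-- `+1` if `p` holds and `-1` otherwise. -/
def signOf (p : Prop) : ℤ := if p then 1 else -1

/-- Let `pos₁`, `pos₂` be the positivity relations of classes of isomorphisms `λ(V₁) → λ(W₁)` and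
`λ(V₂) → λ(W₂)`. If `(v, w) ↦ A v + B w` is an isomorphism `V₁ ⊕ V₂ → W₁ ⊕ W₂`, this is `+1` if its
top exterior power lies in the class of `λ(V₁) ⊗ λ(V₂) → λ(W₁) ⊗ λ(W₂)` and `-1` otherwise. It is
computed in bases; the outcome does not depend on them. -/
def crossSign {V₁ V₂ W₁ W₂ : Type*} [AddCommGroup V₁] [Module ℝ V₁] [AddCommGroup V₂] [Module ℝ V₂]
    [AddCommGroup W₁] [Module ℝ W₁] [AddCommGroup W₂] [Module ℝ W₂] {n₁ n₂ m₁ m₂ : ℕ}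
    (pos₁ : (Fin n₁ → V₁) → (Fin m₁ → W₁) → Prop) (pos₂ : (Fin n₂ → V₂) → (Fin m₂ → W₂) → Prop)
    (A : V₁ →ₗ[ℝ] W₁ × W₂) (B : V₂ →ₗ[ℝ] W₁ × W₂) : ℤ :=
  signOf (∃ (b₁ : Basis (Fin n₁) ℝ V₁) (b₂ : Basis (Fin n₂) ℝ V₂)
    (c₁ : Basis (Fin m₁) ℝ W₁) (c₂ : Basis (Fin m₂) ℝ W₂) (h : m₁ + m₂ = n₁ + n₂),
    0 < (signOf (pos₁ b₁ c₁) * signOf (pos₂ b₂ c₂) : ℝ) *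
      ((c₁.prod c₂).reindex finSumFinEquiv).det
        (Fin.append (fun i => A (b₁ i)) (fun j => B (b₂ j)) ∘ Fin.cast h))

end Linear

/-! ### Relative orientations of maps -/

/-- A relative orientation of a continuous map `f : Z → X`: a continuous choice of homotopy classes
of isomorphisms `λ(T_u Z) → λ(T_{f u} X)`; continuity means that the classes are locally constant in
local trivializations of the tangent bundles. -/
structure RelOrientation {E H E' H' : Type*} [NormedAddCommGroup E] [NormedSpace ℝ E]
    [TopologicalSpace H] [NormedAddCommGroup E'] [NormedSpace ℝ E'] [TopologicalSpace H']
    (I : ModelWithCorners ℝ E H) (I' : ModelWithCorners ℝ E' H')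
    {Z X : Type*} [TopologicalSpace Z] [ChartedSpace H Z] [IsManifold I ∞ Z]
    [TopologicalSpace X] [ChartedSpace H' X] [IsManifold I' ∞ X] (f : Z → X) where
  at_ (u : Z) : LinearRelOrientation (TangentSpace I u) (TangentSpace I' (f u))
    (finrank ℝ E) (finrank ℝ E')
  locallyConstant : ∀ u₀ : Z,
    ∃ τ : Orientation ℝ E (Fin (finrank ℝ E)) → Orientation ℝ E' (Fin (finrank ℝ E')),
    ∀ᶠ u in 𝓝 u₀,
      ∀ (hu : u ∈ (trivializationAt E (TangentSpace I) u₀).baseSet)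
        (hx : f u ∈ (trivializationAt E' (TangentSpace I') (f u₀)).baseSet)
        (θ : Orientation ℝ (TangentSpace I u) (Fin (finrank ℝ E))),
        Orientation.map _ ((trivializationAt E' (TangentSpace I') (f u₀)).continuousLinearEquivAt ℝ
            (f u) hx).toLinearEquiv ((at_ u).toFun θ) =
          τ (Orientation.map _ ((trivializationAt E (TangentSpace I) u₀).continuousLinearEquivAt ℝ
            u hu).toLinearEquiv θ)

/-! ### Transversality -/

section Transverse

variable {E : Type*} [NormedAddCommGroup E] [NormedSpace ℝ E] {H : Type*} [TopologicalSpace H]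
  (I : ModelWithCorners ℝ E H) {Z : Type*} [TopologicalSpace Z] [ChartedSpace H Z]
  {E' : Type*} [NormedAddCommGroup E'] [NormedSpace ℝ E'] {H' : Type*} [TopologicalSpace H']
  (I' : ModelWithCorners ℝ E' H') {Υ : Type*} [TopologicalSpace Υ] [ChartedSpace H' Υ]
  {F : Type*} [NormedAddCommGroup F] [NormedSpace ℝ F] {G : Type*} [TopologicalSpace G]
  (J : ModelWithCorners ℝ F G) {Y : Type*} [TopologicalSpace Y] [ChartedSpace G Y]

/-- The differential `d_u f : T_u Z → T_{f u} Y`; each tangent space is read in the preferred chart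
at its base point. -/
def differential (f : Z → Y) (u : Z) : E →ₗ[ℝ] F :=
  (mfderiv I J f u).toLinearMap

/-- The differential at `u ∈ ∂Z` of the restriction of `f` to `∂Z`. -/
def boundaryDifferential (f : Z → Y) (u : Z) : boundaryTangent I →ₗ[ℝ] F :=
  (differential I J f u).domRestrict (boundaryTangent I)

/-- `f` is transverse to `g`. -/
def Transverse (f : Z → Y) (g : Υ → Y) : Prop :=
  ∀ u P, f u = g P →
    (differential I J f u).range ⊔ (differential I' J g P).range = ⊤

/-- `f` is transverse to the restriction of `g` to the boundary of its domain. -/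
def TransverseBoundary (f : Z → Y) (g : Υ → Y) : Prop :=
  ∀ u, ∀ P ∈ I'.boundary Υ, f u = g P →
    (differential I J f u).range ⊔ (boundaryDifferential I' J g P).range = ⊤

/-- The restrictions of `f` and `g` to the boundaries of their domains are transverse. -/
def BoundaryTransverseBoundary (f : Z → Y) (g : Υ → Y) : Prop :=
  ∀ u ∈ I.boundary Z, ∀ P ∈ I'.boundary Υ, f u = g P →
    (boundaryDifferential I J f u).range ⊔ (boundaryDifferential I' J g P).range = ⊤

/-- `f` and `g` are smooth, and `f` and `f|∂Z` are transverse to `g` and `g|∂Υ`. -/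
structure StronglyTransverse (f : Z → Y) (g : Υ → Y) : Prop where
  smooth_left : ContMDiff I J ∞ f
  smooth_right : ContMDiff I' J ∞ g
  transverse : Transverse I I' J f g
  transverse_boundary : TransverseBoundary I I' J f g
  boundary_transverse : TransverseBoundary I' I J g f
  boundary_transverse_boundary : BoundaryTransverseBoundary I I' J f g

/-! ### Pseudocycles -/

/-- The limit set of `f`. -/
def limitSet (f : Z → Y) : Set Y :=
  ⋂ (K : Set Z) (_ : IsCompact K), closure (f '' Kᶜ)

/-- A smooth map into `Y` from a manifold (Hausdorff, second countable, without boundary, possibly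
empty). A manifold has at most the cardinality of the continuum, so `Type` is large enough. -/
structure SmoothMapInto (Y : Type*) [TopologicalSpace Y] [ChartedSpace G Y] where
  dim : ℕ
  carrier : Type
  [topology : TopologicalSpace carrier]
  [charted : ChartedSpace (EuclideanSpace ℝ (Fin dim)) carrier]
  [manifold : IsManifold (𝓡 dim) ∞ carrier]
  [hausdorff : T2Space carrier]
  [secondCountable : SecondCountableTopology carrier]
  map : carrier → Y
  smooth : ContMDiff (𝓡 dim) J ∞ map

attribute [instance] SmoothMapInto.topology SmoothMapInto.charted SmoothMapInto.manifold
  SmoothMapInto.hausdorff SmoothMapInto.secondCountable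

/-- The dimension of the domain is at most `n - 2`; the empty manifold has every dimension. -/
def SmoothMapInto.DimLeSubTwo {J : ModelWithCorners ℝ F G} (h : SmoothMapInto J Y) (n : ℕ) : Prop :=
  Nonempty h.carrier → h.dim + 2 ≤ n

/-- `f` is a bordered `ℤ₂`-pseudocycle whose boundary is its restriction to `Z₀ ⊆ ∂Z`. -/
structure IsBorderedPseudocycle (f : Z → Y) (Z₀ : Set Z) : Prop where
  continuous : Continuous f
  isCompact_closure : IsCompact (closure (range f))
  subset_boundary : Z₀ ⊆ I.boundary Z
  exists_map : ∃ h : SmoothMapInto J Y, h.DimLeSubTwo (finrank ℝ E) ∧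
    limitSet f ⊆ range h.map ∧ f '' (I.boundary Z \ Z₀) ⊆ J.boundary Y ∪ range h.map

/-- `f` and `g` are transverse as bordered `ℤ₂`-pseudocycles: they are strongly transverse, and their
limit sets are covered by smooth maps `h₁`, `h₂` from manifolds of codimension at least `2` such that
`h₁` is transverse to `g`, `g|∂Υ`, `h₂` to `f`, `f|∂Z`, and `h₁` to `h₂`. -/
structure TransversePseudocycles (f : Z → Y) (g : Υ → Y) : Prop where
  stronglyTransverse : StronglyTransverse I I' J f g
  exists_maps : ∃ h₁ h₂ : SmoothMapInto J Y,
    h₁.DimLeSubTwo (finrank ℝ E) ∧ h₂.DimLeSubTwo (finrank ℝ E') ∧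
    limitSet f ⊆ range h₁.map ∧ limitSet g ⊆ range h₂.map ∧
    Transverse (𝓡 h₁.dim) I' J h₁.map g ∧ TransverseBoundary (𝓡 h₁.dim) I' J h₁.map g ∧
    Transverse (𝓡 h₂.dim) I J h₂.map f ∧ TransverseBoundary (𝓡 h₂.dim) I J h₂.map f ∧
    Transverse (𝓡 h₁.dim) (𝓡 h₂.dim) J h₁.map h₂.map

/-! ### Fiber products with the boundary -/

/-- The fiber product of `f` and `g|∂Υ`. -/
def fiberProdBoundary (f : Z → Y) (g : Υ → Y) : Set (Z × Υ) :=
  {p | p.2 ∈ I'.boundary Υ ∧ f p.1 = g p.2}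

/-- The fiber product of `f|∂Z` and `g`. -/
def boundaryFiberProd (f : Z → Y) (g : Υ → Y) : Set (Z × Υ) :=
  {p | p.1 ∈ I.boundary Z ∧ f p.1 = g p.2}

end Transverse

/-! ### Intersection signs at boundary points -/

section Signs

variable {E₁ H₁ E₂ H₂ F₁ G₁ F₂ G₂ : Type*}
  [NormedAddCommGroup E₁] [NormedSpace ℝ E₁] [TopologicalSpace H₁]
  [NormedAddCommGroup E₂] [NormedSpace ℝ E₂] [TopologicalSpace H₂]
  [NormedAddCommGroup F₁] [NormedSpace ℝ F₁] [TopologicalSpace G₁]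
  [NormedAddCommGroup F₂] [NormedSpace ℝ F₂] [TopologicalSpace G₂]
  {I₁ : ModelWithCorners ℝ E₁ H₁} {I₂ : ModelWithCorners ℝ E₂ H₂}
  {J₁ : ModelWithCorners ℝ F₁ G₁} {J₂ : ModelWithCorners ℝ F₂ G₂}
  {Z Υ X M : Type*}
  [TopologicalSpace Z] [ChartedSpace H₁ Z] [IsManifold I₁ ∞ Z]
  [TopologicalSpace Υ] [ChartedSpace H₂ Υ] [IsManifold I₂ ∞ Υ]
  [TopologicalSpace X] [ChartedSpace G₁ X] [IsManifold J₁ ∞ X]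
  [TopologicalSpace M] [ChartedSpace G₂ M] [IsManifold J₂ ∞ M]

/-- The class of a relative orientation at `u`, with the tangent spaces read in the preferred
charts. -/
def RelOrientation.linear {f : Z → X} (o : RelOrientation I₁ J₁ f) (u : Z) :
    LinearRelOrientation E₁ F₁ (finrank ℝ E₁) (finrank ℝ F₁) :=
  o.at_ u

/-- The sign of `(u, P)`, `P ∈ ∂Υ`, in the fiber product of `f` and `g|∂Υ`, with respect to `o₁`
and `∂o₂`. -/
def signRight (f : Z → X × M) (g : Υ → X × M)
    (o₁ : RelOrientation I₁ J₁ (fun u => (f u).1)) (o₂ : RelOrientation I₂ J₂ (fun P => (g P).2))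
    (p : Z × Υ) : ℤ :=
  crossSign (o₁.linear p.1).Pos ((o₂.linear p.2).BoundaryPos I₂)
    (differential I₁ (J₁.prod J₂) f p.1) (boundaryDifferential I₂ (J₁.prod J₂) g p.2)

/-- The sign of `(u, P)`, `u ∈ ∂Z`, in the fiber product of `f|∂Z` and `g`, with respect to `∂o₁`
and `o₂`. -/
def signLeft (f : Z → X × M) (g : Υ → X × M)
    (o₁ : RelOrientation I₁ J₁ (fun u => (f u).1)) (o₂ : RelOrientation I₂ J₂ (fun P => (g P).2))
    (p : Z × Υ) : ℤ :=
  crossSign ((o₁.linear p.1).BoundaryPos I₁) (o₂.linear p.2).Pos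
    (boundaryDifferential I₁ (J₁.prod J₂) f p.1) (differential I₂ (J₁.prod J₂) g p.2)

end Signs

end Steenrod

end

/-!
The fiber product `N` of `f` and `g` is compact, and near each of its points it is an arc of an
oriented curve. The orientation at `x` is recorded by a covector `ξ x` on the product of the charts
that completes the equation `d f - d g = 0` to a positive isomorphism; the points of `N` on which
`ξ x` is smaller, respectively larger, than at `x` give filters of left and of right germs.

Instead of classifying compact curves, we count ends by jumps of integer step functions: the end
sign of `x` is the jump at `x` of the constant function `1`. Along one arc the jumps of a function
supported on it telescope to `0`. Removing the parts of `1` on finitely many arcs covering `N`, one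
after the other, shows that the end signs add up to `0`. The ends of `N` are the points of the two
boundary fiber products, and there the outward normal convention compares the end sign `ε` with the
intersection sign: it is `-(-1) ^ dim Υ * ε` when `Υ` contributes the boundary point and `ε` when
`Z` does.
-/

namespace Steenrod

open Filter Asymptotics
open scoped NNReal

/-! ### Jumps of step functions along arcs -/

section Jumps

variable {α β : Type*} {F : Filter α} {h h' : α → ℤ} {m : ℤ}

/-- The eventual value of `h` along the filter `F`. On `F = ⊥`, and when there is no such value,
this is the junk value `0` of the infimum of an unbounded or empty set of integers. -/
noncomputable def germValue (F : Filter α) (h : α → ℤ) : ℤ :=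
  sInf {m | ∀ᶠ y in F, h y = m}

theorem germValue_bot (h : α → ℤ) : germValue ⊥ h = 0 := by
  simp [germValue]

theorem germValue_eq [NeBot F] (hm : ∀ᶠ y in F, h y = m) : germValue F h = m := by
  have : {n | ∀ᶠ y in F, h y = n} = {m} := by
    ext n
    refine ⟨fun hn => ?_, fun hn => by rwa [mem_singleton_iff.1 hn]⟩
    obtain ⟨y, hyn, hym⟩ := (hn.and hm).exists
    exact hyn.symm.trans hym
  rw [germValue, this, csInf_singleton]

theorem germValue_eq_zero (h0 : ∀ᶠ y in F, h y = 0) : germValue F h = 0 := by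
  rcases F.eq_or_neBot with rfl | hF
  exacts [germValue_bot h, germValue_eq h0]

theorem germValue_congr (hh : h =ᶠ[F] h') : germValue F h = germValue F h' := by
  have : {m | ∀ᶠ y in F, h y = m} = {m | ∀ᶠ y in F, h' y = m} :=
    Set.ext fun m => eventually_congr (hh.mono fun y hy => by rw [hy])
  rw [germValue, germValue, this]

theorem germValue_map (γ : β → α) (F : Filter β) (h : α → ℤ) :
    germValue (map γ F) h = germValue F (h ∘ γ) :=
  rfl

theorem germValue_sub (hh : EventuallyConst h F) (hh' : EventuallyConst h' F) :
    germValue F (h - h') = germValue F h - germValue F h' := by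
  rcases F.eq_or_neBot with rfl | hF
  · simp only [germValue_bot, sub_zero]
  · obtain ⟨m, hm⟩ := eventuallyConst_iff_exists_eventuallyEq.1 hh
    obtain ⟨m', hm'⟩ := eventuallyConst_iff_exists_eventuallyEq.1 hh'
    rw [germValue_eq hm, germValue_eq hm', germValue_eq (m := m - m') (hm.sub hm')]

/-- The jump of `h` at `x`, where `L x` and `R x` are the filters of left and of right germs. -/
noncomputable def jump (L R : α → Filter α) (h : α → ℤ) (x : α) : ℤ :=
  germValue (L x) h - germValue (R x) h

/-- A step function on `N`: it is eventually constant along the left and the right germs at every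
point of `N`. -/
def IsStep (N : Set α) (L R : α → Filter α) (h : α → ℤ) : Prop :=
  ∀ x ∈ N, EventuallyConst h (L x) ∧ EventuallyConst h (R x)

variable {N : Set α} {L R : α → Filter α}

theorem IsStep.sub (hh : IsStep N L R h) (hh' : IsStep N L R h') : IsStep N L R (h - h') :=
  fun x hx => ⟨(hh x hx).1.comp₂ (· - ·) (hh' x hx).1, (hh x hx).2.comp₂ (· - ·) (hh' x hx).2⟩

theorem jump_sub (hh : IsStep N L R h) (hh' : IsStep N L R h') {x : α} (hx : x ∈ N) :
    jump L R (h - h') x = jump L R h x - jump L R h' x := by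
  rw [jump, germValue_sub (hh x hx).1 (hh' x hx).1, germValue_sub (hh x hx).2 (hh' x hx).2, jump,
    jump]
  ring

theorem jump_congr {x : α} (hL : h =ᶠ[L x] h') (hR : h =ᶠ[R x] h') :
    jump L R h x = jump L R h' x := by
  rw [jump, jump, germValue_congr hL, germValue_congr hR]

/-- The sign of `x` as an end point of `N`: `+1` if it is a final point, `-1` if it is an initial
point, and `0` if it is neither. -/
noncomputable def endSign (L R : α → Filter α) (x : α) : ℤ :=
  jump L R 1 x

theorem endSign_of_neBot {x : α} [NeBot (L x)] [NeBot (R x)] : endSign L R x = 0 := by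
  rw [endSign, jump, germValue_eq (m := 1) (by simp), germValue_eq (m := 1) (by simp), sub_self]

theorem endSign_of_right_eq_bot {x : α} [NeBot (L x)] (hR : R x = ⊥) : endSign L R x = 1 := by
  rw [endSign, jump, hR, germValue_bot, germValue_eq (m := 1) (by simp), sub_zero]

theorem endSign_of_left_eq_bot {x : α} [NeBot (R x)] (hL : L x = ⊥) : endSign L R x = -1 := by
  rw [endSign, jump, hL, germValue_bot, germValue_eq (m := 1) (by simp), zero_sub]

theorem isStep_one : IsStep N L R 1 :=
  fun _ _ => ⟨EventuallyConst.const 1, EventuallyConst.const 1⟩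

end Jumps

section Line

variable {k : ℝ → ℤ} {a b : ℝ}

theorem eventually_germValue_eq {s : Set ℝ} (hs : IsOpen s) {t : ℝ} [NeBot (𝓝[s] t)]
    (hk : EventuallyConst k (𝓝[s] t)) :
    ∀ᶠ y in 𝓝[s] t,
      germValue (𝓝[<] y) k = germValue (𝓝[s] t) k ∧ jump (𝓝[<] ·) (𝓝[>] ·) k y = 0 := by
  obtain ⟨m, hm⟩ := eventuallyConst_iff_exists_eventuallyEq.1 hk
  filter_upwards [eventually_eventually_nhdsWithin.2 hm, self_mem_nhdsWithin] with y hy hys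
  rw [hs.nhdsWithin_eq hys] at hy
  rw [jump, germValue_eq hm, germValue_eq (hy.filter_mono nhdsWithin_le_nhds),
    germValue_eq (hy.filter_mono nhdsWithin_le_nhds), sub_self]
  exact ⟨rfl, rfl⟩

theorem germValue_nhdsLT_eq_zero_and_jump_eq_zero (hk : ∀ t ∉ Icc a b, k t = 0) {t : ℝ}
    (ht : t ∉ Icc a b) : germValue (𝓝[<] t) k = 0 ∧ jump (𝓝[<] ·) (𝓝[>] ·) k t = 0 := by
  have h0 : ∀ᶠ z in 𝓝 t, k z = 0 :=
    (isClosed_Icc.isOpen_compl.eventually_mem ht).mono hk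
  rw [jump, germValue_eq (h0.filter_mono nhdsWithin_le_nhds),
    germValue_eq (h0.filter_mono nhdsWithin_le_nhds)]
  exact ⟨rfl, rfl⟩

theorem IsStep.finite_support_jump (hk : ∀ t ∉ Icc a b, k t = 0)
    (hs : IsStep univ (𝓝[<] ·) (𝓝[>] ·) k) :
    (jump (𝓝[<] ·) (𝓝[>] ·) k).support.Finite := by
  by_contra hinf
  have hsub : (jump (𝓝[<] ·) (𝓝[>] ·) k).support ⊆ Icc a b := fun t ht =>
    by_contra fun h => ht (germValue_nhdsLT_eq_zero_and_jump_eq_zero hk h).2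
  obtain ⟨t, -, hacc⟩ := Set.Infinite.exists_accPt_of_subset_isCompact hinf isCompact_Icc hsub
  rw [accPt_iff_frequently_nhdsNE, ← Iio_union_Ioi, nhdsWithin_union] at hacc
  refine hacc (eventually_sup.2 ⟨?_, ?_⟩)
  · exact (eventually_germValue_eq isOpen_Iio (hs t trivial).1).mono fun y hy => not_not.2 hy.2
  · exact (eventually_germValue_eq isOpen_Ioi (hs t trivial).2).mono fun y hy => not_not.2 hy.2

theorem finsum_mem_eq_of_subset_of_forall_eq_zero {α : Type*} {s t : Set α} {J : α → ℤ}
    (hst : s ⊆ t) (h0 : ∀ x ∈ t, x ∉ s → J x = 0) : ∑ᶠ x ∈ s, J x = ∑ᶠ x ∈ t, J x :=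
  finsum_mem_inter_support_eq' J s t fun x hx =>
    ⟨fun h => hst h, fun hxt => by_contra fun hxs => hx (h0 x hxt hxs)⟩

theorem eventually_finsum_Iio_eq_left {J : ℝ → ℤ} {x : ℝ} (h0 : ∀ᶠ y in 𝓝[<] x, J y = 0) :
    ∀ᶠ y in 𝓝[<] x, ∑ᶠ t ∈ Iio y, J t = ∑ᶠ t ∈ Iio x, J t := by
  obtain ⟨c, hc, hsub⟩ := mem_nhdsLT_iff_exists_Ioo_subset.1 h0
  filter_upwards [Ioo_mem_nhdsLT hc] with y hy
  refine finsum_mem_inter_support_eq' J _ _ fun t ht => ⟨fun h => h.trans hy.2, fun h => ?_⟩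
  by_contra hty
  exact ht (hsub ⟨hy.1.trans_le (not_lt.1 hty), h⟩)

theorem eventually_finsum_Iio_eq_right {J : ℝ → ℤ} (hJ : J.support.Finite) {x : ℝ}
    (h0 : ∀ᶠ y in 𝓝[>] x, J y = 0) :
    ∀ᶠ y in 𝓝[>] x, ∑ᶠ t ∈ Iio y, J t = J x + ∑ᶠ t ∈ Iio x, J t := by
  obtain ⟨c, hc, hsub⟩ := mem_nhdsGT_iff_exists_Ioo_subset.1 h0
  filter_upwards [Ioo_mem_nhdsGT hc] with y hy
  rw [← finsum_mem_insert' J self_notMem_Iio (hJ.subset inter_subset_right), Iio_insert]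
  refine finsum_mem_inter_support_eq' J _ _ fun t ht =>
    ⟨fun h => ?_, fun h => (mem_Iic.1 h).trans_lt hy.1⟩
  by_contra htx
  exact ht (hsub ⟨not_le.1 htx, (mem_Iio.1 h).trans hy.2⟩)

theorem isLocallyConstant_finsum_jump_add_germValue
    (hJ : (jump (𝓝[<] ·) (𝓝[>] ·) k).support.Finite) (hs : IsStep univ (𝓝[<] ·) (𝓝[>] ·) k) :
    IsLocallyConstant fun x : ℝ =>
      ∑ᶠ t ∈ Iio x, jump (𝓝[<] ·) (𝓝[>] ·) k t + germValue (𝓝[<] x) k := by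
  refine (IsLocallyConstant.iff_eventually_eq _).2 fun x => ?_
  have hl := eventually_germValue_eq isOpen_Iio (hs x trivial).1
  have hr := eventually_germValue_eq isOpen_Ioi (hs x trivial).2
  rw [← nhdsLT_sup_nhdsGE, ← nhdsGT_sup_nhdsWithin_singleton, nhdsWithin_singleton, eventually_sup,
    eventually_sup, eventually_pure]
  refine ⟨?_, ?_, rfl⟩
  · filter_upwards [hl, eventually_finsum_Iio_eq_left (hl.mono fun y hy => hy.2)] with y hy hsum
    rw [hy.1, hsum]
  · filter_upwards [hr, eventually_finsum_Iio_eq_right hJ (hr.mono fun y hy => hy.2)] with y hy hsum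
    rw [hy.1, hsum, jump]
    ring

theorem finsum_jump_eq_zero_of_support_subset_Icc (hk : ∀ t ∉ Icc a b, k t = 0)
    (hs : IsStep univ (𝓝[<] ·) (𝓝[>] ·) k) : ∑ᶠ t, jump (𝓝[<] ·) (𝓝[>] ·) k t = 0 := by
  have hout {t : ℝ} (ht : t ∉ Icc a b) := germValue_nhdsLT_eq_zero_and_jump_eq_zero hk ht
  have hG := (isLocallyConstant_finsum_jump_add_germValue (hs.finite_support_jump hk) hs)
    |>.apply_eq_of_preconnectedSpace (a - 1) (b + 1)
  have hbefore : ∑ᶠ t ∈ Iio (a - 1), jump (𝓝[<] ·) (𝓝[>] ·) k t = 0 :=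
    finsum_mem_eq_zero_of_forall_eq_zero fun t ht =>
      (hout fun h => by linarith [h.1, mem_Iio.1 ht]).2
  have hafter : ∑ᶠ t ∈ Iio (b + 1), jump (𝓝[<] ·) (𝓝[>] ·) k t =
      ∑ᶠ t, jump (𝓝[<] ·) (𝓝[>] ·) k t :=
    (finsum_mem_eq_of_subset_of_forall_eq_zero (subset_univ _) fun t _ ht =>
      (hout fun h => ht (h.2.trans_lt (lt_add_one b))).2).trans (finsum_mem_univ _)
  rwa [hbefore, hafter, (hout fun h => by linarith [h.1]).1, (hout fun h => by linarith [h.2]).1,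
    add_zero, add_zero, eq_comm] at hG

end Line

section Arcs

variable {α : Type*}

theorem indicator_image_comp_eqOn (γ : ℝ → α) (h : α → ℤ) (a b : ℝ) :
    EqOn ((γ '' Icc a b).indicator h ∘ γ) ((Icc a b).indicator (h ∘ γ)) (Icc a b) :=
  fun t ht => by rw [Function.comp_apply, indicator_of_mem (mem_image_of_mem γ ht),
    indicator_of_mem ht, Function.comp_apply]

theorem indicator_Icc_neg_comp_neg (k : ℝ → ℤ) (a b : ℝ) :
    (Icc (-b) (-a)).indicator (k ∘ Neg.neg) = (Icc a b).indicator k ∘ Neg.neg := by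
  rw [← neg_Icc]
  rfl

theorem map_neg_nhdsLT_neg (t : ℝ) : map Neg.neg (𝓝[<] (-t)) = 𝓝[>] t :=
  neg_nhdsLT.trans (by rw [neg_neg])

theorem indicator_Icc_eventuallyEq_zero {k : ℝ → ℤ} {a b t : ℝ} (ht : t ∉ Ioc a b) :
    (Icc a b).indicator k =ᶠ[𝓝[<] t] 0 := by
  rcases le_or_gt t a with hta | hat
  · filter_upwards [self_mem_nhdsWithin] with y hy
    exact indicator_of_notMem (fun h => (hta.trans h.1).not_gt hy) _
  · filter_upwards [Ioo_mem_nhdsLT (lt_of_not_ge fun h => ht ⟨hat, h⟩ : b < t)] with y hy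
    exact indicator_of_notMem (fun h => h.2.not_gt hy.1) _

variable [TopologicalSpace α]

/-- `γ : [a, b] → N` is an injective arc along which the filters `L` and `R` of left and right germs
of `N` are those of the interval; no germ leaving the arc at an end point stays on the arc. -/
structure IsArc (N : Set α) (L R : α → Filter α) (γ : ℝ → α) (a b : ℝ) : Prop where
  continuousOn : ContinuousOn γ (Icc a b)
  injOn : InjOn γ (Icc a b)
  mapsTo : MapsTo γ (Icc a b) N
  left : ∀ t ∈ Ioc a b, L (γ t) = map γ (𝓝[<] t)
  left_end : ∀ᶠ y in L (γ a), y ∉ γ '' Icc a b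
  right : ∀ t ∈ Ico a b, R (γ t) = map γ (𝓝[>] t)
  right_end : ∀ᶠ y in R (γ b), y ∉ γ '' Icc a b

/-- Some arc of `N` is a neighborhood of `p` in `N`. The arc may start or end at `p`, in which case
`p` is an end point of `N`. -/
def HasArcNhd (N : Set α) (L R : α → Filter α) (p : α) : Prop :=
  ∃ γ a b, IsArc N L R γ a b ∧ γ '' Icc a b ∈ 𝓝[N] p

namespace IsArc

variable {N : Set α} {L R : α → Filter α} {γ : ℝ → α} {a b t : ℝ} {h : α → ℤ}

theorem reverse (hγ : IsArc N L R γ a b) : IsArc N R L (γ ∘ Neg.neg) (-b) (-a) where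
  continuousOn := hγ.continuousOn.comp continuous_neg.continuousOn
    fun t ht => ⟨le_neg_of_le_neg ht.2, neg_le.1 ht.1⟩
  injOn := hγ.injOn.comp neg_injective.injOn fun t ht => ⟨le_neg_of_le_neg ht.2, neg_le.1 ht.1⟩
  mapsTo := hγ.mapsTo.comp fun t ht => ⟨le_neg_of_le_neg ht.2, neg_le.1 ht.1⟩
  left t ht := by
    rw [Function.comp_apply, hγ.right (-t) ⟨le_neg_of_le_neg ht.2, neg_lt.1 ht.1⟩, ← map_map]
    exact congrArg (map γ) neg_nhdsLT.symm
  left_end := by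
    rw [Function.comp_apply, image_comp, image_neg_Icc, neg_neg, neg_neg]
    exact hγ.right_end
  right t ht := by
    rw [Function.comp_apply, hγ.left (-t) ⟨lt_neg_of_lt_neg ht.2, neg_le.1 ht.1⟩, ← map_map]
    exact congrArg (map γ) neg_nhdsGT.symm
  right_end := by
    rw [Function.comp_apply, image_comp, image_neg_Icc, neg_neg, neg_neg]
    exact hγ.left_end

theorem isClosed_image [T2Space α] (hγ : IsArc N L R γ a b) : IsClosed (γ '' Icc a b) :=
  (isCompact_Icc.image_of_continuousOn hγ.continuousOn).isClosed

theorem germ_left (hγ : IsArc N L R γ a b) (ht : t ∈ Icc a b) (h : α → ℤ) :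
    germValue (L (γ t)) ((γ '' Icc a b).indicator h) =
        germValue (𝓝[<] t) ((Icc a b).indicator (h ∘ γ)) ∧
      (EventuallyConst ((Icc a b).indicator (h ∘ γ)) (𝓝[<] t) →
        EventuallyConst ((γ '' Icc a b).indicator h) (L (γ t))) := by
  rcases ht.1.eq_or_lt with rfl | hat
  · have h0 : (γ '' Icc a b).indicator h =ᶠ[L (γ a)] 0 :=
      hγ.left_end.mono fun y hy => indicator_of_notMem hy h
    exact ⟨by rw [germValue_eq_zero h0,
      germValue_eq_zero (indicator_Icc_eventuallyEq_zero (by simp))],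
      fun _ => (EventuallyConst.const 0).congr h0.symm⟩
  · have heq : (γ '' Icc a b).indicator h ∘ γ =ᶠ[𝓝[<] t] (Icc a b).indicator (h ∘ γ) := by
      filter_upwards [Ioo_mem_nhdsLT hat] with y hy
      exact indicator_image_comp_eqOn γ h a b ⟨hy.1.le, hy.2.le.trans ht.2⟩
    rw [hγ.left t ⟨hat, ht.2⟩, germValue_map]
    exact ⟨germValue_congr heq, fun hk => hk.congr heq.symm⟩

theorem germ_right (hγ : IsArc N L R γ a b) (ht : t ∈ Icc a b) (h : α → ℤ) :
    germValue (R (γ t)) ((γ '' Icc a b).indicator h) =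
        germValue (𝓝[>] t) ((Icc a b).indicator (h ∘ γ)) ∧
      (EventuallyConst ((Icc a b).indicator (h ∘ γ)) (𝓝[>] t) →
        EventuallyConst ((γ '' Icc a b).indicator h) (R (γ t))) := by
  have hrev := hγ.reverse.germ_left (t := -t) ⟨neg_le_neg ht.2, neg_le_neg ht.1⟩ h
  rw [Function.comp_apply, neg_neg, image_comp, image_neg_Icc, neg_neg, neg_neg,
    ← Function.comp_assoc, indicator_Icc_neg_comp_neg] at hrev
  rwa [← map_neg_nhdsLT_neg]

theorem jump_indicator (hγ : IsArc N L R γ a b) (ht : t ∈ Icc a b) (h : α → ℤ) :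
    jump L R ((γ '' Icc a b).indicator h) (γ t) =
      jump (𝓝[<] ·) (𝓝[>] ·) ((Icc a b).indicator (h ∘ γ)) t :=
  congrArg₂ (· - ·) (hγ.germ_left ht h).1 (hγ.germ_right ht h).1

theorem eventuallyConst_left (hγ : IsArc N L R γ a b) (hh : IsStep N L R h) (t : ℝ) :
    EventuallyConst ((Icc a b).indicator (h ∘ γ)) (𝓝[<] t) := by
  by_cases ht : t ∈ Ioc a b
  · have hconst : EventuallyConst (h ∘ γ) (𝓝[<] t) := by
      have := (hh _ (hγ.mapsTo ⟨ht.1.le, ht.2⟩)).1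
      rwa [hγ.left t ht] at this
    refine hconst.congr ?_
    filter_upwards [Ioo_mem_nhdsLT ht.1] with y hy
    exact (indicator_of_mem (mem_Icc.2 ⟨hy.1.le, hy.2.le.trans ht.2⟩) _).symm
  · exact (EventuallyConst.const 0).congr (indicator_Icc_eventuallyEq_zero ht).symm

theorem eventuallyConst_right (hγ : IsArc N L R γ a b) (hh : IsStep N L R h) (t : ℝ) :
    EventuallyConst ((Icc a b).indicator (h ∘ γ)) (𝓝[>] t) := by
  have hrev := hγ.reverse.eventuallyConst_left (fun x hx => (hh x hx).symm) (-t)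
  rw [← Function.comp_assoc, indicator_Icc_neg_comp_neg] at hrev
  rwa [← map_neg_nhdsLT_neg]

theorem isStep_indicator [T2Space α] (hγ : IsArc N L R γ a b) (hL : ∀ x ∈ N, L x ≤ 𝓝 x)
    (hR : ∀ x ∈ N, R x ≤ 𝓝 x) (hh : IsStep N L R h) :
    IsStep N L R ((γ '' Icc a b).indicator h) := by
  intro x hx
  by_cases hxC : x ∈ γ '' Icc a b
  · obtain ⟨t, ht, rfl⟩ := hxC
    exact ⟨(hγ.germ_left ht h).2 (hγ.eventuallyConst_left hh t),
      (hγ.germ_right ht h).2 (hγ.eventuallyConst_right hh t)⟩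
  · have h0 : ∀ᶠ y in 𝓝 x, (γ '' Icc a b).indicator h y = 0 :=
      (hγ.isClosed_image.isOpen_compl.eventually_mem hxC).mono fun y hy => indicator_of_notMem hy h
    exact ⟨(EventuallyConst.const 0).congr (EventuallyEq.symm (h0.filter_mono (hL x hx))),
      (EventuallyConst.const 0).congr (EventuallyEq.symm (h0.filter_mono (hR x hx)))⟩

theorem jump_indicator_eq_zero [T2Space α] (hγ : IsArc N L R γ a b) {x : α} (hL : L x ≤ 𝓝 x)
    (hR : R x ≤ 𝓝 x) (hx : x ∉ γ '' Icc a b) : jump L R ((γ '' Icc a b).indicator h) x = 0 := by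
  have h0 : ∀ᶠ y in 𝓝 x, (γ '' Icc a b).indicator h y = 0 :=
    (hγ.isClosed_image.isOpen_compl.eventually_mem hx).mono fun y hy => indicator_of_notMem hy h
  rw [jump, germValue_eq_zero (h0.filter_mono hL), germValue_eq_zero (h0.filter_mono hR), sub_self]

theorem finite_jump_indicator [T2Space α] (hγ : IsArc N L R γ a b) (hL : ∀ x ∈ N, L x ≤ 𝓝 x)
    (hR : ∀ x ∈ N, R x ≤ 𝓝 x) (hh : IsStep N L R h) :
    {x ∈ N | jump L R ((γ '' Icc a b).indicator h) x ≠ 0}.Finite := by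
  have hk : IsStep univ (𝓝[<] ·) (𝓝[>] ·) ((Icc a b).indicator (h ∘ γ)) := fun t _ =>
    ⟨hγ.eventuallyConst_left hh t, hγ.eventuallyConst_right hh t⟩
  refine ((hk.finite_support_jump fun t ht => indicator_of_notMem ht _).image γ).subset ?_
  rintro x ⟨hxN, hx⟩
  obtain ⟨t, ht, rfl⟩ := by_contra fun hxC =>
    hx (hγ.jump_indicator_eq_zero (hL x hxN) (hR x hxN) hxC)
  exact ⟨t, by rwa [Function.mem_support, ← hγ.jump_indicator ht], rfl⟩

theorem finsum_jump_indicator [T2Space α] (hγ : IsArc N L R γ a b) (hL : ∀ x ∈ N, L x ≤ 𝓝 x)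
    (hR : ∀ x ∈ N, R x ≤ 𝓝 x) (hh : IsStep N L R h) :
    ∑ᶠ x ∈ N, jump L R ((γ '' Icc a b).indicator h) x = 0 := by
  have hk0 : ∀ t ∉ Icc a b, (Icc a b).indicator (h ∘ γ) t = 0 := fun t ht =>
    indicator_of_notMem ht _
  have hsub : ∑ᶠ x ∈ γ '' Icc a b, jump L R ((γ '' Icc a b).indicator h) x =
      ∑ᶠ x ∈ N, jump L R ((γ '' Icc a b).indicator h) x :=
    finsum_mem_eq_of_subset_of_forall_eq_zero hγ.mapsTo.image_subset fun x hxN hx =>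
      hγ.jump_indicator_eq_zero (hL x hxN) (hR x hxN) hx
  have hIcc : ∑ᶠ t ∈ Icc a b, jump (𝓝[<] ·) (𝓝[>] ·) ((Icc a b).indicator (h ∘ γ)) t =
      ∑ᶠ t, jump (𝓝[<] ·) (𝓝[>] ·) ((Icc a b).indicator (h ∘ γ)) t :=
    (finsum_mem_eq_of_subset_of_forall_eq_zero (subset_univ _) fun t _ ht =>
      (germValue_nhdsLT_eq_zero_and_jump_eq_zero hk0 ht).2).trans (finsum_mem_univ _)
  rw [← hsub, finsum_mem_image hγ.injOn, finsum_mem_congr rfl fun t ht => hγ.jump_indicator ht h,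
    hIcc, finsum_jump_eq_zero_of_support_subset_Icc hk0 fun t _ =>
      ⟨hγ.eventuallyConst_left hh t, hγ.eventuallyConst_right hh t⟩]

end IsArc

variable {N : Set α} {L R : α → Filter α} {h : α → ℤ}

theorem jump_eq_jump_indicator {C : Set α} {x : α} (hL : L x ≤ 𝓝[N] x) (hR : R x ≤ 𝓝[N] x)
    (hC : C ∈ 𝓝[N] x) : jump L R h x = jump L R (C.indicator h) x := by
  have heq : h =ᶠ[𝓝[N] x] C.indicator h := by
    filter_upwards [hC] with y hy using (indicator_of_mem hy h).symm
  exact jump_congr (heq.filter_mono hL) (heq.filter_mono hR)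

theorem IsStep.finite_jump [T2Space α] (hN : IsCompact N) (hL : ∀ x ∈ N, L x ≤ 𝓝[N] x)
    (hR : ∀ x ∈ N, R x ≤ 𝓝[N] x) (harc : ∀ p ∈ N, HasArcNhd N L R p) (hh : IsStep N L R h) :
    {x ∈ N | jump L R h x ≠ 0}.Finite := by
  refine hN.induction_on (p := fun s => {x ∈ s | x ∈ N ∧ jump L R h x ≠ 0}.Finite) (by simp)
    (fun s t hst ht => ht.subset fun x hx => ⟨hst hx.1, hx.2⟩)
    (fun s t hs ht => (hs.union ht).subset fun x hx => hx.1.imp (⟨·, hx.2⟩) (⟨·, hx.2⟩))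
    (fun p hp => ?_) |>.subset fun x hx => ⟨hx.1, hx⟩
  obtain ⟨γ, a, b, hγ, hCp⟩ := harc p hp
  refine ⟨_, eventually_eventually_nhdsWithin.2 hCp,
    (hγ.finite_jump_indicator (fun x hx => (hL x hx).trans nhdsWithin_le_nhds)
      (fun x hx => (hR x hx).trans nhdsWithin_le_nhds) hh).subset ?_⟩
  rintro x ⟨hCx, hxN, hx⟩
  exact ⟨hxN, fun h0 => hx ((jump_eq_jump_indicator (hL x hxN) (hR x hxN) hCx).trans h0)⟩

/-- Cutting `h` off arc by arc does not change the sum of its jumps, and leaves the zero function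
once the arcs are exhausted. -/
theorem finsum_jump_eq_zero_of_forall_notMem_arcs [T2Space α] (hL : ∀ x ∈ N, L x ≤ 𝓝[N] x)
    (hR : ∀ x ∈ N, R x ≤ 𝓝[N] x)
    (hfin : ∀ h, IsStep N L R h → {x ∈ N | jump L R h x ≠ 0}.Finite) {ι : Type*} (t : Finset ι)
    {γ : ι → ℝ → α} {a b : ι → ℝ} (hγ : ∀ i ∈ t, IsArc N L R (γ i) (a i) (b i))
    (hh : IsStep N L R h) (h0 : ∀ x ∈ N, (∀ i ∈ t, x ∉ γ i '' Icc (a i) (b i)) → h x = 0) :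
    ∑ᶠ x ∈ N, jump L R h x = 0 := by
  classical
  induction t using Finset.induction_on generalizing h with
  | empty =>
    have hN0 {x : α} : h =ᶠ[𝓝[N] x] 0 :=
      eventually_mem_nhdsWithin.mono fun y hy => h0 y hy (by simp)
    refine finsum_mem_eq_zero_of_forall_eq_zero fun x hx => ?_
    rw [jump, germValue_eq_zero (hN0.filter_mono (hL x hx)),
      germValue_eq_zero (hN0.filter_mono (hR x hx)), sub_self]
  | insert i t _ ih =>
    have hγi := hγ i (Finset.mem_insert_self i t)
    have hL' : ∀ x ∈ N, L x ≤ 𝓝 x := fun x hx => (hL x hx).trans nhdsWithin_le_nhds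
    have hR' : ∀ x ∈ N, R x ≤ 𝓝 x := fun x hx => (hR x hx).trans nhdsWithin_le_nhds
    have hcut := hγi.isStep_indicator hL' hR' hh
    have hrest : ∑ᶠ x ∈ N, jump L R (h - (γ i '' Icc (a i) (b i)).indicator h) x = 0 := by
      refine ih (fun j hj => hγ j (Finset.mem_insert_of_mem hj)) (hh.sub hcut) fun x hx hxt => ?_
      by_cases hxi : x ∈ γ i '' Icc (a i) (b i)
      · rw [Pi.sub_apply, indicator_of_mem hxi, sub_self]
      · rw [Pi.sub_apply, indicator_of_notMem hxi, sub_zero]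
        exact h0 x hx (Finset.forall_mem_insert _ _ _ |>.2 ⟨hxi, hxt⟩)
    have hsplit : ∀ x ∈ N, jump L R h x = jump L R (h - (γ i '' Icc (a i) (b i)).indicator h) x +
        jump L R ((γ i '' Icc (a i) (b i)).indicator h) x := fun x hx => by
      rw [jump_sub hh hcut hx, sub_add_cancel]
    rw [finsum_mem_congr rfl hsplit, finsum_mem_add_distrib' (hfin _ (hh.sub hcut)) (hfin _ hcut),
      hrest, hγi.finsum_jump_indicator hL' hR' hh, add_zero]

theorem finite_endSign_ne_zero [T2Space α] (hN : IsCompact N) (hL : ∀ x ∈ N, L x ≤ 𝓝[N] x)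
    (hR : ∀ x ∈ N, R x ≤ 𝓝[N] x) (harc : ∀ p ∈ N, HasArcNhd N L R p) :
    {x ∈ N | endSign L R x ≠ 0}.Finite :=
  isStep_one.finite_jump hN hL hR harc

theorem finsum_endSign_eq_zero [T2Space α] (hN : IsCompact N) (hL : ∀ x ∈ N, L x ≤ 𝓝[N] x)
    (hR : ∀ x ∈ N, R x ≤ 𝓝[N] x) (harc : ∀ p ∈ N, HasArcNhd N L R p) :
    ∑ᶠ x ∈ N, endSign L R x = 0 := by
  have hfin : ∀ h, IsStep N L R h → {x ∈ N | jump L R h x ≠ 0}.Finite := fun h hh =>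
    hh.finite_jump hN hL hR harc
  choose! γ a b hγ hCx using harc
  obtain ⟨t, htN, hcover⟩ := hN.elim_nhdsWithin_subcover _ hCx
  refine finsum_jump_eq_zero_of_forall_notMem_arcs hL hR hfin t (fun p hp => hγ p (htN p hp))
    isStep_one fun x hx hxt => ?_
  obtain ⟨p, hp, hxp⟩ := mem_iUnion₂.1 (hcover hx)
  exact absurd hxp (hxt p hp)

end Arcs

/-! ### Determinants and relative orientations -/

section SignOf

theorem signOf_congr {p q : Prop} (h : p ↔ q) : signOf p = signOf q := by
  rw [propext h]

theorem signOf_mul_self (p : Prop) : (signOf p : ℝ) * signOf p = 1 := by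
  unfold signOf
  split_ifs <;> norm_num

theorem signOf_ne_zero (p : Prop) : signOf p ≠ 0 := by
  rw [signOf]
  split_ifs <;> decide

theorem signOf_pos_mul_self_pos {x : ℝ} (hx : x ≠ 0) : 0 < (signOf (0 < x) : ℝ) * x := by
  rcases hx.lt_or_gt with hx | hx <;> simp [signOf, hx, hx.not_gt]

theorem signOf_pos_neg {x : ℝ} (hx : x ≠ 0) : signOf (0 < -x) = -signOf (0 < x) := by
  rcases hx.lt_or_gt with hx | hx <;> simp [signOf, hx, hx.not_gt]

theorem signOf_neg_one_pow_mul (n : ℕ) {x : ℝ} (hx : x ≠ 0) :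
    signOf (0 < (-1) ^ n * x) = (-1) ^ n * signOf (0 < x) := by
  rcases Nat.even_or_odd n with h | h
  · simp [h.neg_one_pow]
  · simp only [h.neg_one_pow, neg_one_mul, signOf_pos_neg hx]

end SignOf

section OrientSign

variable {V W : Type*} [AddCommGroup V] [Module ℝ V] [AddCommGroup W] [Module ℝ W] {n m : ℕ}

theorem orientSign_rayOfNeZero {φ : V [⋀^Fin n]→ₗ[ℝ] ℝ} (hφ : φ ≠ 0) (v : Fin n → V) :
    orientSign (rayOfNeZero ℝ φ hφ) v = SignType.sign (φ v) := by
  set θ := rayOfNeZero ℝ φ hφ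
  have hray : SameRay ℝ θ.someVector φ := by
    rw [← ray_eq_iff θ.someVector_ne_zero hφ]
    exact θ.someVector_ray
  obtain ⟨r₁, r₂, h₁, h₂, h⟩ := hray.exists_pos θ.someVector_ne_zero hφ
  have hv : r₁ * θ.someVector v = r₂ * φ v := by
    simpa using congrArg (fun ψ : V [⋀^Fin n]→ₗ[ℝ] ℝ => ψ v) h
  have hsign := congrArg SignType.sign hv
  rwa [sign_mul, sign_mul, sign_pos h₁, sign_pos h₂, one_mul, one_mul] at hsign

theorem orientSign_neg (θ : Orientation ℝ V (Fin n)) (v : Fin n → V) :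
    orientSign (-θ) v = -orientSign θ v := by
  induction θ using Module.Ray.ind with
  | h φ hφ =>
    rw [neg_rayOfNeZero, orientSign_rayOfNeZero, orientSign_rayOfNeZero]
    simp [Left.sign_neg]

theorem orientSign_map (e : V ≃ₗ[ℝ] W) (θ : Orientation ℝ V (Fin n)) (v : Fin n → V) :
    orientSign (Orientation.map _ e θ) (e ∘ v) = orientSign θ v := by
  induction θ using Module.Ray.ind with
  | h φ hφ =>
    rw [Orientation.map_apply, orientSign_rayOfNeZero, orientSign_rayOfNeZero]
    simp [Function.comp_def]

theorem someVector_basis_ne_zero (θ : Orientation ℝ V (Fin n)) (b : Basis (Fin n) ℝ V) :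
    θ.someVector b ≠ 0 :=
  (θ.someVector.map_basis_ne_zero_iff b).2 θ.someVector_ne_zero

theorem alternatingMap_apply_eq_mul_det (φ : V [⋀^Fin n]→ₗ[ℝ] ℝ) (b : Basis (Fin n) ℝ V)
    (v : Fin n → V) : φ v = φ b * b.det v := by
  conv_lhs => rw [φ.eq_smul_basis_det b]
  rfl

namespace LinearRelOrientation

theorem pos_iff (σ : LinearRelOrientation V W n m) (b : Basis (Fin n) ℝ V)
    (θ : Orientation ℝ V (Fin n)) (v : Fin n → V) (w : Fin m → W) :
    σ.Pos v w ↔ 0 < orientSign θ v * orientSign (σ.toFun θ) w := by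
  refine ⟨fun ⟨θ', h⟩ => ?_, fun h => ⟨θ, h⟩⟩
  have := Module.Finite.of_basis b
  rcases θ'.eq_or_eq_neg θ (Module.finrank_eq_card_basis b).symm with rfl | rfl
  · exact h
  · rwa [σ.map_neg, orientSign_neg, orientSign_neg, neg_mul_neg] at h

theorem pos_iff_someVector_mul_pos (σ : LinearRelOrientation V W n m) (b : Basis (Fin n) ℝ V)
    (v : Fin n → V) (w : Fin m → W) :
    σ.Pos v w ↔ 0 < b.orientation.someVector v * (σ.toFun b.orientation).someVector w := by
  have pos_iff_eq_one : ∀ s : SignType, 0 < s ↔ s = 1 := by decide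
  rw [σ.pos_iff b b.orientation, orientSign, orientSign, ← sign_mul, pos_iff_eq_one,
    sign_eq_one_iff]

theorem pos_map_iff {V' W' : Type*} [AddCommGroup V'] [Module ℝ V'] [AddCommGroup W'] [Module ℝ W']
    (σ : LinearRelOrientation V W n m) (σ' : LinearRelOrientation V' W' n m)
    (b : Basis (Fin n) ℝ V) (T : V ≃ₗ[ℝ] V') (S : W ≃ₗ[ℝ] W')
    (h : ∀ θ, Orientation.map _ S (σ.toFun θ) = σ'.toFun (Orientation.map _ T θ))
    (v : Fin n → V) (w : Fin m → W) : σ'.Pos (T ∘ v) (S ∘ w) ↔ σ.Pos v w := by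
  rw [σ.pos_iff b b.orientation, σ'.pos_iff (b.map T) (Orientation.map _ T b.orientation), ← h,
    orientSign_map, orientSign_map]

theorem signOf_pos_change (σ : LinearRelOrientation V W n m) (b : Basis (Fin n) ℝ V)
    (c c' : Basis (Fin m) ℝ W) {v : Fin n → V} (hv : b.det v ≠ 0) :
    0 < (signOf (σ.Pos v c') : ℝ) * signOf (σ.Pos b c) * (b.det v * c'.det c) := by
  set α := b.orientation.someVector
  set β := (σ.toFun b.orientation).someVector
  have hα : α b ≠ 0 := someVector_basis_ne_zero _ b
  have hβ : β c ≠ 0 := someVector_basis_ne_zero _ c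
  have hβ' : β c' ≠ 0 := someVector_basis_ne_zero _ c'
  have hv' : α v = α b * b.det v := alternatingMap_apply_eq_mul_det α b v
  have hc : β c = β c' * c'.det c := alternatingMap_apply_eq_mul_det β c' c
  have h : 0 < (signOf (σ.Pos v c') * (α v * β c')) * (signOf (σ.Pos b c) * (α b * β c)) := by
    rw [signOf_congr (σ.pos_iff_someVector_mul_pos b v c'),
      signOf_congr (σ.pos_iff_someVector_mul_pos b b c)]
    refine mul_pos (signOf_pos_mul_self_pos (mul_ne_zero ?_ hβ'))
      (signOf_pos_mul_self_pos (mul_ne_zero hα hβ))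
    exact hv' ▸ mul_ne_zero hα hv
  refine pos_of_mul_pos_left (b := (α b * β c') ^ 2) ?_ (sq_nonneg _)
  rw [hv', hc] at h
  linarith

end LinearRelOrientation

end OrientSign

section FrameDet

variable {V₁ V₂ W₁ W₂ : Type*} [AddCommGroup V₁] [Module ℝ V₁] [AddCommGroup V₂] [Module ℝ V₂]
  [AddCommGroup W₁] [Module ℝ W₁] [AddCommGroup W₂] [Module ℝ W₂] {n₁ n₂ m₁ m₂ : ℕ}

theorem det_basis_prod {ι₁ ι₂ : Type*} [Fintype ι₁] [DecidableEq ι₁] [Fintype ι₂] [DecidableEq ι₂]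
    (b₁ : Basis ι₁ ℝ V₁) (b₂ : Basis ι₂ ℝ V₂) (v₁ : ι₁ → V₁) (v₂ : ι₂ → V₂) :
    (b₁.prod b₂).det (Sum.elim (fun i => (v₁ i, (0 : V₂))) fun i => ((0 : V₁), v₂ i))
      = b₁.det v₁ * b₂.det v₂ := by
  rw [Basis.det_apply, Basis.det_apply, Basis.det_apply, ← Matrix.det_fromBlocks_zero₁₂ _ 0]
  congr 1
  ext (i | i) (j | j) <;> simp [Basis.toMatrix_apply]

/-- The frame `(v₁, 0), (0, v₂)` of `V₁ × V₂` made of frames of the factors. -/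
def prodFrame {V₁ V₂ : Type*} [Zero V₁] [Zero V₂] (v₁ : Fin n₁ → V₁) (v₂ : Fin n₂ → V₂) :
    Fin (n₁ + n₂) → V₁ × V₂ :=
  Fin.append (fun i => (v₁ i, 0)) (fun i => (0, v₂ i))

/-- The basis of `V₁ × V₂` made of bases of the factors, indexed like `prodFrame`. -/
noncomputable def prodBasis (b₁ : Basis (Fin n₁) ℝ V₁) (b₂ : Basis (Fin n₂) ℝ V₂) :
    Basis (Fin (n₁ + n₂)) ℝ (V₁ × V₂) :=
  (b₁.prod b₂).reindex finSumFinEquiv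

theorem coe_prodBasis (b₁ : Basis (Fin n₁) ℝ V₁) (b₂ : Basis (Fin n₂) ℝ V₂) :
    ⇑(prodBasis b₁ b₂) = prodFrame b₁ b₂ := by
  funext i
  refine Fin.addCases (fun j => ?_) (fun j => ?_) i <;> simp [prodBasis, prodFrame]

theorem prodBasis_det (b₁ : Basis (Fin n₁) ℝ V₁) (b₂ : Basis (Fin n₂) ℝ V₂) (v₁ : Fin n₁ → V₁)
    (v₂ : Fin n₂ → V₂) : (prodBasis b₁ b₂).det (prodFrame v₁ v₂) = b₁.det v₁ * b₂.det v₂ := by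
  rw [prodBasis, Basis.det_reindex, ← det_basis_prod]
  congr 1
  funext i
  rcases i with i | i <;> simp [prodFrame]

/-- The basis of `V × ℝ` with the unit vector of `ℝ` in the last position. -/
noncomputable def snocBasis (c : Basis (Fin n₁) ℝ V₁) : Basis (Fin (n₁ + 1)) ℝ (V₁ × ℝ) :=
  prodBasis c (Basis.singleton (Fin 1) ℝ)

theorem snocBasis_det (c : Basis (Fin n₁) ℝ V₁) (w : Fin (n₁ + 1) → V₁ × ℝ) :
    (snocBasis c).det w = ∑ j : Fin (n₁ + 1), (-1) ^ (n₁ + (j : ℕ)) * (w j).2 *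
      c.det (fun i => (w (j.succAbove i)).1) := by
  rw [Basis.det_apply, Matrix.det_succ_row _ (Fin.last n₁)]
  refine Finset.sum_congr rfl fun j _ => ?_
  have hlast : (snocBasis c).toMatrix w (Fin.last n₁) j = (w j).2 := by
    rw [show Fin.last n₁ = finSumFinEquiv (Sum.inr (0 : Fin 1)) from Fin.ext (by simp)]
    simp [snocBasis, prodBasis, Basis.toMatrix_apply, -finSumFinEquiv_apply_right]
  have hinit : ((snocBasis c).toMatrix w).submatrix (Fin.last n₁).succAbove j.succAbove
      = c.toMatrix (fun i => (w (j.succAbove i)).1) := by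
    ext i k
    rw [Matrix.submatrix_apply, show (Fin.last n₁).succAbove i = finSumFinEquiv
      (Sum.inl i : Fin n₁ ⊕ Fin 1) from Fin.ext (by simp)]
    simp [snocBasis, prodBasis, Basis.toMatrix_apply, -finSumFinEquiv_apply_left]
  rw [hlast, hinit, Fin.val_last, Basis.det_apply]

/-- The determinant of `T : V₁ ⊕ V₂ → W₁ ⊕ W₂ ⊕ ℝ` with respect to a frame of the domain and a basis
of the target. -/
noncomputable def frameDet (h : m₁ + m₂ + 1 = n₁ + n₂) (v₁ : Fin n₁ → V₁) (v₂ : Fin n₂ → V₂)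
    (c₁ : Basis (Fin m₁) ℝ W₁) (c₂ : Basis (Fin m₂) ℝ W₂) (T : V₁ × V₂ →ₗ[ℝ] (W₁ × W₂) × ℝ) : ℝ :=
  (snocBasis (prodBasis c₁ c₂)).det (fun j => T (prodFrame v₁ v₂ (Fin.cast h j)))

theorem frameDet_change_frame (h : m₁ + m₂ + 1 = n₁ + n₂) (b₁ : Basis (Fin n₁) ℝ V₁)
    (b₂ : Basis (Fin n₂) ℝ V₂) (v₁ : Fin n₁ → V₁) (v₂ : Fin n₂ → V₂)
    (c₁ : Basis (Fin m₁) ℝ W₁) (c₂ : Basis (Fin m₂) ℝ W₂) (T : V₁ × V₂ →ₗ[ℝ] (W₁ × W₂) × ℝ) :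
    frameDet h v₁ v₂ c₁ c₂ T = frameDet h b₁ b₂ c₁ c₂ T * (b₁.det v₁ * b₂.det v₂) := by
  let b := (prodBasis b₁ b₂).reindex (finCongr h.symm)
  have hdet := alternatingMap_apply_eq_mul_det
    ((snocBasis (prodBasis c₁ c₂)).det.compLinearMap T) b (fun j => prodFrame v₁ v₂ (Fin.cast h j))
  simp only [AlternatingMap.compLinearMap_apply] at hdet
  rw [frameDet, hdet, frameDet, ← prodBasis_det b₁ b₂ v₁ v₂, Basis.det_reindex]
  congr 2
  funext j
  simp [b, coe_prodBasis]

theorem frameDet_change_basis (h : m₁ + m₂ + 1 = n₁ + n₂) (v₁ : Fin n₁ → V₁) (v₂ : Fin n₂ → V₂)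
    (c₁ c₁' : Basis (Fin m₁) ℝ W₁) (c₂ c₂' : Basis (Fin m₂) ℝ W₂)
    (T : V₁ × V₂ →ₗ[ℝ] (W₁ × W₂) × ℝ) :
    frameDet h v₁ v₂ c₁' c₂' T = frameDet h v₁ v₂ c₁ c₂ T * (c₁'.det c₁ * c₂'.det c₂) := by
  have hbasis : (snocBasis (prodBasis c₁' c₂')).det (snocBasis (prodBasis c₁ c₂))
      = c₁'.det c₁ * c₂'.det c₂ := by
    rw [snocBasis, snocBasis, coe_prodBasis, prodBasis_det, Basis.det_self, mul_one, coe_prodBasis,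
      prodBasis_det]
  rw [frameDet, alternatingMap_apply_eq_mul_det _ (snocBasis (prodBasis c₁ c₂)), hbasis, mul_comm,
    frameDet]

/-- The determinant of `T`, corrected by the signs of the frames and bases under `σ₁` and `σ₂`: its
sign is independent of these choices. -/
noncomputable def orientedDet (σ₁ : LinearRelOrientation V₁ W₁ n₁ m₁)
    (σ₂ : LinearRelOrientation V₂ W₂ n₂ m₂) (h : m₁ + m₂ + 1 = n₁ + n₂)
    (v₁ : Fin n₁ → V₁) (v₂ : Fin n₂ → V₂)
    (c₁ : Basis (Fin m₁) ℝ W₁) (c₂ : Basis (Fin m₂) ℝ W₂) (T : V₁ × V₂ →ₗ[ℝ] (W₁ × W₂) × ℝ) : ℝ :=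
  signOf (σ₁.Pos v₁ c₁) * signOf (σ₂.Pos v₂ c₂) * frameDet h v₁ v₂ c₁ c₂ T

theorem orientedDet_change (σ₁ : LinearRelOrientation V₁ W₁ n₁ m₁)
    (σ₂ : LinearRelOrientation V₂ W₂ n₂ m₂) (h : m₁ + m₂ + 1 = n₁ + n₂)
    (b₁ : Basis (Fin n₁) ℝ V₁) (b₂ : Basis (Fin n₂) ℝ V₂)
    (c₁ c₁' : Basis (Fin m₁) ℝ W₁) (c₂ c₂' : Basis (Fin m₂) ℝ W₂)
    {v₁ : Fin n₁ → V₁} {v₂ : Fin n₂ → V₂} (h₁ : b₁.det v₁ ≠ 0) (h₂ : b₂.det v₂ ≠ 0) :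
    ∃ r : ℝ, 0 < r ∧ ∀ T, orientedDet σ₁ σ₂ h v₁ v₂ c₁' c₂' T
      = r * orientedDet σ₁ σ₂ h b₁ b₂ c₁ c₂ T := by
  refine ⟨_, mul_pos (σ₁.signOf_pos_change b₁ c₁ c₁' h₁) (σ₂.signOf_pos_change b₂ c₂ c₂' h₂),
    fun T => ?_⟩
  rw [orientedDet, orientedDet, frameDet_change_basis h v₁ v₂ c₁ c₁' c₂ c₂',
    frameDet_change_frame h b₁ b₂ v₁ v₂]
  set s₁ : ℝ := (signOf (σ₁.Pos b₁ c₁) : ℝ) with hs₁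
  set s₂ : ℝ := (signOf (σ₂.Pos b₂ c₂) : ℝ) with hs₂
  have q₁ : s₁ ^ 2 = 1 := by rw [sq, hs₁, signOf_mul_self]
  have q₂ : s₂ ^ 2 = 1 := by rw [sq, hs₂, signOf_mul_self]
  ring_nf
  rw [q₁, q₂]
  ring

variable {T : V₁ × V₂ →ₗ[ℝ] (W₁ × W₂) × ℝ}

theorem surjective_of_frameDet_ne_zero {h : m₁ + m₂ + 1 = n₁ + n₂}
    {v₁ : Fin n₁ → V₁} {v₂ : Fin n₂ → V₂} {c₁ : Basis (Fin m₁) ℝ W₁} {c₂ : Basis (Fin m₂) ℝ W₂}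
    (hT : frameDet h v₁ v₂ c₁ c₂ T ≠ 0) : Function.Surjective T := by
  have hspan := ((snocBasis (prodBasis c₁ c₂)).is_basis_iff_det.2 (isUnit_iff_ne_zero.2 hT)).2
  rw [← LinearMap.range_eq_top, eq_top_iff, ← hspan, Submodule.span_le]
  rintro _ ⟨j, rfl⟩
  exact ⟨_, rfl⟩

theorem bijective_of_surjective (h : m₁ + m₂ + 1 = n₁ + n₂) (b₁ : Basis (Fin n₁) ℝ V₁)
    (b₂ : Basis (Fin n₂) ℝ V₂) (c₁ : Basis (Fin m₁) ℝ W₁) (c₂ : Basis (Fin m₂) ℝ W₂)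
    (hT : Function.Surjective T) : Function.Bijective T := by
  have := Module.Finite.of_basis (prodBasis b₁ b₂)
  have := Module.Finite.of_basis (snocBasis (prodBasis c₁ c₂))
  have hrank : finrank ℝ (V₁ × V₂) = finrank ℝ ((W₁ × W₂) × ℝ) := by
    rw [Module.finrank_eq_card_basis (prodBasis b₁ b₂), Module.finrank_eq_card_basis
      (snocBasis (prodBasis c₁ c₂)), Fintype.card_fin, Fintype.card_fin, h]
  exact ⟨(LinearMap.injective_iff_surjective_of_finrank_eq_finrank hrank).2 hT, hT⟩

theorem orientedDet_ne_zero_iff_bijective (σ₁ : LinearRelOrientation V₁ W₁ n₁ m₁)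
    (σ₂ : LinearRelOrientation V₂ W₂ n₂ m₂) (h : m₁ + m₂ + 1 = n₁ + n₂)
    (b₁ : Basis (Fin n₁) ℝ V₁) (b₂ : Basis (Fin n₂) ℝ V₂)
    (c₁ : Basis (Fin m₁) ℝ W₁) (c₂ : Basis (Fin m₂) ℝ W₂) :
    orientedDet σ₁ σ₂ h b₁ b₂ c₁ c₂ T ≠ 0 ↔ Function.Bijective T := by
  refine ⟨fun hT => bijective_of_surjective h b₁ b₂ c₁ c₂
    (surjective_of_frameDet_ne_zero (right_ne_zero_of_mul hT)), fun hT => ?_⟩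
  let b := ((prodBasis b₁ b₂).reindex (finCongr h.symm)).map (LinearEquiv.ofBijective T hT)
  have hb : frameDet h b₁ b₂ c₁ c₂ T = (snocBasis (prodBasis c₁ c₂)).det b := by
    rw [frameDet]
    congr 1
    funext j
    simp only [b, Basis.map_apply, Basis.reindex_apply, coe_prodBasis]
    rfl
  exact mul_ne_zero (mul_ne_zero (Int.cast_ne_zero.2 (signOf_ne_zero _))
    (Int.cast_ne_zero.2 (signOf_ne_zero _)))
    (hb ▸ (Basis.isUnit_det _ b).ne_zero)

end FrameDet

section DiffProd

variable {V₁ V₂ W₁ W₂ : Type*} [AddCommGroup V₁] [Module ℝ V₁] [AddCommGroup V₂] [Module ℝ V₂]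
  [AddCommGroup W₁] [Module ℝ W₁] [AddCommGroup W₂] [Module ℝ W₂] {n₁ n₂ m₁ m₂ : ℕ}

/-- The difference `(v, w) ↦ A v - B w`, whose kernel is the tangent space of a fiber product,
together with a functional. -/
noncomputable def diffProd (A : V₁ →ₗ[ℝ] W₁ × W₂) (B : V₂ →ₗ[ℝ] W₁ × W₂) (s : V₁ × V₂ →ₗ[ℝ] ℝ) :
    V₁ × V₂ →ₗ[ℝ] (W₁ × W₂) × ℝ :=
  (A.coprod (-B)).prod s

theorem diffProd_apply (A : V₁ →ₗ[ℝ] W₁ × W₂) (B : V₂ →ₗ[ℝ] W₁ × W₂) (s : V₁ × V₂ →ₗ[ℝ] ℝ)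
    (x : V₁ × V₂) : diffProd A B s x = (A x.1 - B x.2, s x) := by
  simp [diffProd, sub_eq_add_neg]

theorem exists_frameDet_diffProd_eq_apply (h : m₁ + m₂ + 1 = n₁ + n₂)
    (v₁ : Fin n₁ → V₁) (v₂ : Fin n₂ → V₂) (c₁ : Basis (Fin m₁) ℝ W₁) (c₂ : Basis (Fin m₂) ℝ W₂)
    (A : V₁ →ₗ[ℝ] W₁ × W₂) (B : V₂ →ₗ[ℝ] W₁ × W₂) :
    ∃ k : V₁ × V₂, ∀ s, frameDet h v₁ v₂ c₁ c₂ (diffProd A B s) = s k := by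
  let w : Fin (m₁ + m₂ + 1) → V₁ × V₂ := fun j => prodFrame v₁ v₂ (Fin.cast h j)
  refine ⟨∑ j : Fin (m₁ + m₂ + 1), ((-1) ^ (m₁ + m₂ + (j : ℕ)) * (prodBasis c₁ c₂).det fun i =>
    A (w (j.succAbove i)).1 - B (w (j.succAbove i)).2) • w j, fun s => ?_⟩
  rw [frameDet, snocBasis_det, map_sum]
  refine Finset.sum_congr rfl fun j _ => ?_
  simp only [diffProd_apply, map_smul, smul_eq_mul, w]
  ring

theorem exists_orientedDet_diffProd_eq_apply (σ₁ : LinearRelOrientation V₁ W₁ n₁ m₁)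
    (σ₂ : LinearRelOrientation V₂ W₂ n₂ m₂) (h : m₁ + m₂ + 1 = n₁ + n₂)
    (v₁ : Fin n₁ → V₁) (v₂ : Fin n₂ → V₂) (c₁ : Basis (Fin m₁) ℝ W₁) (c₂ : Basis (Fin m₂) ℝ W₂)
    (A : V₁ →ₗ[ℝ] W₁ × W₂) (B : V₂ →ₗ[ℝ] W₁ × W₂) :
    ∃ k : V₁ × V₂, A k.1 - B k.2 = 0 ∧
      ∀ s, orientedDet σ₁ σ₂ h v₁ v₂ c₁ c₂ (diffProd A B s) = s k := by
  obtain ⟨k, hk⟩ := exists_frameDet_diffProd_eq_apply h v₁ v₂ c₁ c₂ A B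
  let D : V₁ × V₂ →ₗ[ℝ] W₁ × W₂ := A.coprod (-B)
  have hD : ∀ x, D x = A x.1 - B x.2 := fun x => by simp [D, sub_eq_add_neg]
  have hker : A k.1 - B k.2 = 0 := by
    refine (prodBasis c₁ c₂).ext_elem fun i => ?_
    have hdet : frameDet h v₁ v₂ c₁ c₂ (diffProd A B ((prodBasis c₁ c₂).coord i ∘ₗ D)) = 0 := by
      by_contra hne
      obtain ⟨x, hx⟩ := surjective_of_frameDet_ne_zero hne (0, 1)
      rw [diffProd_apply, Prod.mk.injEq, LinearMap.comp_apply, hD] at hx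
      rw [hx.1, map_zero] at hx
      exact zero_ne_one hx.2
    rw [hk, LinearMap.comp_apply, hD] at hdet
    simpa using hdet
  refine ⟨(signOf (σ₁.Pos v₁ c₁) * signOf (σ₂.Pos v₂ c₂) : ℝ) • k, ?_, fun s => ?_⟩
  · rw [Prod.smul_fst, Prod.smul_snd, map_smul, map_smul, ← smul_sub, hker, smul_zero]
  · rw [orientedDet, hk, map_smul, smul_eq_mul]

theorem orientedDet_diffProd_neg (σ₁ : LinearRelOrientation V₁ W₁ n₁ m₁)
    (σ₂ : LinearRelOrientation V₂ W₂ n₂ m₂) (h : m₁ + m₂ + 1 = n₁ + n₂)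
    (v₁ : Fin n₁ → V₁) (v₂ : Fin n₂ → V₂) (c₁ : Basis (Fin m₁) ℝ W₁) (c₂ : Basis (Fin m₂) ℝ W₂)
    (A : V₁ →ₗ[ℝ] W₁ × W₂) (B : V₂ →ₗ[ℝ] W₁ × W₂) (s : V₁ × V₂ →ₗ[ℝ] ℝ) :
    orientedDet σ₁ σ₂ h v₁ v₂ c₁ c₂ (diffProd A B (-s))
      = -orientedDet σ₁ σ₂ h v₁ v₂ c₁ c₂ (diffProd A B s) := by
  obtain ⟨k, -, hk⟩ := exists_orientedDet_diffProd_eq_apply σ₁ σ₂ h v₁ v₂ c₁ c₂ A B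
  rw [hk, hk, LinearMap.neg_apply]

theorem exists_eq_mul_add_of_orientedDet_pos {σ₁ : LinearRelOrientation V₁ W₁ n₁ m₁}
    {σ₂ : LinearRelOrientation V₂ W₂ n₂ m₂} {h : m₁ + m₂ + 1 = n₁ + n₂}
    {b₁ : Basis (Fin n₁) ℝ V₁} {b₂ : Basis (Fin n₂) ℝ V₂}
    {c₁ : Basis (Fin m₁) ℝ W₁} {c₂ : Basis (Fin m₂) ℝ W₂}
    {A : V₁ →ₗ[ℝ] W₁ × W₂} {B : V₂ →ₗ[ℝ] W₁ × W₂} {s t : V₁ × V₂ →ₗ[ℝ] ℝ}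
    (hs : 0 < orientedDet σ₁ σ₂ h b₁ b₂ c₁ c₂ (diffProd A B s))
    (ht : 0 < orientedDet σ₁ σ₂ h b₁ b₂ c₁ c₂ (diffProd A B t)) :
    ∃ c : ℝ, 0 < c ∧ ∃ q : W₁ × W₂ →ₗ[ℝ] ℝ, ∀ x, t x = c * s x + q (A x.1 - B x.2) := by
  have hbij := (orientedDet_ne_zero_iff_bijective σ₁ σ₂ h b₁ b₂ c₁ c₂).1 hs.ne'
  obtain ⟨k, hk, hdet⟩ := exists_orientedDet_diffProd_eq_apply σ₁ σ₂ h b₁ b₂ c₁ c₂ A B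
  rw [hdet] at hs ht
  let e := LinearEquiv.ofBijective _ hbij
  have he : ∀ x, e x = (A x.1 - B x.2, s x) := fun x => diffProd_apply A B s x
  let q : W₁ × W₂ →ₗ[ℝ] ℝ := t ∘ₗ e.symm.toLinearMap ∘ₗ LinearMap.inl ℝ (W₁ × W₂) ℝ
  refine ⟨t k / s k, div_pos ht hs, q, fun x => ?_⟩
  have hx : e.symm (A x.1 - B x.2, 0) = x - (s x / s k) • k := by
    rw [LinearEquiv.symm_apply_eq, map_sub, map_smul, he, he, hk]
    ext <;> simp [hs.ne']
  have hq : q (A x.1 - B x.2) = t (e.symm (A x.1 - B x.2, 0)) := rfl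
  rw [hq, hx, map_sub, map_smul, smul_eq_mul]
  field_simp
  ring

end DiffProd

section HalfSpace

variable {E : Type*} [NormedAddCommGroup E] [NormedSpace ℝ E] {H : Type*} [TopologicalSpace H]
  {I : ModelWithCorners ℝ E H} {l : E →L[ℝ] ℝ} {n : ℕ}

theorem interior_range_eq (hI : range I = {x | 0 ≤ l x}) (hl : l ≠ 0) :
    interior (range I) = {x | 0 < l x} := by
  have := (l.isOpenMap_of_ne_zero hl).preimage_interior_eq_interior_preimage l.continuous (Ici 0)
  rw [interior_Ici] at this
  rw [hI]
  exact this.symm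

theorem frontier_range_eq (hI : range I = {x | 0 ≤ l x}) (hl : l ≠ 0) :
    frontier (range I) = {x | l x = 0} := by
  have := (l.isOpenMap_of_ne_zero hl).preimage_frontier_eq_frontier_preimage l.continuous (Ici 0)
  rw [frontier_Ici] at this
  rw [hI]
  exact this.symm

theorem boundaryTangent_eq_ker (hI : range I = {x | 0 ≤ l x}) (hl : l ≠ 0) :
    boundaryTangent I = LinearMap.ker (l : E →ₗ[ℝ] ℝ) := by
  rw [boundaryTangent, frontier_range_eq hI hl]
  exact Submodule.span_eq (LinearMap.ker (l : E →ₗ[ℝ] ℝ))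

theorem mem_boundaryTangent_iff (hI : range I = {x | 0 ≤ l x}) (hl : l ≠ 0) {x : E} :
    x ∈ boundaryTangent I ↔ l x = 0 := by
  rw [boundaryTangent_eq_ker hI hl, LinearMap.mem_ker, ContinuousLinearMap.coe_coe]

theorem finrank_boundaryTangent [FiniteDimensional ℝ E] (hI : range I = {x | 0 ≤ l x})
    (hl : l ≠ 0) : finrank ℝ (boundaryTangent I) + 1 = finrank ℝ E := by
  rw [boundaryTangent_eq_ker hI hl]
  exact Module.Dual.finrank_ker_add_one_of_ne_zero (ContinuousLinearMap.coe_injective.ne hl)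

theorem nonempty_basis_boundaryTangent (hI : range I = {x | 0 ≤ l x}) (hl : l ≠ 0)
    (e : Basis (Fin (n + 1)) ℝ E) : Nonempty (Basis (Fin n) ℝ (boundaryTangent I)) := by
  have := Module.Finite.of_basis e
  have hrank := finrank_boundaryTangent hI hl
  rw [Module.finrank_eq_card_basis e, Fintype.card_fin, add_left_inj] at hrank
  exact ⟨finBasisOfFinrankEq ℝ _ hrank⟩

theorem exists_apply_neg (hl : l ≠ 0) : ∃ ν, l ν < 0 := by
  obtain ⟨x, hx⟩ := DFunLike.ne_iff.1 hl
  rcases hx.lt_or_gt with h | h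
  · exact ⟨x, h⟩
  · exact ⟨-x, by simpa using h⟩

theorem isOutward_iff (hI : range I = {x | 0 ≤ l x}) (hl : l ≠ 0) {ν : E} :
    IsOutward I ν ↔ l ν < 0 := by
  rw [IsOutward, interior_range_eq hI hl]
  simp

theorem exists_eq_succ_of_basis (hl : l ≠ 0) (e : Basis (Fin n) ℝ E) : ∃ k, n = k + 1 := by
  obtain ⟨x, hx⟩ := DFunLike.ne_iff.1 hl
  have : Nontrivial E := ⟨x, 0, fun h => hx (by rw [h, map_zero, map_zero])⟩
  have := e.index_nonempty
  exact Nat.exists_eq_succ_of_ne_zero (Fin.pos_iff_nonempty.2 this).ne'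

end HalfSpace

section AppendLast

theorem appendLast_eq_snoc {V : Type*} {k : ℕ} (b : Fin k → V) (ν : V) :
    appendLast (n := k + 1) b ν = (Fin.snoc (α := fun _ => V) b ν : Fin (k + 1) → V) := by
  funext i
  refine Fin.lastCases ?_ (fun j => ?_) i <;> simp [appendLast]

variable {E : Type*} [NormedAddCommGroup E] [NormedSpace ℝ E] {H : Type*} [TopologicalSpace H]
  {I : ModelWithCorners ℝ E H} {l : E →L[ℝ] ℝ} {n : ℕ}

theorem alternatingMap_snoc_of_mem (b : Basis (Fin n) ℝ (boundaryTangent I))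
    (φ : E [⋀^Fin (n + 1)]→ₗ[ℝ] ℝ) {x : E} (hx : x ∈ boundaryTangent I) :
    φ (Fin.snoc (α := fun _ => E) (fun i => (b i : E)) x) = 0 := by
  refine φ.map_linearDependent _ fun hli => ?_
  refine (linearIndependent_finSnoc.1 hli).2 ?_
  have hspan := congrArg (Submodule.map (boundaryTangent I).subtype) b.span_eq
  rw [Submodule.map_span, ← range_comp, Submodule.map_top, Submodule.range_subtype] at hspan
  exact hspan.ge hx

theorem alternatingMap_snoc_mul_comm (hI : range I = {x | 0 ≤ l x}) (hl : l ≠ 0)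
    (b : Basis (Fin n) ℝ (boundaryTangent I)) (φ : E [⋀^Fin (n + 1)]→ₗ[ℝ] ℝ) (ν ν' : E) :
    φ (Fin.snoc (α := fun _ => E) (fun i => (b i : E)) ν') * l ν
      = φ (Fin.snoc (α := fun _ => E) (fun i => (b i : E)) ν) * l ν' := by
  let F : E →ₗ[ℝ] ℝ := φ.toMultilinearMap.toLinearMap
    (Fin.snoc (α := fun _ => E) (fun i => (b i : E)) 0) (Fin.last n)
  have hF : ∀ x, F x = φ (Fin.snoc (α := fun _ => E) (fun i => (b i : E)) x) := fun x => by
    simp only [F, MultilinearMap.toLinearMap_apply, Fin.update_snoc_last]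
    rfl
  have hker : F (l ν • ν' - l ν' • ν) = 0 := by
    rw [hF]
    exact alternatingMap_snoc_of_mem b φ ((mem_boundaryTangent_iff hI hl).2 (by simp [mul_comm]))
  rw [map_sub, map_smul, map_smul, hF, hF, smul_eq_mul, smul_eq_mul] at hker
  linarith

theorem LinearRelOrientation.boundaryPos_iff {W : Type*} [AddCommGroup W] [Module ℝ W] {m : ℕ}
    (hI : range I = {x | 0 ≤ l x}) (hl : l ≠ 0) (σ : LinearRelOrientation E W (n + 1) m)
    (e : Basis (Fin (n + 1)) ℝ E) (b : Basis (Fin n) ℝ (boundaryTangent I)) {ν : E} (hν : l ν < 0)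
    (w : Fin m → W) :
    σ.BoundaryPos I b w ↔ σ.Pos (Fin.snoc (α := fun _ => E) (fun i => (b i : E)) ν) w := by
  have happ : ∀ ν, appendLast (n := n + 1) (fun i => (b i : E)) ν
      = Fin.snoc (α := fun _ => E) (fun i => (b i : E)) ν := appendLast_eq_snoc _
  refine ⟨fun ⟨ν', hν', hpos⟩ => ?_, fun h =>
    ⟨ν, (isOutward_iff hI hl).2 hν, (happ ν).symm ▸ h⟩⟩
  rw [isOutward_iff hI hl] at hν'
  rw [happ, σ.pos_iff_someVector_mul_pos e] at hpos
  rw [σ.pos_iff_someVector_mul_pos e]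
  have hcomm := alternatingMap_snoc_mul_comm hI hl b e.orientation.someVector ν ν'
  rw [eq_div_of_mul_eq hν'.ne hcomm.symm, mul_div_assoc, mul_right_comm]
  exact mul_pos hpos (div_pos_of_neg_of_neg hν hν')

theorem det_snoc_ne_zero (hI : range I = {x | 0 ≤ l x}) (hl : l ≠ 0)
    (e : Basis (Fin (n + 1)) ℝ E) (b : Basis (Fin n) ℝ (boundaryTangent I)) {ν : E}
    (hν : l ν ≠ 0) : e.det (Fin.snoc (α := fun _ => E) (fun i => (b i : E)) ν) ≠ 0 := by
  have hli : LinearIndependent ℝ (Fin.snoc (α := fun _ => E) (fun i => (b i : E)) ν) := by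
    rw [linearIndependent_finSnoc]
    refine ⟨b.linearIndependent.map' (boundaryTangent I).subtype (Submodule.ker_subtype _),
      fun hmem => hν ((mem_boundaryTangent_iff hI hl).1 (Submodule.span_le.2 ?_ hmem))⟩
    rintro _ ⟨i, rfl⟩
    exact (b i).2
  have hunit := e.isUnit_det (basisOfLinearIndependentOfCardEqFinrank hli
    (Module.finrank_eq_card_basis e).symm)
  rw [coe_basisOfLinearIndependentOfCardEqFinrank] at hunit
  exact hunit.ne_zero

end AppendLast

section ProdFrame

variable {V₁ V₂ : Type*} [Zero V₁] [Zero V₂] {n₁ n₂ m k : ℕ}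

theorem prodFrame_snoc_right (h : m = n₁ + k) (v₁ : Fin n₁ → V₁) (v₂ : Fin k → V₂) (ν : V₂) :
    prodFrame v₁ (Fin.snoc (α := fun _ => V₂) v₂ ν) ∘ Fin.cast (congrArg (· + 1) h)
      = (Fin.last m).insertNth (α := fun _ => V₁ × V₂) (0, ν) (prodFrame v₁ v₂ ∘ Fin.cast h) := by
  subst h
  have hsnoc : (fun i => ((0 : V₁), Fin.snoc (α := fun _ => V₂) v₂ ν i))
      = Fin.snoc (α := fun _ => V₁ × V₂) (fun i => (0, v₂ i)) (0, ν) := by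
    funext i
    refine Fin.lastCases ?_ (fun j => ?_) i <;> simp
  rw [prodFrame, prodFrame, Fin.insertNth_last', hsnoc, Fin.append_snoc]
  rfl

theorem prodFrame_snoc_left (h : m = k + n₂) (h' : m + 1 = k + 1 + n₂) (v₁ : Fin k → V₁) (ν : V₁)
    (v₂ : Fin n₂ → V₂) :
    prodFrame (Fin.snoc (α := fun _ => V₁) v₁ ν) v₂ ∘ Fin.cast h'
      = Fin.insertNth (α := fun _ => V₁ × V₂) ⟨k, by omega⟩ (ν, 0)
        (prodFrame v₁ v₂ ∘ Fin.cast h) := by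
  subst h
  rw [Fin.eq_insertNth_iff]
  refine ⟨?_, funext fun i => Fin.addCases (fun j => ?_) (fun j => ?_) i⟩
  · have hk : Fin.cast h' ⟨k, by omega⟩ = Fin.castAdd n₂ (Fin.last k) := rfl
    rw [Function.comp_apply, hk, prodFrame, Fin.append_left, Fin.snoc_last]
  · have hj : Fin.cast h' (Fin.succAbove ⟨k, by omega⟩ (Fin.castAdd n₂ j))
        = Fin.castAdd n₂ j.castSucc := by
      rw [Fin.succAbove_of_castSucc_lt _ _ j.isLt]
      rfl
    simp [Fin.removeNth, hj, prodFrame]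
  · have hj : Fin.cast h' (Fin.succAbove ⟨k, by omega⟩ (Fin.natAdd k j))
        = Fin.natAdd (k + 1) j := by
      rw [Fin.succAbove_of_le_castSucc _ _ (by simp [Fin.le_def])]
      ext
      simp only [Fin.val_cast, Fin.val_succ, Fin.val_natAdd]
      omega
    simp [Fin.removeNth, hj, prodFrame]

theorem snd_prodFrame_of_forall {p : V₂ → Prop} (h₀ : p 0) (v₁ : Fin n₁ → V₁) {v₂ : Fin n₂ → V₂}
    (h : ∀ i, p (v₂ i)) (i : Fin (n₁ + n₂)) : p (prodFrame v₁ v₂ i).2 := by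
  refine Fin.addCases (fun j => ?_) (fun j => ?_) i <;> simp [prodFrame, h, h₀]

theorem fst_prodFrame_of_forall {p : V₁ → Prop} (h₀ : p 0) {v₁ : Fin n₁ → V₁} (v₂ : Fin n₂ → V₂)
    (h : ∀ i, p (v₁ i)) (i : Fin (n₁ + n₂)) : p (prodFrame v₁ v₂ i).1 := by
  refine Fin.addCases (fun j => ?_) (fun j => ?_) i <;> simp [prodFrame, h, h₀]

end ProdFrame

section BoundaryFrameDet

variable {V₁ V₂ W₁ W₂ : Type*} [AddCommGroup V₁] [Module ℝ V₁] [AddCommGroup V₂] [Module ℝ V₂]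
  [AddCommGroup W₁] [Module ℝ W₁] [AddCommGroup W₂] [Module ℝ W₂] {n₁ n₂ m₁ m₂ k : ℕ}
  (A : V₁ →ₗ[ℝ] W₁ × W₂) (B : V₂ →ₗ[ℝ] W₁ × W₂)

theorem det_diff_prodFrame {m : ℕ} (h : m = n₁ + n₂) (c : Basis (Fin m) ℝ (W₁ × W₂))
    (v₁ : Fin n₁ → V₁) (v₂ : Fin n₂ → V₂) :
    c.det (fun i => A (prodFrame v₁ v₂ (Fin.cast h i)).1 - B (prodFrame v₁ v₂ (Fin.cast h i)).2)
      = (-1) ^ n₂ * c.det (Fin.append (fun i => A (v₁ i)) (fun j => B (v₂ j)) ∘ Fin.cast h) := by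
  subst h
  let ε : Fin (n₁ + n₂) → ℝ := Fin.append (fun _ => 1) (fun _ => -1)
  have hsmul : (fun i => A (prodFrame v₁ v₂ i).1 - B (prodFrame v₁ v₂ i).2)
      = fun i => ε i • Fin.append (fun i => A (v₁ i)) (fun j => B (v₂ j)) i := by
    funext i
    refine Fin.addCases (fun j => ?_) (fun j => ?_) i <;> simp [ε, prodFrame]
  refine (congrArg c.det hsmul).trans ?_
  rw [AlternatingMap.map_smul_univ, Fin.prod_univ_add]
  simp [ε]

theorem frameDet_diffProd_of_insertNth (h : m₁ + m₂ + 1 = n₁ + n₂) {v₁ : Fin n₁ → V₁}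
    {v₂ : Fin n₂ → V₂} (c₁ : Basis (Fin m₁) ℝ W₁) (c₂ : Basis (Fin m₂) ℝ W₂) {s : V₁ × V₂ →ₗ[ℝ] ℝ}
    {j₀ : Fin (m₁ + m₂ + 1)} {x : V₁ × V₂} {p : Fin (m₁ + m₂) → V₁ × V₂}
    (hp : prodFrame v₁ v₂ ∘ Fin.cast h = j₀.insertNth (α := fun _ => V₁ × V₂) x p)
    (hs : ∀ i, s (p i) = 0) :
    frameDet h v₁ v₂ c₁ c₂ (diffProd A B s) = (-1) ^ (m₁ + m₂ + (j₀ : ℕ)) * s x *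
      (prodBasis c₁ c₂).det (fun i => A (p i).1 - B (p i).2) := by
  have hp' : ∀ j, prodFrame v₁ v₂ (Fin.cast h j) = j₀.insertNth (α := fun _ => V₁ × V₂) x p j :=
    congrFun hp
  simp only [frameDet, snocBasis_det, hp', diffProd_apply]
  rw [Finset.sum_eq_single j₀]
  · simp
  · intro j _ hj
    obtain ⟨i, rfl⟩ := Fin.exists_succAbove_eq hj
    simp [hs]
  · simp

theorem frameDet_snoc_right (h : m₁ + m₂ + 1 = n₁ + (k + 1)) (h' : m₁ + m₂ = n₁ + k)
    (v₁ : Fin n₁ → V₁) (v₂ : Fin k → V₂) (ν : V₂) (c₁ : Basis (Fin m₁) ℝ W₁)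
    (c₂ : Basis (Fin m₂) ℝ W₂) (l : V₂ →ₗ[ℝ] ℝ) (hl : ∀ i, l (v₂ i) = 0) :
    frameDet h v₁ (Fin.snoc (α := fun _ => V₂) v₂ ν) c₁ c₂
        (diffProd A B (l ∘ₗ LinearMap.snd ℝ V₁ V₂))
      = (-1) ^ k * l ν * (prodBasis c₁ c₂).det
        (Fin.append (fun i => A (v₁ i)) (fun j => B (v₂ j)) ∘ Fin.cast h') := by
  rw [frameDet_diffProd_of_insertNth A B h c₁ c₂ (prodFrame_snoc_right h' v₁ v₂ ν)
    fun i => snd_prodFrame_of_forall (p := fun v => l v = 0) (map_zero l) v₁ hl _]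
  simp only [Function.comp_apply, det_diff_prodFrame A B h', Fin.val_last, LinearMap.comp_apply,
    LinearMap.snd_apply, ← two_mul, pow_mul, neg_one_sq, one_pow]
  ring

theorem frameDet_snoc_left (h : m₁ + m₂ + 1 = (k + 1) + n₂) (h' : m₁ + m₂ = k + n₂)
    (v₁ : Fin k → V₁) (ν : V₁) (v₂ : Fin n₂ → V₂) (c₁ : Basis (Fin m₁) ℝ W₁)
    (c₂ : Basis (Fin m₂) ℝ W₂) (l : V₁ →ₗ[ℝ] ℝ) (hl : ∀ i, l (v₁ i) = 0) :
    frameDet h (Fin.snoc (α := fun _ => V₁) v₁ ν) v₂ c₁ c₂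
        (diffProd A B (l ∘ₗ LinearMap.fst ℝ V₁ V₂))
      = l ν * (prodBasis c₁ c₂).det
        (Fin.append (fun i => A (v₁ i)) (fun j => B (v₂ j)) ∘ Fin.cast h') := by
  rw [frameDet_diffProd_of_insertNth A B h c₁ c₂ (prodFrame_snoc_left h' h v₁ ν v₂)
    fun i => fst_prodFrame_of_forall (p := fun v => l v = 0) (map_zero l) v₂ hl _]
  have hsign : (-1 : ℝ) ^ (m₁ + m₂ + k) * (-1) ^ n₂ = 1 := by
    rw [← pow_add, show m₁ + m₂ + k + n₂ = 2 * (k + n₂) by omega, pow_mul, neg_one_sq, one_pow]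
  simp only [Function.comp_apply, det_diff_prodFrame A B h', LinearMap.comp_apply,
    LinearMap.fst_apply]
  linear_combination (l ν * (prodBasis c₁ c₂).det
    (Fin.append (fun i => A (v₁ i)) (fun j => B (v₂ j)) ∘ Fin.cast h')) * hsign

end BoundaryFrameDet

section CrossSign

variable {V₁ V₂ W₁ W₂ : Type*} [AddCommGroup V₁] [Module ℝ V₁] [AddCommGroup V₂] [Module ℝ V₂]
  [AddCommGroup W₁] [Module ℝ W₁] [AddCommGroup W₂] [Module ℝ W₂] {n₁ n₂ m₁ m₂ k : ℕ}

theorem crossSign_eq_signOf {pos₁ : (Fin n₁ → V₁) → (Fin m₁ → W₁) → Prop}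
    {pos₂ : (Fin n₂ → V₂) → (Fin m₂ → W₂) → Prop} {A : V₁ →ₗ[ℝ] W₁ × W₂} {B : V₂ →ₗ[ℝ] W₁ × W₂}
    (b₁ : Basis (Fin n₁) ℝ V₁) (b₂ : Basis (Fin n₂) ℝ V₂) (c₁ : Basis (Fin m₁) ℝ W₁)
    (c₂ : Basis (Fin m₂) ℝ W₂) (h : m₁ + m₂ = n₁ + n₂) {x : ℝ}
    (hx : ∀ (b₁ : Basis (Fin n₁) ℝ V₁) (b₂ : Basis (Fin n₂) ℝ V₂) (c₁ : Basis (Fin m₁) ℝ W₁)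
      (c₂ : Basis (Fin m₂) ℝ W₂), ∃ r > 0, (signOf (pos₁ b₁ c₁) * signOf (pos₂ b₂ c₂) : ℝ) *
        (prodBasis c₁ c₂).det (Fin.append (fun i => A (b₁ i)) (fun j => B (b₂ j)) ∘ Fin.cast h)
          = r * x) :
    crossSign pos₁ pos₂ A B = signOf (0 < x) := by
  refine signOf_congr ⟨?_, fun hpos => ?_⟩
  · rintro ⟨b₁, b₂, c₁, c₂, _, hpos⟩
    obtain ⟨r, hr, heq⟩ := hx b₁ b₂ c₁ c₂
    exact (mul_pos_iff_of_pos_left hr).1 (heq ▸ hpos)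
  · obtain ⟨r, hr, heq⟩ := hx b₁ b₂ c₁ c₂
    exact ⟨b₁, b₂, c₁, c₂, h, heq ▸ mul_pos hr hpos⟩

variable {E : Type*} [NormedAddCommGroup E] [NormedSpace ℝ E] {H : Type*} [TopologicalSpace H]
  {I : ModelWithCorners ℝ E H} {l : E →L[ℝ] ℝ}

theorem crossSign_boundary_right (hI : range I = {x | 0 ≤ l x}) (hl : l ≠ 0)
    (σ₁ : LinearRelOrientation V₁ W₁ n₁ m₁) (σ₂ : LinearRelOrientation E W₂ n₂ m₂)
    (h : m₁ + m₂ + 1 = n₁ + n₂) (e₁ : Basis (Fin n₁) ℝ V₁) (e₂ : Basis (Fin n₂) ℝ E)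
    (c₁ : Basis (Fin m₁) ℝ W₁) (c₂ : Basis (Fin m₂) ℝ W₂)
    (A : V₁ →ₗ[ℝ] W₁ × W₂) (B : E →ₗ[ℝ] W₁ × W₂)
    (hne : orientedDet σ₁ σ₂ h e₁ e₂ c₁ c₂
      (diffProd A B ((l : E →ₗ[ℝ] ℝ) ∘ₗ LinearMap.snd ℝ V₁ E)) ≠ 0) :
    crossSign σ₁.Pos (σ₂.BoundaryPos I) A (B.domRestrict (boundaryTangent I))
      = (-1) ^ n₂ * signOf (0 < orientedDet σ₁ σ₂ h e₁ e₂ c₁ c₂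
        (diffProd A B ((l : E →ₗ[ℝ] ℝ) ∘ₗ LinearMap.snd ℝ V₁ E))) := by
  obtain ⟨k, rfl⟩ := exists_eq_succ_of_basis hl e₂
  obtain ⟨ν, hν⟩ := exists_apply_neg hl
  obtain ⟨b⟩ := nonempty_basis_boundaryTangent hI hl e₂
  have h' : m₁ + m₂ = n₁ + k := by omega
  rw [← signOf_neg_one_pow_mul _ hne]
  refine crossSign_eq_signOf e₁ b c₁ c₂ h' fun b₁ b₂ c₁' c₂' => ?_
  obtain ⟨r, hr, hchange⟩ := orientedDet_change σ₁ σ₂ h e₁ e₂ c₁ c₁' c₂ c₂'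
    (e₁.isUnit_det b₁).ne_zero (det_snoc_ne_zero hI hl e₂ b₂ hν.ne)
  have hdet := hchange (diffProd A B ((l : E →ₗ[ℝ] ℝ) ∘ₗ LinearMap.snd ℝ V₁ E))
  rw [orientedDet, frameDet_snoc_right A B h h' _ _ _ _ _ _
    fun i => (mem_boundaryTangent_iff hI hl).1 (b₂ i).2] at hdet
  refine ⟨r / -l ν, div_pos hr (neg_pos.2 hν), ?_⟩
  rw [signOf_congr (σ₂.boundaryPos_iff hI hl e₂ b₂ hν c₂'), div_mul_eq_mul_div,
    eq_div_iff (neg_ne_zero.2 hν.ne), pow_succ]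
  have hsq : (-1 : ℝ) ^ k * (-1) ^ k = 1 := by rw [← mul_pow, neg_one_mul, neg_neg, one_pow]
  simp only [LinearMap.domRestrict_apply]
  generalize (prodBasis c₁' c₂').det _ = D at hdet ⊢
  generalize (signOf _ * signOf _ : ℝ) = s at hdet ⊢
  linear_combination -(-1) ^ k * hdet + s * D * l ν * hsq

theorem crossSign_boundary_left (hI : range I = {x | 0 ≤ l x}) (hl : l ≠ 0)
    (σ₁ : LinearRelOrientation E W₁ n₁ m₁) (σ₂ : LinearRelOrientation V₂ W₂ n₂ m₂)
    (h : m₁ + m₂ + 1 = n₁ + n₂) (e₁ : Basis (Fin n₁) ℝ E) (e₂ : Basis (Fin n₂) ℝ V₂)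
    (c₁ : Basis (Fin m₁) ℝ W₁) (c₂ : Basis (Fin m₂) ℝ W₂)
    (A : E →ₗ[ℝ] W₁ × W₂) (B : V₂ →ₗ[ℝ] W₁ × W₂)
    (hne : orientedDet σ₁ σ₂ h e₁ e₂ c₁ c₂
      (diffProd A B ((l : E →ₗ[ℝ] ℝ) ∘ₗ LinearMap.fst ℝ E V₂)) ≠ 0) :
    crossSign (σ₁.BoundaryPos I) σ₂.Pos (A.domRestrict (boundaryTangent I)) B
      = -signOf (0 < orientedDet σ₁ σ₂ h e₁ e₂ c₁ c₂
        (diffProd A B ((l : E →ₗ[ℝ] ℝ) ∘ₗ LinearMap.fst ℝ E V₂))) := by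
  obtain ⟨k, rfl⟩ := exists_eq_succ_of_basis hl e₁
  obtain ⟨ν, hν⟩ := exists_apply_neg hl
  obtain ⟨b⟩ := nonempty_basis_boundaryTangent hI hl e₁
  have h' : m₁ + m₂ = k + n₂ := by omega
  rw [← signOf_pos_neg hne]
  refine crossSign_eq_signOf b e₂ c₁ c₂ h' fun b₁ b₂ c₁' c₂' => ?_
  obtain ⟨r, hr, hchange⟩ := orientedDet_change σ₁ σ₂ h e₁ e₂ c₁ c₁' c₂ c₂'
    (det_snoc_ne_zero hI hl e₁ b₁ hν.ne) (e₂.isUnit_det b₂).ne_zero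
  have hdet := hchange (diffProd A B ((l : E →ₗ[ℝ] ℝ) ∘ₗ LinearMap.fst ℝ E V₂))
  rw [orientedDet, frameDet_snoc_left A B h h' _ _ _ _ _ _
    fun i => (mem_boundaryTangent_iff hI hl).1 (b₁ i).2] at hdet
  refine ⟨r / -l ν, div_pos hr (neg_pos.2 hν), ?_⟩
  rw [signOf_congr (σ₁.boundaryPos_iff hI hl e₁ b₁ hν c₁'), div_mul_eq_mul_div,
    eq_div_iff (neg_ne_zero.2 hν.ne)]
  simp only [LinearMap.domRestrict_apply]
  linear_combination -hdet

end CrossSign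

section Surjectivity

variable {V₁ V₂ W₁ W₂ E H : Type*} [AddCommGroup V₁] [Module ℝ V₁] [AddCommGroup V₂] [Module ℝ V₂]
  [AddCommGroup W₁] [Module ℝ W₁] [AddCommGroup W₂] [Module ℝ W₂]
  [NormedAddCommGroup E] [NormedSpace ℝ E] [TopologicalSpace H] {I : ModelWithCorners ℝ E H}
  {l : E →L[ℝ] ℝ}

theorem surjective_diffProd_snd (hI : range I = {x | 0 ≤ l x}) (hl : l ≠ 0)
    {A : V₁ →ₗ[ℝ] W₁ × W₂} {B : E →ₗ[ℝ] W₁ × W₂}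
    (h : A.range ⊔ (B.domRestrict (boundaryTangent I)).range = ⊤) :
    Function.Surjective (diffProd A B ((l : E →ₗ[ℝ] ℝ) ∘ₗ LinearMap.snd ℝ V₁ E)) := by
  rintro ⟨w, t⟩
  obtain ⟨e, he : l e = t⟩ := LinearMap.surjective (f := (l : E →ₗ[ℝ] ℝ))
    (fun h0 => hl (ContinuousLinearMap.coe_injective h0)) t
  have hw : w + B e ∈ A.range ⊔ (B.domRestrict (boundaryTangent I)).range := h ▸ Submodule.mem_top
  obtain ⟨_, ⟨x, rfl⟩, _, ⟨y, rfl⟩, hxy : A x + B y = w + B e⟩ := Submodule.mem_sup.1 hw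
  have hy : l y = 0 := (mem_boundaryTangent_iff hI hl).1 y.2
  refine ⟨(x, e - y), ?_⟩
  rw [diffProd_apply]
  refine Prod.ext ?_ ?_
  · change A x - B (e - y) = w
    rw [map_sub, eq_sub_of_add_eq hxy]
    abel
  · simp only [LinearMap.comp_apply, LinearMap.snd_apply, ContinuousLinearMap.coe_coe, map_sub, he,
      hy, sub_zero]

theorem surjective_diffProd_fst (hI : range I = {x | 0 ≤ l x}) (hl : l ≠ 0)
    {A : E →ₗ[ℝ] W₁ × W₂} {B : V₂ →ₗ[ℝ] W₁ × W₂}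
    (h : B.range ⊔ (A.domRestrict (boundaryTangent I)).range = ⊤) :
    Function.Surjective (diffProd A B ((l : E →ₗ[ℝ] ℝ) ∘ₗ LinearMap.fst ℝ E V₂)) := by
  rintro ⟨w, t⟩
  obtain ⟨⟨x, y⟩, hxy⟩ := surjective_diffProd_snd hI hl h (-w, t)
  rw [diffProd_apply, Prod.mk.injEq] at hxy
  refine ⟨(y, x), ?_⟩
  rw [diffProd_apply, Prod.mk.injEq, ← neg_sub, hxy.1, neg_neg]
  exact ⟨rfl, hxy.2⟩

theorem exists_surjective_diffProd [FiniteDimensional ℝ V₁] [FiniteDimensional ℝ V₂]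
    [FiniteDimensional ℝ W₁] [FiniteDimensional ℝ W₂]
    {A : V₁ →ₗ[ℝ] W₁ × W₂} {B : V₂ →ₗ[ℝ] W₁ × W₂}
    (hd : finrank ℝ W₁ + finrank ℝ W₂ + 1 = finrank ℝ V₁ + finrank ℝ V₂)
    (h : A.range ⊔ B.range = ⊤) : ∃ s, Function.Surjective (diffProd A B s) := by
  have hlt : finrank ℝ (W₁ × W₂) < finrank ℝ (V₁ × V₂) := by
    rw [finrank_prod, finrank_prod]
    omega
  obtain ⟨k, hk, hk0⟩ := (Submodule.ne_bot_iff _).1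
    (LinearMap.ker_ne_bot_of_finrank_lt (f := A.coprod (-B)) hlt)
  obtain ⟨s, hs⟩ := Module.Projective.exists_dual_eq_one ℝ hk0
  have hk' : A k.1 - B k.2 = 0 := by
    rwa [LinearMap.mem_ker, LinearMap.coprod_apply, LinearMap.neg_apply, ← sub_eq_add_neg] at hk
  have hks : diffProd A B s k = (0, 1) := by rw [diffProd_apply, hk', hs]
  refine ⟨s, fun ⟨w, t⟩ => ?_⟩
  have hw : w ∈ A.range ⊔ B.range := h ▸ Submodule.mem_top
  obtain ⟨_, ⟨x, rfl⟩, _, ⟨y, rfl⟩, hxy⟩ := Submodule.mem_sup.1 hw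
  refine ⟨(x, -y) + (t - s (x, -y)) • k, ?_⟩
  rw [map_add, map_smul, hks, diffProd_apply, map_neg, sub_neg_eq_add, hxy]
  simp

end Surjectivity

/-! ### Level curves -/

section LevelSet

variable {V W : Type*} [NormedAddCommGroup V] [NormedSpace ℝ V]
  [NormedAddCommGroup W] [NormedSpace ℝ W] {F : V → W} {D : V →L[ℝ] W} {K : Set V} {x₀ : V}

theorem pos_iff_pos_of_abs_sub_mul_le {a b c : ℝ} (hc : 0 < c)
    (h : |b - c * a| ≤ c / 2 * |a|) : 0 < a ↔ 0 < b := by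
  rw [abs_le] at h
  rcases le_or_gt a 0 with ha | ha
  · rw [abs_of_nonpos ha] at h
    exact iff_of_false ha.not_gt (by nlinarith)
  · rw [abs_of_pos ha] at h
    exact iff_of_true ha (by nlinarith)

theorem isLittleO_sub_of_level [FiniteDimensional ℝ V] {r₁ r₂ : V → ℝ} {r₁' r₂' : V →L[ℝ] ℝ}
    (hF : HasFDerivWithinAt F D K x₀)
    (h₁ : HasFDerivWithinAt r₁ r₁' K x₀) (h₂ : HasFDerivWithinAt r₂ r₂' K x₀)
    (hinj : Function.Injective (D.prod r₁')) {c : ℝ} {q : W →L[ℝ] ℝ}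
    (hq : r₂' = c • r₁' + q ∘L D) :
    (fun y => r₂ y - r₂ x₀ - c * (r₁ y - r₁ x₀)) =o[𝓝[K ∩ {y | F y = F x₀}] x₀]
      fun y => r₁ y - r₁ x₀ := by
  have hind : Topology.IsInducing (D.prod r₁') :=
    (LinearMap.isClosedEmbedding_of_injective (f := (D.prod r₁' : V →ₗ[ℝ] W × ℝ))
      (LinearMap.ker_eq_bot.2 hinj)).isInducing
  have hd : HasFDerivWithinAt (fun y => r₂ y - (c * r₁ y + q (F y))) (0 : V →L[ℝ] ℝ) K x₀ := by
    have := h₂.sub ((h₁.const_mul c).add (q.hasFDerivAt.comp_hasFDerivWithinAt x₀ hF))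
    rwa [hq, sub_self] at this
  have ho := hd.isLittleO
  simp only [zero_apply, sub_zero] at ho
  refine IsLittleO.of_norm_norm (((ho.trans_isBigO ((hF.prodMk h₁).isTheta_sub hind).2).mono
    (nhdsWithin_mono x₀ inter_subset_left)).norm_norm.congr' ?_ ?_) <;>
    filter_upwards [self_mem_nhdsWithin] with y ⟨_, hy⟩
  · rw [hy]
    congr 1
    ring
  · simp [Prod.norm_def, show F y = F x₀ from hy]

/-- Moving along a level set of `F`, two functions increase together if their derivatives are
positively proportional on the kernel of the derivative of `F`. -/
theorem eventually_lt_iff_lt_of_level [FiniteDimensional ℝ V] {r₁ r₂ : V → ℝ}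
    {r₁' r₂' : V →L[ℝ] ℝ} (hF : HasFDerivWithinAt F D K x₀)
    (h₁ : HasFDerivWithinAt r₁ r₁' K x₀) (h₂ : HasFDerivWithinAt r₂ r₂' K x₀)
    (hinj : Function.Injective (D.prod r₁')) {c : ℝ} (hc : 0 < c) {q : W →L[ℝ] ℝ}
    (hq : r₂' = c • r₁' + q ∘L D) :
    ∀ᶠ y in 𝓝[K ∩ {y | F y = F x₀}] x₀,
      (r₁ y < r₁ x₀ ↔ r₂ y < r₂ x₀) ∧ (r₁ x₀ < r₁ y ↔ r₂ x₀ < r₂ y) := by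
  filter_upwards [(isLittleO_sub_of_level hF h₁ h₂ hinj hq).bound (half_pos hc)] with y hy
  rw [Real.norm_eq_abs, Real.norm_eq_abs] at hy
  have hup := pos_iff_pos_of_abs_sub_mul_le hc hy
  rw [← abs_neg, ← abs_neg (r₁ y - r₁ x₀),
    show -(r₂ y - r₂ x₀ - c * (r₁ y - r₁ x₀)) = -(r₂ y - r₂ x₀) - c * -(r₁ y - r₁ x₀) by ring] at hy
  have hdown := pos_iff_pos_of_abs_sub_mul_le hc hy
  simp only [neg_sub, sub_pos] at hup hdown
  exact ⟨hdown, hup⟩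

theorem exists_lipschitzOnWith_sub_of_convex (hK : Convex ℝ K) (hx₀ : x₀ ∈ K)
    (hu : UniqueDiffWithinAt ℝ K x₀) (hF : ContDiffWithinAt ℝ 1 F K x₀)
    (hD : HasFDerivWithinAt F D K x₀) {c : ℝ≥0} (hc : 0 < c) :
    ∃ u ∈ 𝓝[K] x₀, LipschitzOnWith c (fun x => F x - D x) u := by
  obtain ⟨u, hu_mem, -, -, f', hf', hf'c⟩ :=
    (contDiffWithinAt_succ_iff_hasFDerivWithinAt' (n := 0) (by simp)).1 (by simpa using hF)
  rw [insert_eq_of_mem hx₀] at hu_mem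
  have hfD : f' x₀ = D := hu.eq (hf' x₀ (mem_of_mem_nhdsWithin hx₀ hu_mem)) hD
  have hclose : ∀ᶠ x in 𝓝[K] x₀, ‖f' x - D‖ ≤ c := by
    have := hf'c.continuousWithinAt
    rw [ContinuousWithinAt, hfD] at this
    filter_upwards [this (Metric.closedBall_mem_nhds D (ε := c) hc)] with x hx
    simpa [dist_eq_norm] using hx
  obtain ⟨ε, hε, hball⟩ := Metric.mem_nhdsWithin_iff.1 (inter_mem hu_mem hclose)
  refine ⟨Metric.ball x₀ ε ∩ K, Metric.mem_nhdsWithin_iff.2 ⟨ε, hε, subset_rfl⟩,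
    LipschitzOnWith.of_dist_le_mul fun x hx y hy => ?_⟩
  rw [dist_eq_norm, dist_eq_norm,
    show F x - D x - (F y - D y) = F x - F y - D (x - y) by rw [map_sub]; abel]
  exact ((convex_ball x₀ ε).inter hK).norm_image_sub_le_of_norm_hasFDerivWithin_le'
    (fun z hz => (hf' z (hball hz).1).mono inter_subset_right) (fun z hz => (hball hz).2) hy hx

theorem exists_pos_mul_lt_nnnorm_symm_inv (e : V ≃L[ℝ] W) {C : ℝ≥0} (hC : 0 < C) :
    ∃ c : ℝ≥0, 0 < c ∧ (Subsingleton V ∨ C * c < ‖(e.symm : W →L[ℝ] V)‖₊⁻¹) := by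
  rcases e.subsingleton_or_nnnorm_symm_pos with h | h
  · exact ⟨1, one_pos, Or.inl h⟩
  · refine ⟨‖(e.symm : W →L[ℝ] V)‖₊⁻¹ / 2 / C, by positivity, Or.inr ?_⟩
    rw [mul_div_cancel₀ _ hC.ne']
    exact NNReal.half_lt_self (inv_pos.2 h).ne'

/-- Since `F` is only controlled on the convex set `K`, the inverse function theorem is applied to
a Lipschitz extension of `F - D` to the whole space. -/
theorem exists_homeomorph_eventuallyEq [FiniteDimensional ℝ V] [FiniteDimensional ℝ W]
    {s : V →L[ℝ] ℝ} (hK : Convex ℝ K) (hx₀ : x₀ ∈ K) (hu : UniqueDiffWithinAt ℝ K x₀)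
    (hF : ContDiffWithinAt ℝ 1 F K x₀) (hD : HasFDerivWithinAt F D K x₀)
    (hbij : Function.Bijective (D.prod s)) :
    ∃ Ψ : V ≃ₜ W × ℝ, (∀ x, (Ψ x).2 = s x) ∧ ∀ᶠ x in 𝓝[K] x₀, Ψ x = (F x, s x) := by
  let e : V ≃L[ℝ] W × ℝ :=
    (LinearEquiv.ofBijective (D.prod s : V →ₗ[ℝ] W × ℝ) hbij).toContinuousLinearEquiv
  obtain ⟨c, hc, hc_lt⟩ := exists_pos_mul_lt_nnnorm_symm_inv e (lipschitzExtensionConstant_pos W)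
  obtain ⟨u, hu_mem, hlip⟩ := exists_lipschitzOnWith_sub_of_convex hK hx₀ hu hF hD hc
  obtain ⟨g, hg, hgeq⟩ := hlip.extend_finite_dimension
  have happ : ApproximatesLinearOn (fun x => (D x + g x, s x)) (e : V →L[ℝ] W × ℝ) univ
      (lipschitzExtensionConstant W * c) := by
    rw [ApproximatesLinearOn.approximatesLinearOn_iff_lipschitzOnWith, lipschitzOnWith_univ]
    have hsub : (fun x => (D x + g x, s x)) - ⇑(e : V →L[ℝ] W × ℝ) = fun x => (g x, (0 : ℝ)) := by
      ext x
      · exact add_sub_cancel_left (D x) (g x)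
      · exact sub_self (s x)
    rw [hsub]
    exact LipschitzWith.of_dist_le_mul fun x y => by simpa [Prod.dist_eq] using hg.dist_le_mul x y
  refine ⟨happ.toHomeomorph _ hc_lt, fun x => rfl, ?_⟩
  filter_upwards [hu_mem] with x hx
  change (D x + g x, s x) = (F x, s x)
  rw [← hgeq hx, add_sub_cancel]

end LevelSet

section LocalCoordinate

variable {α : Type*} [TopologicalSpace α]

/-- The germ at `x` of the part of `N` on which the coordinate `r` is smaller than at `x`. -/
def below (N : Set α) (r : α → ℝ) (x : α) : Filter α :=
  𝓝[N ∩ r ⁻¹' Iio (r x)] x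

/-- The germ at `x` of the part of `N` on which the coordinate `r` is larger than at `x`. -/
def above (N : Set α) (r : α → ℝ) (x : α) : Filter α :=
  𝓝[N ∩ r ⁻¹' Ioi (r x)] x

/-- Near `p`, the function `r` identifies `N` with the set `T` of parameters, with inverse `γ`. -/
structure IsLocalCoordinate (N : Set α) (T : Set ℝ) (r : α → ℝ) (γ : ℝ → α) (p : α) : Prop where
  mem : p ∈ N
  left_inv : ∀ᶠ y in 𝓝[N] p, r y ∈ T ∧ γ (r y) = y ∧ ContinuousWithinAt r N y
  right_inv : ∀ᶠ t in 𝓝[T] (r p), γ t ∈ N ∧ r (γ t) = t ∧ ContinuousWithinAt γ T t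

variable {N : Set α} {T : Set ℝ} {r : α → ℝ} {γ : ℝ → α} {p : α} {L R : α → Filter α} {a b : ℝ}

theorem exists_Icc_mem_nhdsWithin {c : ℝ} {U : Set ℝ} (hT : T = univ ∨ T = Ici c ∨ T = Iic c)
    (hU : U ∈ 𝓝[T] c) : ∃ a b, c ∈ Icc a b ∧ Icc a b ∈ 𝓝[T] c ∧ Icc a b ⊆ U := by
  rcases hT with rfl | rfl | rfl
  · rw [nhdsWithin_univ] at hU ⊢
    exact exists_Icc_mem_subset_of_mem_nhds hU
  · obtain ⟨b, hb, h⟩ := exists_Icc_mem_subset_of_mem_nhdsGE hU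
    exact ⟨c, b, ⟨le_rfl, hb⟩, h⟩
  · obtain ⟨a, ha, h⟩ := exists_Icc_mem_subset_of_mem_nhdsLE hU
    exact ⟨a, c, ⟨ha, le_rfl⟩, h⟩

namespace IsLocalCoordinate

theorem apply_mem (h : IsLocalCoordinate N T r γ p) : r p ∈ T :=
  (h.left_inv.self_of_nhdsWithin h.mem).1

theorem tendsto_coord (h : IsLocalCoordinate N T r γ p) : Tendsto r (𝓝[N] p) (𝓝[T] (r p)) :=
  tendsto_nhdsWithin_of_tendsto_nhds_of_eventually_within _
    (h.left_inv.self_of_nhdsWithin h.mem).2.2 (h.left_inv.mono fun _ hy => hy.1)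

theorem tendsto_param (h : IsLocalCoordinate N T r γ p) : Tendsto γ (𝓝[T] (r p)) (𝓝[N] p) := by
  have hγ := (h.right_inv.self_of_nhdsWithin h.apply_mem).2.2
  rw [ContinuousWithinAt, (h.left_inv.self_of_nhdsWithin h.mem).2.1] at hγ
  exact tendsto_nhdsWithin_of_tendsto_nhds_of_eventually_within _ hγ
    (h.right_inv.mono fun _ ht => ht.1)

theorem map_nhdsWithin (h : IsLocalCoordinate N T r γ p) (S : Set ℝ) :
    map γ (𝓝[T ∩ S] (r p)) = 𝓝[N ∩ r ⁻¹' S] p := by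
  have hr : Tendsto r (𝓝[N ∩ r ⁻¹' S] p) (𝓝[T ∩ S] (r p)) := by
    rw [nhdsWithin_inter', nhdsWithin_inter']
    exact h.tendsto_coord.inf (tendsto_principal_principal.2 fun _ => id)
  refine le_antisymm ?_ ?_
  · rw [nhdsWithin_inter', nhdsWithin_inter']
    refine tendsto_inf.2 ⟨h.tendsto_param.mono_left inf_le_left, tendsto_principal.2 ?_⟩
    filter_upwards [mem_inf_of_left h.right_inv, mem_inf_of_right (mem_principal_self S)]
      with t ht htS
    rwa [mem_preimage, ht.2.1]
  · intro A hA
    filter_upwards [hr hA, nhdsWithin_mono p inter_subset_left h.left_inv] with y hy hinv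
    rwa [mem_preimage, mem_preimage, hinv.2.1] at hy

theorem below_eq_map (h : IsLocalCoordinate N T r γ p) :
    below N r p = map γ (𝓝[T ∩ Iio (r p)] (r p)) :=
  (h.map_nhdsWithin _).symm

theorem above_eq_map (h : IsLocalCoordinate N T r γ p) :
    above N r p = map γ (𝓝[T ∩ Ioi (r p)] (r p)) :=
  (h.map_nhdsWithin _).symm

theorem eventually_isLocalCoordinate (h : IsLocalCoordinate N T r γ p) :
    ∀ᶠ y in 𝓝[N] p, IsLocalCoordinate N T r γ y := by
  filter_upwards [self_mem_nhdsWithin, eventually_eventually_nhdsWithin.2 h.left_inv,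
    h.tendsto_coord.eventually (eventually_eventually_nhdsWithin.2 h.right_inv)] with y hy hl hr
  exact ⟨hy, hl, hr⟩

theorem isArc (hab : Icc a b ⊆ T) (hcoord : ∀ t ∈ Icc a b, IsLocalCoordinate N T r γ (γ t))
    (hr : ∀ t ∈ Icc a b, r (γ t) = t) (hL : ∀ t ∈ Icc a b, L (γ t) = below N r (γ t))
    (hR : ∀ t ∈ Icc a b, R (γ t) = above N r (γ t)) (hle : a ≤ b) : IsArc N L R γ a b where
  continuousOn t ht := by
    have := ((hcoord t ht).right_inv.self_of_nhdsWithin (hcoord t ht).apply_mem).2.2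
    rw [hr t ht] at this
    exact this.mono hab
  injOn := LeftInvOn.injOn hr
  mapsTo t ht := (hcoord t ht).mem
  left t ht := by
    have ht' := Ioc_subset_Icc_self ht
    rw [hL t ht', (hcoord t ht').below_eq_map, hr t ht', inter_comm, nhdsWithin_inter_of_mem']
    filter_upwards [Ioo_mem_nhdsLT ht.1] with x hx using hab ⟨hx.1.le, hx.2.le.trans ht.2⟩
  left_end := by
    rw [hL a ⟨le_rfl, hle⟩]
    filter_upwards [self_mem_nhdsWithin]
    rintro _ ⟨-, hlt⟩ ⟨t, ht, rfl⟩
    rw [mem_preimage, hr t ht, hr a ⟨le_rfl, hle⟩] at hlt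
    exact ht.1.not_gt hlt
  right t ht := by
    have ht' := Ico_subset_Icc_self ht
    rw [hR t ht', (hcoord t ht').above_eq_map, hr t ht', inter_comm, nhdsWithin_inter_of_mem']
    filter_upwards [Ioo_mem_nhdsGT ht.2] with x hx using hab ⟨ht.1.trans hx.1.le, hx.2.le⟩
  right_end := by
    rw [hR b ⟨hle, le_rfl⟩]
    filter_upwards [self_mem_nhdsWithin]
    rintro _ ⟨-, hlt⟩ ⟨t, ht, rfl⟩
    rw [mem_preimage, hr t ht, hr b ⟨hle, le_rfl⟩] at hlt
    exact ht.2.not_gt hlt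

theorem hasArcNhd (h : IsLocalCoordinate N T r γ p)
    (hT : T = univ ∨ T = Ici (r p) ∨ T = Iic (r p))
    (hL : ∀ᶠ y in 𝓝[N] p, L y = below N r y) (hR : ∀ᶠ y in 𝓝[N] p, R y = above N r y) :
    HasArcNhd N L R p := by
  obtain ⟨a, b, hmem, hnhds, hsub⟩ := exists_Icc_mem_nhdsWithin hT
    (inter_mem self_mem_nhdsWithin (inter_mem h.right_inv
      (h.tendsto_param.eventually (h.eventually_isLocalCoordinate.and (hL.and hR)))))
  refine ⟨γ, a, b, isArc (fun t ht => (hsub ht).1) (fun t ht => (hsub ht).2.2.1)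
    (fun t ht => (hsub ht).2.1.2.1) (fun t ht => (hsub ht).2.2.2.1) (fun t ht => (hsub ht).2.2.2.2)
    (hmem.1.trans hmem.2), ?_⟩
  have hmap := h.map_nhdsWithin univ
  simp only [inter_univ, preimage_univ] at hmap
  rw [← hmap]
  exact image_mem_map hnhds

theorem endSign_univ (h : IsLocalCoordinate N univ r γ p) (hL : L p = below N r p)
    (hR : R p = above N r p) : endSign L R p = 0 := by
  rw [h.below_eq_map, univ_inter] at hL
  rw [h.above_eq_map, univ_inter] at hR
  have : NeBot (L p) := hL ▸ inferInstance
  have : NeBot (R p) := hR ▸ inferInstance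
  exact endSign_of_neBot

theorem endSign_Ici (h : IsLocalCoordinate N (Ici (r p)) r γ p) (hL : L p = below N r p)
    (hR : R p = above N r p) : endSign L R p = -1 := by
  rw [h.below_eq_map, Ici_inter_Iio, Ico_self, nhdsWithin_empty, map_bot] at hL
  rw [h.above_eq_map, inter_eq_right.2 Ioi_subset_Ici_self] at hR
  have : NeBot (R p) := hR ▸ inferInstance
  exact endSign_of_left_eq_bot hL

theorem endSign_Iic (h : IsLocalCoordinate N (Iic (r p)) r γ p) (hL : L p = below N r p)
    (hR : R p = above N r p) : endSign L R p = 1 := by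
  rw [h.above_eq_map, Iic_inter_Ioi, Ioc_self, nhdsWithin_empty, map_bot] at hR
  rw [h.below_eq_map, inter_eq_right.2 Iio_subset_Iic_self] at hL
  have : NeBot (L p) := hL ▸ inferInstance
  exact endSign_of_right_eq_bot hR

end IsLocalCoordinate

end LocalCoordinate

section Level

variable {V W : Type*} [NormedAddCommGroup V] [NormedSpace ℝ V] [FiniteDimensional ℝ V]
  [NormedAddCommGroup W] [NormedSpace ℝ W] [FiniteDimensional ℝ W]
  {F : V → W} {D : V →L[ℝ] W} {K : Set V} {x₀ : V} {s : V →L[ℝ] ℝ} {T : Set ℝ}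

theorem exists_isLocalCoordinate_level (hK : Convex ℝ K) (hx₀ : x₀ ∈ K)
    (hu : UniqueDiffWithinAt ℝ K x₀) (hF : ContDiffWithinAt ℝ 1 F K x₀)
    (hD : HasFDerivWithinAt F D K x₀) (hbij : Function.Bijective (D.prod s))
    (hFx₀ : F x₀ = 0) (hT : ∀ᶠ v in 𝓝 x₀, v ∈ K ↔ s v ∈ T) :
    ∃ γ, IsLocalCoordinate {v | v ∈ K ∧ F v = 0} T s γ x₀ := by
  obtain ⟨Ψ, hΨs, hΨ⟩ := exists_homeomorph_eventuallyEq hK hx₀ hu hF hD hbij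
  have hγ : Continuous fun t : ℝ => Ψ.symm (0, t) := by fun_prop
  have hγx₀ : Ψ.symm (0, s x₀) = x₀ := by
    rw [Ψ.symm_apply_eq, hΨ.self_of_nhdsWithin hx₀, hFx₀]
  have hsγ (t : ℝ) : s (Ψ.symm (0, t)) = t := by rw [← hΨs, Ψ.apply_symm_apply]
  refine ⟨fun t => Ψ.symm (0, t), ⟨hx₀, hFx₀⟩, ?_, ?_⟩
  · filter_upwards [self_mem_nhdsWithin, nhdsWithin_le_nhds hT,
      nhdsWithin_mono x₀ (fun _ => And.left) hΨ] with v ⟨hvK, hv⟩ hvT hvΨ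
    refine ⟨hvT.1 hvK, ?_, s.continuous.continuousWithinAt⟩
    rw [Ψ.symm_apply_eq, hvΨ, hv]
  · have hγ₀ := hγ.tendsto (s x₀)
    rw [hγx₀] at hγ₀
    filter_upwards [self_mem_nhdsWithin, nhdsWithin_le_nhds (hγ₀.eventually hT),
      nhdsWithin_le_nhds (hγ₀.eventually (eventually_nhdsWithin_iff.1 hΨ))] with t ht htT htΨ
    have hmem : Ψ.symm (0, t) ∈ K := htT.2 (by rwa [hsγ])
    refine ⟨⟨hmem, ?_⟩, hsγ t, hγ.continuousWithinAt⟩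
    have := htΨ hmem
    rw [Ψ.apply_symm_apply] at this
    exact (congrArg Prod.fst this).symm

end Level

theorem IsLocalCoordinate.comp_extChartAt {E H Z : Type*} [NormedAddCommGroup E] [NormedSpace ℝ E]
    [TopologicalSpace H] {I : ModelWithCorners ℝ E H} [TopologicalSpace Z] [ChartedSpace H Z]
    {N : Set Z} {N' : Set E} {T : Set ℝ} {r : E → ℝ} {γ : ℝ → E} {p : Z}
    (h : IsLocalCoordinate N' T r γ (extChartAt I p p)) (hN' : N' ⊆ range I)
    (hN : ∀ᶠ y in 𝓝 p, extChartAt I p y ∈ N' ↔ y ∈ N) :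
    IsLocalCoordinate N T (r ∘ extChartAt I p) ((extChartAt I p).symm ∘ γ) p := by
  have htend {y : Z} (hy : y ∈ (extChartAt I p).source)
      (hyN : ∀ᶠ z in 𝓝 y, extChartAt I p z ∈ N' ↔ z ∈ N) :
      Tendsto (extChartAt I p) (𝓝[N] y) (𝓝[N'] extChartAt I p y) :=
    tendsto_nhdsWithin_iff.2 ⟨(continuousAt_extChartAt' hy).mono_left nhdsWithin_le_nhds,
      eventually_nhdsWithin_iff.2 (hyN.mono fun z hz => hz.2)⟩
  refine ⟨hN.self_of_nhds.1 h.mem, ?_, ?_⟩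
  · filter_upwards [nhdsWithin_le_nhds (extChartAt_source_mem_nhds (I := I) p),
      nhdsWithin_le_nhds (eventually_eventually_nhds.2 hN),
      (htend (mem_extChartAt_source p) hN).eventually h.left_inv] with y hy hyN ⟨hT, hγ, hr⟩
    refine ⟨hT, ?_, hr.tendsto.comp (htend hy hyN)⟩
    rw [Function.comp_apply, Function.comp_apply, hγ, (extChartAt I p).left_inv hy]
  · have htarget : (extChartAt I p).target ∈ 𝓝[N'] extChartAt I p p :=
      nhdsWithin_mono _ hN' (extChartAt_target_mem_nhdsWithin p)
    have hsymm : Tendsto (extChartAt I p).symm (𝓝[N'] extChartAt I p p) (𝓝 p) := by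
      have := (continuousAt_extChartAt_symm (I := I) p).tendsto
      rw [extChartAt_to_inv] at this
      exact this.mono_left nhdsWithin_le_nhds
    filter_upwards [h.right_inv, h.tendsto_param htarget,
      (hsymm.comp h.tendsto_param).eventually hN] with t ⟨hγN, hrγ, hγ⟩ ht htN
    rw [Function.comp_apply, (extChartAt I p).right_inv ht] at htN
    refine ⟨htN.1 hγN, ?_, (continuousAt_extChartAt_symm'' ht).comp_continuousWithinAt hγ⟩
    rw [Function.comp_apply, Function.comp_apply, (extChartAt I p).right_inv ht, hrγ]

/-! ### Fiber products -/

section CoordinateChange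

variable {V₁ V₂ W₁ W₂ : Type*} [AddCommGroup V₁] [Module ℝ V₁] [AddCommGroup V₂] [Module ℝ V₂]
  [AddCommGroup W₁] [Module ℝ W₁] [AddCommGroup W₂] [Module ℝ W₂] {n₁ n₂ m₁ m₂ : ℕ}

theorem prodBasis_map (c₁ : Basis (Fin m₁) ℝ W₁) (c₂ : Basis (Fin m₂) ℝ W₂) {W₁' W₂' : Type*}
    [AddCommGroup W₁'] [Module ℝ W₁'] [AddCommGroup W₂'] [Module ℝ W₂']
    (S₁ : W₁ ≃ₗ[ℝ] W₁') (S₂ : W₂ ≃ₗ[ℝ] W₂') :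
    prodBasis (c₁.map S₁) (c₂.map S₂) = (prodBasis c₁ c₂).map (S₁.prodCongr S₂) := by
  refine Basis.eq_of_apply_eq fun i => ?_
  rw [Basis.map_apply, coe_prodBasis, coe_prodBasis]
  refine Fin.addCases (fun j => ?_) (fun j => ?_) i <;> simp [prodFrame]

theorem orientedDet_map {σ₁ σ₁' : LinearRelOrientation V₁ W₁ n₁ m₁}
    {σ₂ σ₂' : LinearRelOrientation V₂ W₂ n₂ m₂} (h : m₁ + m₂ + 1 = n₁ + n₂)
    (b₁ : Basis (Fin n₁) ℝ V₁) (b₂ : Basis (Fin n₂) ℝ V₂)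
    (c₁ : Basis (Fin m₁) ℝ W₁) (c₂ : Basis (Fin m₂) ℝ W₂)
    (T₁ : V₁ ≃ₗ[ℝ] V₁) (T₂ : V₂ ≃ₗ[ℝ] V₂) (S₁ : W₁ ≃ₗ[ℝ] W₁) (S₂ : W₂ ≃ₗ[ℝ] W₂)
    (h₁ : ∀ θ, Orientation.map _ S₁ (σ₁.toFun θ) = σ₁'.toFun (Orientation.map _ T₁ θ))
    (h₂ : ∀ θ, Orientation.map _ S₂ (σ₂.toFun θ) = σ₂'.toFun (Orientation.map _ T₂ θ))
    {T T' : V₁ × V₂ →ₗ[ℝ] (W₁ × W₂) × ℝ}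
    (hT : ∀ x : V₁ × V₂, T' (T₁ x.1, T₂ x.2) = ((S₁ (T x).1.1, S₂ (T x).1.2), (T x).2)) :
    orientedDet σ₁' σ₂' h (b₁.map T₁) (b₂.map T₂) (c₁.map S₁) (c₂.map S₂) T'
      = orientedDet σ₁ σ₂ h b₁ b₂ c₁ c₂ T := by
  have e₁ : σ₁'.Pos (b₁.map T₁) (c₁.map S₁) ↔ σ₁.Pos b₁ c₁ :=
    σ₁.pos_map_iff σ₁' b₁ T₁ S₁ h₁ b₁ c₁
  have e₂ : σ₂'.Pos (b₂.map T₂) (c₂.map S₂) ↔ σ₂.Pos b₂ c₂ :=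
    σ₂.pos_map_iff σ₂' b₂ T₂ S₂ h₂ b₂ c₂
  rw [orientedDet, orientedDet, signOf_congr e₁, signOf_congr e₂]
  congr 1
  have hs : snocBasis (prodBasis (c₁.map S₁) (c₂.map S₂))
      = (snocBasis (prodBasis c₁ c₂)).map
        ((S₁.prodCongr S₂).prodCongr (LinearEquiv.refl ℝ ℝ)) := by
    rw [snocBasis, snocBasis, ← prodBasis_map, prodBasis_map c₁ c₂]
    congr 1
  rw [frameDet, frameDet, hs, Basis.det_map]
  congr 1
  funext j
  have hv : ∀ i, prodFrame (b₁.map T₁) (b₂.map T₂) i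
      = (T₁ (prodFrame b₁ b₂ i).1, T₂ (prodFrame b₁ b₂ i).2) := fun i => by
    refine Fin.addCases (fun j => ?_) (fun j => ?_) i <;> simp [prodFrame]
  simp only [Function.comp_apply]
  rw [hv, hT, LinearEquiv.symm_apply_eq]
  rfl

theorem continuousAt_orientedDet {α : Type*} [TopologicalSpace α] {W₁ W₂ : Type*}
    [NormedAddCommGroup W₁] [NormedSpace ℝ W₁] [FiniteDimensional ℝ W₁]
    [NormedAddCommGroup W₂] [NormedSpace ℝ W₂] [FiniteDimensional ℝ W₂]
    (σ₁ : LinearRelOrientation V₁ W₁ n₁ m₁)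
    (σ₂ : LinearRelOrientation V₂ W₂ n₂ m₂) (h : m₁ + m₂ + 1 = n₁ + n₂)
    (v₁ : Fin n₁ → V₁) (v₂ : Fin n₂ → V₂)
    (c₁ : Basis (Fin m₁) ℝ W₁) (c₂ : Basis (Fin m₂) ℝ W₂)
    {A : α → V₁ →ₗ[ℝ] W₁ × W₂} {B : α → V₂ →ₗ[ℝ] W₁ × W₂} {x₀ : α} (s : V₁ × V₂ →ₗ[ℝ] ℝ)
    (hA : ∀ v, ContinuousAt (fun x => A x v) x₀) (hB : ∀ v, ContinuousAt (fun x => B x v) x₀) :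
    ContinuousAt (fun x => orientedDet σ₁ σ₂ h v₁ v₂ c₁ c₂ (diffProd (A x) (B x) s)) x₀ := by
  unfold orientedDet
  refine continuousAt_const.mul ?_
  simp only [frameDet, Basis.det_apply, diffProd_apply]
  have hdet : Continuous fun M : Matrix (Fin (m₁ + m₂ + 1)) (Fin (m₁ + m₂ + 1)) ℝ => M.det :=
    continuous_id.matrix_det
  refine hdet.continuousAt.comp (f := fun x => (snocBasis (prodBasis c₁ c₂)).toMatrix _) ?_
  refine continuousAt_pi.2 fun i => continuousAt_pi.2 fun j => ?_
  simp only [Basis.toMatrix_apply]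
  have hl : Continuous ((snocBasis (prodBasis c₁ c₂)).coord i) :=
    LinearMap.continuous_of_finiteDimensional _
  exact hl.continuousAt.comp (f := fun x => _) (((hA _).sub (hB _)).prodMk continuousAt_const)

end CoordinateChange

section TangentCoordinates

variable {E : Type*} [NormedAddCommGroup E] [NormedSpace ℝ E] {H : Type*} [TopologicalSpace H]
  (I : ModelWithCorners ℝ E H) {Z : Type*} [TopologicalSpace Z] [ChartedSpace H Z]
  [IsManifold I ∞ Z]
  {F : Type*} [NormedAddCommGroup F] [NormedSpace ℝ F] {G : Type*} [TopologicalSpace G]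
  (J : ModelWithCorners ℝ F G) {X : Type*} [TopologicalSpace X] [ChartedSpace G X]
  [IsManifold J ∞ X]

/-- The passage from the preferred chart at `u` to that at `u₀`, on the tangent space at `u`. -/
noncomputable def tangentEquiv (u₀ u : Z)
    (hu : u ∈ (trivializationAt E (TangentSpace I) u₀).baseSet) : E ≃L[ℝ] E :=
  (trivializationAt E (TangentSpace I) u₀).continuousLinearEquivAt ℝ u hu

theorem eventually_mem_baseSet (u₀ : Z) :
    ∀ᶠ u in 𝓝 u₀, u ∈ (trivializationAt E (TangentSpace I) u₀).baseSet :=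
  (trivializationAt E (TangentSpace I) u₀).open_baseSet.mem_nhds
    (FiberBundle.mem_baseSet_trivializationAt' u₀)

theorem coe_tangentEquiv {u₀ u : Z}
    (hu : u ∈ (trivializationAt E (TangentSpace I) u₀).baseSet) :
    (tangentEquiv I u₀ u hu : E →L[ℝ] E) = mfderiv I 𝓘(ℝ, E) (extChartAt I u₀) u := by
  have hu' : u ∈ (chartAt H u₀).source := by simpa using hu
  rw [← TangentBundle.continuousLinearMapAt_trivializationAt hu']
  exact (trivializationAt E (TangentSpace I) u₀).coe_continuousLinearEquivAt_eq' (R := ℝ) hu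

theorem tangentEquiv_self (u₀ : Z)
    (hu : u₀ ∈ (trivializationAt E (TangentSpace I) u₀).baseSet) :
    tangentEquiv I u₀ u₀ hu = ContinuousLinearEquiv.refl ℝ E := by
  have : (tangentEquiv I u₀ u₀ hu : E →L[ℝ] E) = ContinuousLinearMap.id ℝ E := by
    rw [coe_tangentEquiv]
    exact mfderiv_extChartAt_self
  ext x
  exact congrArg (fun φ : E →L[ℝ] E => φ x) this

theorem RelOrientation.eventually_map_eq {f : Z → X} (o : RelOrientation I J f)
    {u₀ : Z} {x₀ : X} (h₀ : f u₀ = x₀) : ∀ᶠ u in 𝓝 u₀, ∀ x, f u = x → ∀ hu hx θ,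
      Orientation.map _ (tangentEquiv J x₀ x hx).toLinearEquiv ((o.linear u).toFun θ)
        = (o.linear u₀).toFun (Orientation.map _ (tangentEquiv I u₀ u hu).toLinearEquiv θ) := by
  subst h₀
  obtain ⟨τ, hτ⟩ := o.locallyConstant u₀
  have hτ₀ : ∀ θ, (o.linear u₀).toFun θ = τ θ := fun θ => by
    have hu := FiberBundle.mem_baseSet_trivializationAt' (F := E) (E := TangentSpace I) u₀
    have hx := FiberBundle.mem_baseSet_trivializationAt' (F := F) (E := TangentSpace J) (f u₀)
    have := hτ.self_of_nhds hu hx θ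
    change Orientation.map _ (tangentEquiv J (f u₀) (f u₀) hx).toLinearEquiv
      ((o.linear u₀).toFun θ)
        = τ (Orientation.map _ (tangentEquiv I u₀ u₀ hu).toLinearEquiv θ) at this
    rw [tangentEquiv_self, tangentEquiv_self,
      show (ContinuousLinearEquiv.refl ℝ F).toLinearEquiv = LinearEquiv.refl ℝ F from rfl,
      show (ContinuousLinearEquiv.refl ℝ E).toLinearEquiv = LinearEquiv.refl ℝ E from rfl,
      Orientation.map_refl, Orientation.map_refl] at this
    exact this
  filter_upwards [hτ] with u hτu x hx hu' hx' θ
  subst hx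
  rw [hτ₀]
  exact hτu hu' hx' θ

theorem inTangentCoordinates_tangentEquiv (f : Z → X) {u₀ u : Z} {x₀ x : X} (h₀ : f u₀ = x₀)
    (h : f u = x) (hu : u ∈ (trivializationAt E (TangentSpace I) u₀).baseSet)
    (hx : x ∈ (trivializationAt F (TangentSpace J) x₀).baseSet) (v : E) :
    inTangentCoordinates I J id f (mfderiv I J f) u₀ u (tangentEquiv I u₀ u hu v)
      = tangentEquiv J x₀ x hx ((mfderiv I J f u : E →L[ℝ] F) v) := by
  subst h₀ h
  have hcoord : inTangentCoordinates I J id f (mfderiv I J f) u₀ u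
      = (tangentEquiv J (f u₀) (f u) hx : F →L[ℝ] F) ∘L mfderiv I J f u ∘L
        ((tangentEquiv I u₀ u hu).symm : E →L[ℝ] E) :=
    ContinuousLinearMap.inCoordinates_eq hu hx
  rw [hcoord]
  exact congrArg (fun w => tangentEquiv J (f u₀) (f u) hx ((mfderiv I J f u : E →L[ℝ] F) w))
    ((tangentEquiv I u₀ u hu).symm_apply_apply v)

theorem continuousAt_inTangentCoordinates {f : Z → X} (hf : ContMDiff I J ∞ f) (u₀ : Z) :
    ContinuousAt (inTangentCoordinates I J id f (mfderiv I J f) u₀) u₀ :=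
  ((hf u₀).mfderiv_const (m := 0) (by simp)).continuousAt

end TangentCoordinates

section Compactness

variable {Z Υ Y : Type*} [TopologicalSpace Z] [TopologicalSpace Υ] [TopologicalSpace Y]

/-- The fiber product of `f` and `g`. -/
def fiberProd (f : Z → Y) (g : Υ → Y) : Set (Z × Υ) := {p | f p.1 = g p.2}

theorem exists_le_nhds_or_mem_limitSet [T2Space Y] {f : Z → Y} (hf : Continuous f)
    (U : Ultrafilter Z) {y : Y} (hy : Tendsto f U (𝓝 y)) :
    (∃ u, (U : Filter Z) ≤ 𝓝 u ∧ f u = y) ∨ y ∈ limitSet f := by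
  by_cases hU : ∃ u, (U : Filter Z) ≤ 𝓝 u
  · obtain ⟨u, hu⟩ := hU
    exact Or.inl ⟨u, hu, tendsto_nhds_unique ((hf.tendsto u).mono_left hu) hy⟩
  · refine Or.inr (mem_iInter₂.2 fun K hK => ?_)
    have hKU : K ∉ U := fun hKU => by
      obtain ⟨u, -, hu⟩ := hK.ultrafilter_le_nhds U (le_principal_iff.2 hKU)
      exact hU ⟨u, hu⟩
    exact mem_closure_of_tendsto hy
      (mem_of_superset (Ultrafilter.compl_mem_iff_notMem.2 hKU) fun z hz => mem_image_of_mem f hz)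

theorem isCompact_fiberProd [T2Space Y] {f : Z → Y} {g : Υ → Y} (hf : Continuous f)
    (hg : Continuous g) (hK : IsCompact (closure (range f)))
    (h₁ : Disjoint (limitSet f) (range g)) (h₂ : Disjoint (limitSet g) (range f))
    (h₃ : Disjoint (limitSet f) (limitSet g)) : IsCompact (fiberProd f g) := by
  rw [isCompact_iff_ultrafilter_le_nhds]
  intro U hU
  have hN : ∀ᶠ p in (U : Filter (Z × Υ)), f p.1 = g p.2 := le_principal_iff.1 hU
  obtain ⟨y, -, hy⟩ := hK.ultrafilter_le_nhds (U.map fun p => f p.1) (le_principal_iff.2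
    (Ultrafilter.mem_map.2 (univ_mem' fun p => subset_closure (mem_range_self p.1))))
  have hyf : Tendsto (fun p : Z × Υ => f p.1) U (𝓝 y) := hy
  have hyg : Tendsto (fun p : Z × Υ => g p.2) U (𝓝 y) := hyf.congr' hN
  rcases exists_le_nhds_or_mem_limitSet hf (U.map Prod.fst) hyf,
    exists_le_nhds_or_mem_limitSet hg (U.map Prod.snd) hyg with
    ⟨⟨u, hu, hfu⟩ | hyf', ⟨P, hP, hgP⟩ | hyg'⟩
  · refine ⟨(u, P), hfu.trans hgP.symm, ?_⟩
    have : Tendsto id (U : Filter (Z × Υ)) (𝓝 u ×ˢ 𝓝 P) := Tendsto.prodMk hu hP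
    rwa [← nhds_prod_eq] at this
  · exact (h₂.notMem_of_mem_left hyg' ⟨u, hfu⟩).elim
  · exact (h₁.notMem_of_mem_left hyf' ⟨P, hgP⟩).elim
  · exact (h₃.notMem_of_mem_left hyf' hyg').elim

end Compactness

section LevelMap

variable {E₁ H₁ E₂ H₂ F G : Type*}
  [NormedAddCommGroup E₁] [NormedSpace ℝ E₁] [TopologicalSpace H₁]
  [NormedAddCommGroup E₂] [NormedSpace ℝ E₂] [TopologicalSpace H₂]
  [NormedAddCommGroup F] [NormedSpace ℝ F] [TopologicalSpace G]
  (I₁ : ModelWithCorners ℝ E₁ H₁) (I₂ : ModelWithCorners ℝ E₂ H₂) (J : ModelWithCorners ℝ F G)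
  {Z Υ Y : Type*}
  [TopologicalSpace Z] [ChartedSpace H₁ Z]
  [TopologicalSpace Υ] [ChartedSpace H₂ Υ]
  [TopologicalSpace Y] [ChartedSpace G Y]

/-- The difference of `f` and `g`, read in charts. -/
noncomputable def levelMap (f : Z → Y) (g : Υ → Y) (p : Z × Υ) (v : E₁ × E₂) : F :=
  extChartAt J (f p.1) (f ((extChartAt I₁ p.1).symm v.1))
    - extChartAt J (g p.2) (g ((extChartAt I₂ p.2).symm v.2))

variable {I₁ I₂ J} {f : Z → Y} {g : Υ → Y}

variable (I₁ I₂ J f g) in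
/-- The difference of the differentials of `f` and `g`. -/
noncomputable def levelDeriv (p : Z × Υ) : E₁ × E₂ →L[ℝ] F :=
  let A : E₁ →L[ℝ] F := mfderiv I₁ J f p.1
  let B : E₂ →L[ℝ] F := mfderiv I₂ J g p.2
  A ∘L ContinuousLinearMap.fst ℝ E₁ E₂ - B ∘L ContinuousLinearMap.snd ℝ E₁ E₂

theorem hasFDerivWithinAt_levelMap (hf : ContMDiff I₁ J ∞ f) (hg : ContMDiff I₂ J ∞ g)
    (p : Z × Υ) :
    HasFDerivWithinAt (levelMap I₁ I₂ J f g p) (levelDeriv I₁ I₂ J f g p)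
      (range (I₁.prod I₂)) (extChartAt (I₁.prod I₂) p p) := by
  rw [ModelWithCorners.range_prod]
  have h₁ : HasFDerivWithinAt (fun v => extChartAt J (f p.1) (f ((extChartAt I₁ p.1).symm v)))
      (mfderiv I₁ J f p.1 : E₁ →L[ℝ] F) (range I₁) (extChartAt I₁ p.1 p.1) :=
    ((hf p.1).mdifferentiableAt (by simp)).hasMFDerivAt.2
  have h₂ : HasFDerivWithinAt (fun v => extChartAt J (g p.2) (g ((extChartAt I₂ p.2).symm v)))
      (mfderiv I₂ J g p.2 : E₂ →L[ℝ] F) (range I₂) (extChartAt I₂ p.2 p.2) :=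
    ((hg p.2).mdifferentiableAt (by simp)).hasMFDerivAt.2
  have h₁' := HasFDerivWithinAt.comp (f := Prod.fst) (s := range I₁ ×ˢ range I₂)
    (extChartAt (I₁.prod I₂) p p) h₁ hasFDerivWithinAt_fst (fun x hx => hx.1)
  have h₂' := HasFDerivWithinAt.comp (f := Prod.snd) (s := range I₁ ×ˢ range I₂)
    (extChartAt (I₁.prod I₂) p p) h₂ hasFDerivWithinAt_snd (fun x hx => hx.2)
  exact h₁'.sub h₂'

theorem contDiffWithinAt_levelMap (hf : ContMDiff I₁ J ∞ f) (hg : ContMDiff I₂ J ∞ g)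
    (p : Z × Υ) :
    ContDiffWithinAt ℝ 1 (levelMap I₁ I₂ J f g p)
      (range (I₁.prod I₂)) (extChartAt (I₁.prod I₂) p p) := by
  rw [ModelWithCorners.range_prod]
  have h₁ : ContDiffWithinAt ℝ 1 (fun v => extChartAt J (f p.1) (f ((extChartAt I₁ p.1).symm v)))
      (range I₁) (extChartAt I₁ p.1 p.1) :=
    (contMDiffAt_iff.1 ((hf p.1).of_le (m := 1) (by simp))).2
  have h₂ : ContDiffWithinAt ℝ 1 (fun v => extChartAt J (g p.2) (g ((extChartAt I₂ p.2).symm v)))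
      (range I₂) (extChartAt I₂ p.2 p.2) :=
    (contMDiffAt_iff.1 ((hg p.2).of_le (m := 1) (by simp))).2
  have h₁' := ContDiffWithinAt.comp (f := Prod.fst) (s := range I₁ ×ˢ range I₂)
    (extChartAt (I₁.prod I₂) p p) h₁ contDiffWithinAt_fst (fun x hx => hx.1)
  have h₂' := ContDiffWithinAt.comp (f := Prod.snd) (s := range I₁ ×ˢ range I₂)
    (extChartAt (I₁.prod I₂) p p) h₂ contDiffWithinAt_snd (fun x hx => hx.2)
  exact h₁'.sub h₂'

theorem eventually_levelMap_eq_zero_iff (hf : Continuous f) (hg : Continuous g) {p : Z × Υ}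
    (hp : p ∈ fiberProd f g) :
    ∀ᶠ y in 𝓝 p, levelMap I₁ I₂ J f g p (extChartAt (I₁.prod I₂) p y) = 0 ↔ y ∈ fiberProd f g := by
  have hu : ∀ᶠ y in 𝓝 p, y.1 ∈ (extChartAt I₁ p.1).source :=
    continuous_fst.continuousAt.eventually (extChartAt_source_mem_nhds p.1)
  have hP : ∀ᶠ y in 𝓝 p, y.2 ∈ (extChartAt I₂ p.2).source :=
    continuous_snd.continuousAt.eventually (extChartAt_source_mem_nhds p.2)
  have hfu : ∀ᶠ y in 𝓝 p, f y.1 ∈ (extChartAt J (f p.1)).source :=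
    (hf.comp continuous_fst).continuousAt.eventually (extChartAt_source_mem_nhds (f p.1))
  have hgP : ∀ᶠ y in 𝓝 p, g y.2 ∈ (extChartAt J (f p.1)).source :=
    (hg.comp continuous_snd).continuousAt.eventually
      ((show f p.1 = g p.2 from hp) ▸ extChartAt_source_mem_nhds (f p.1))
  filter_upwards [hu, hP, hfu, hgP] with y hu hP hfu hgP
  rw [levelMap, extChartAt_prod, PartialEquiv.prod_coe, (extChartAt I₁ p.1).left_inv hu,
    (extChartAt I₂ p.2).left_inv hP, ← show f p.1 = g p.2 from hp, sub_eq_zero]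
  exact (extChartAt J (f p.1)).injOn.eq_iff hfu hgP

end LevelMap

section BoundaryPoints

variable {E H Z : Type*} [NormedAddCommGroup E] [NormedSpace ℝ E] [TopologicalSpace H]
  {I : ModelWithCorners ℝ E H} [TopologicalSpace Z] [ChartedSpace H Z] {l : E →L[ℝ] ℝ} {u : Z}

theorem IsBorderedModel.convex_range (hI : IsBorderedModel I) : Convex ℝ (range I) := by
  obtain ⟨l, hl⟩ := hI
  rw [hl]
  exact convex_halfSpace_ge l.toLinearMap.isLinear 0

theorem IsBorderedModel.convex_range_prod {E' H' : Type*} [NormedAddCommGroup E'] [NormedSpace ℝ E']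
    [TopologicalSpace H'] {I' : ModelWithCorners ℝ E' H'} (hI : IsBorderedModel I)
    (hI' : IsBorderedModel I') : Convex ℝ (range (I.prod I')) := by
  rw [ModelWithCorners.range_prod]
  exact hI.convex_range.prod hI'.convex_range

theorem ne_zero_of_mem_boundary (hI : range I = {x | 0 ≤ l x}) (hu : u ∈ I.boundary Z) : l ≠ 0 := by
  rintro rfl
  have hu' : extChartAt I u u ∈ frontier (range I) := hu
  simp [hI] at hu'

theorem apply_extChartAt_eq_zero (hI : range I = {x | 0 ≤ l x}) (hu : u ∈ I.boundary Z) :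
    l (extChartAt I u u) = 0 := by
  have hu' : extChartAt I u u ∈ frontier (range I) := hu
  rw [frontier_range_eq hI (ne_zero_of_mem_boundary hI hu)] at hu'
  exact hu'

theorem range_mem_nhds_of_notMem_boundary (hu : u ∉ I.boundary Z) :
    range I ∈ 𝓝 (extChartAt I u u) :=
  mem_interior_iff_mem_nhds.1 ((I.isInteriorPoint_or_isBoundaryPoint u).resolve_right hu)

end BoundaryPoints

section Dimension

theorem finrank_le_of_sup_range_eq_top {V₁ V₂ W : Type*} [AddCommGroup V₁] [Module ℝ V₁]
    [AddCommGroup V₂] [Module ℝ V₂] [AddCommGroup W] [Module ℝ W] [FiniteDimensional ℝ V₁]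
    [FiniteDimensional ℝ V₂] {A : V₁ →ₗ[ℝ] W} {B : V₂ →ₗ[ℝ] W} (h : A.range ⊔ B.range = ⊤) :
    finrank ℝ W ≤ finrank ℝ V₁ + finrank ℝ V₂ := by
  rw [← finrank_top ℝ W, ← h]
  exact (Submodule.finrank_add_le_finrank_add_finrank _ _).trans
    (add_le_add A.finrank_range_le B.finrank_range_le)

variable {E₁ H₁ E₂ H₂ F G : Type*}
  [NormedAddCommGroup E₁] [NormedSpace ℝ E₁] [FiniteDimensional ℝ E₁] [TopologicalSpace H₁]
  [NormedAddCommGroup E₂] [NormedSpace ℝ E₂] [FiniteDimensional ℝ E₂] [TopologicalSpace H₂]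
  [NormedAddCommGroup F] [NormedSpace ℝ F] [TopologicalSpace G]
  {I₁ : ModelWithCorners ℝ E₁ H₁} {I₂ : ModelWithCorners ℝ E₂ H₂} {J : ModelWithCorners ℝ F G}
  {Z Υ Y : Type*} [TopologicalSpace Z] [ChartedSpace H₁ Z] [TopologicalSpace Υ] [ChartedSpace H₂ Υ]
  [TopologicalSpace Y] [ChartedSpace G Y] {f : Z → Y} {g : Υ → Y}

theorem BoundaryTransverseBoundary.notMem_boundary (ht : BoundaryTransverseBoundary I₁ I₂ J f g)
    (hI₁ : IsBorderedModel I₁) (hI₂ : IsBorderedModel I₂)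
    (hd : finrank ℝ E₁ + finrank ℝ E₂ = finrank ℝ F + 1) {p : Z × Υ} (hp : p ∈ fiberProd f g)
    (hp₁ : p.1 ∈ I₁.boundary Z) : p.2 ∉ I₂.boundary Υ := by
  intro hp₂
  obtain ⟨l₁, hl₁⟩ := hI₁
  obtain ⟨l₂, hl₂⟩ := hI₂
  have d₁ := finrank_boundaryTangent hl₁ (ne_zero_of_mem_boundary hl₁ hp₁)
  have d₂ := finrank_boundaryTangent hl₂ (ne_zero_of_mem_boundary hl₂ hp₂)
  have d := finrank_le_of_sup_range_eq_top (ht _ hp₁ _ hp₂ hp)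
  omega

theorem Transverse.disjoint_range (ht : Transverse I₁ I₂ J f g)
    (hd : Nonempty Z → Nonempty Υ → finrank ℝ E₁ + finrank ℝ E₂ < finrank ℝ F) :
    Disjoint (range f) (range g) := by
  rw [disjoint_left]
  rintro _ ⟨u, rfl⟩ ⟨P, hP⟩
  exact (hd ⟨u⟩ ⟨P⟩).not_ge (finrank_le_of_sup_range_eq_top (ht u P hP.symm))

theorem TransversePseudocycles.isCompact_fiberProd [T2Space Y]
    (hfg : TransversePseudocycles I₁ I₂ J f g)
    (hd : finrank ℝ E₁ + finrank ℝ E₂ = finrank ℝ F + 1) (hK : IsCompact (closure (range f))) :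
    IsCompact (fiberProd f g) := by
  obtain ⟨h₁, h₂, d₁, d₂, l₁, l₂, t₁, -, t₂, -, t₁₂⟩ := hfg.exists_maps
  have hr₁ := finrank_euclideanSpace_fin (𝕜 := ℝ) (n := h₁.dim)
  have hr₂ := finrank_euclideanSpace_fin (𝕜 := ℝ) (n := h₂.dim)
  refine Steenrod.isCompact_fiberProd hfg.stronglyTransverse.smooth_left.continuous
    hfg.stronglyTransverse.smooth_right.continuous hK
    ((t₁.disjoint_range fun n₁ _ => ?_).mono_left l₁)
    ((t₂.disjoint_range fun n₂ _ => ?_).mono_left l₂)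
    ((t₁₂.disjoint_range fun n₁ n₂ => ?_).mono l₁ l₂)
  · have := d₁ n₁
    omega
  · have := d₂ n₂
    omega
  · have := d₁ n₁
    have := d₂ n₂
    omega

end Dimension

section CoordDifferential

variable {E H F₁ G₁ F₂ G₂ Z X M : Type*} [NormedAddCommGroup E] [NormedSpace ℝ E]
  [TopologicalSpace H] (I : ModelWithCorners ℝ E H)
  [NormedAddCommGroup F₁] [NormedSpace ℝ F₁] [TopologicalSpace G₁]
  [NormedAddCommGroup F₂] [NormedSpace ℝ F₂] [TopologicalSpace G₂]
  (J₁ : ModelWithCorners ℝ F₁ G₁) (J₂ : ModelWithCorners ℝ F₂ G₂)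
  [TopologicalSpace Z] [ChartedSpace H Z]
  [TopologicalSpace X] [ChartedSpace G₁ X] [TopologicalSpace M] [ChartedSpace G₂ M]

variable {I J₁ J₂} in
theorem differential_prod {f : Z → X × M} (hf : ContMDiff I (J₁.prod J₂) ∞ f) (u : Z) (v : E) :
    differential I (J₁.prod J₂) f u v
      = ((mfderiv I J₁ (fun u => (f u).1) u : E →L[ℝ] F₁) v,
        (mfderiv I J₂ (fun u => (f u).2) u : E →L[ℝ] F₂) v) := by
  have h := mfderiv_prodMk (hf.fst.mdifferentiable (by simp) u) (hf.snd.mdifferentiable (by simp) u)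
  exact congrArg (fun φ : E →L[ℝ] F₁ × F₂ => φ v) h

variable [IsManifold I ∞ Z] [IsManifold J₁ ∞ X] [IsManifold J₂ ∞ M]

/-- The differential at `u` of a map into a product, read in the local trivializations of the
tangent bundles at `u₀` and at the components of its image. -/
noncomputable def coordDifferential (f : Z → X × M) (u₀ u : Z) : E →L[ℝ] F₁ × F₂ :=
  (inTangentCoordinates I J₁ id (fun u => (f u).1) (mfderiv I J₁ fun u => (f u).1) u₀ u).prod
    (inTangentCoordinates I J₂ id (fun u => (f u).2) (mfderiv I J₂ fun u => (f u).2) u₀ u)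

variable {I J₁ J₂} {f : Z → X × M}

theorem continuousAt_coordDifferential_apply (hf : ContMDiff I (J₁.prod J₂) ∞ f) (u₀ : Z) (v : E) :
    ContinuousAt (fun u => coordDifferential I J₁ J₂ f u₀ u v) u₀ :=
  ((continuousAt_inTangentCoordinates I J₁ hf.fst u₀).clm_apply continuousAt_const).prodMk
    ((continuousAt_inTangentCoordinates I J₂ hf.snd u₀).clm_apply continuousAt_const)

theorem coordDifferential_tangentEquiv (hf : ContMDiff I (J₁.prod J₂) ∞ f) {u₀ u : Z}
    {y₀ y : X × M} (h₀ : f u₀ = y₀) (h : f u = y)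
    (hu : u ∈ (trivializationAt E (TangentSpace I) u₀).baseSet)
    (hy₁ : y.1 ∈ (trivializationAt F₁ (TangentSpace J₁) y₀.1).baseSet)
    (hy₂ : y.2 ∈ (trivializationAt F₂ (TangentSpace J₂) y₀.2).baseSet) (v : E) :
    coordDifferential I J₁ J₂ f u₀ u (tangentEquiv I u₀ u hu v)
      = (tangentEquiv J₁ y₀.1 y.1 hy₁ (differential I (J₁.prod J₂) f u v).1,
        tangentEquiv J₂ y₀.2 y.2 hy₂ (differential I (J₁.prod J₂) f u v).2) := by
  rw [differential_prod hf]
  exact Prod.ext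
    (inTangentCoordinates_tangentEquiv I J₁ (fun u => (f u).1) (congrArg Prod.fst h₀)
      (congrArg Prod.fst h) hu hy₁ v)
    (inTangentCoordinates_tangentEquiv I J₂ (fun u => (f u).2) (congrArg Prod.snd h₀)
      (congrArg Prod.snd h) hu hy₂ v)

end CoordDifferential

section ChartCovector

variable {E₁ H₁ E₂ H₂ Z Υ : Type*}
  [NormedAddCommGroup E₁] [NormedSpace ℝ E₁] [TopologicalSpace H₁]
  [NormedAddCommGroup E₂] [NormedSpace ℝ E₂] [TopologicalSpace H₂]
  (I₁ : ModelWithCorners ℝ E₁ H₁) (I₂ : ModelWithCorners ℝ E₂ H₂)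
  [TopologicalSpace Z] [ChartedSpace H₁ Z] [TopologicalSpace Υ] [ChartedSpace H₂ Υ]

/-- The differential at `x` of the functional `s` of the preferred chart at `p`. -/
noncomputable def chartCovector (s : E₁ × E₂ →L[ℝ] ℝ) (p x : Z × Υ) : E₁ × E₂ →L[ℝ] ℝ :=
  s ∘L (mfderiv I₁ 𝓘(ℝ, E₁) (extChartAt I₁ p.1) x.1 : E₁ →L[ℝ] E₁).prodMap
    (mfderiv I₂ 𝓘(ℝ, E₂) (extChartAt I₂ p.2) x.2 : E₂ →L[ℝ] E₂)

variable {I₁ I₂} [IsManifold I₁ ∞ Z] [IsManifold I₂ ∞ Υ]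

theorem chartCovector_self (s : E₁ × E₂ →L[ℝ] ℝ) (p : Z × Υ) :
    chartCovector I₁ I₂ s p p = s := by
  have h₁ : (mfderiv I₁ 𝓘(ℝ, E₁) (extChartAt I₁ p.1) p.1 : E₁ →L[ℝ] E₁) = .id ℝ E₁ :=
    mfderiv_extChartAt_self
  have h₂ : (mfderiv I₂ 𝓘(ℝ, E₂) (extChartAt I₂ p.2) p.2 : E₂ →L[ℝ] E₂) = .id ℝ E₂ :=
    mfderiv_extChartAt_self
  rw [chartCovector, h₁, h₂]
  rfl

theorem hasFDerivWithinAt_chartCovector (s : E₁ × E₂ →L[ℝ] ℝ) {p x : Z × Υ}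
    (h₁ : x.1 ∈ (chartAt H₁ p.1).source) (h₂ : x.2 ∈ (chartAt H₂ p.2).source) :
    HasFDerivWithinAt
      ((s ∘ extChartAt (I₁.prod I₂) p) ∘ (extChartAt (I₁.prod I₂) x).symm)
      (chartCovector I₁ I₂ s p x) (range (I₁.prod I₂)) (extChartAt (I₁.prod I₂) x x) := by
  rw [ModelWithCorners.range_prod]
  have hd₁ := HasFDerivWithinAt.comp (f := Prod.fst) (s := range I₁ ×ˢ range I₂)
    (extChartAt (I₁.prod I₂) x x) (mdifferentiableAt_extChartAt h₁).hasMFDerivAt.2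
    hasFDerivWithinAt_fst (fun x hx => hx.1)
  have hd₂ := HasFDerivWithinAt.comp (f := Prod.snd) (s := range I₁ ×ˢ range I₂)
    (extChartAt (I₁.prod I₂) x x) (mdifferentiableAt_extChartAt h₂).hasMFDerivAt.2
    hasFDerivWithinAt_snd (fun x hx => hx.2)
  exact s.hasFDerivAt.comp_hasFDerivWithinAt _ (hd₁.prodMk hd₂)

end ChartCovector

section Germs

variable {E₁ H₁ E₂ H₂ Z Υ Y : Type*}
  [NormedAddCommGroup E₁] [NormedSpace ℝ E₁] [TopologicalSpace H₁]
  [NormedAddCommGroup E₂] [NormedSpace ℝ E₂] [TopologicalSpace H₂]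
  {I₁ : ModelWithCorners ℝ E₁ H₁} {I₂ : ModelWithCorners ℝ E₂ H₂}
  [TopologicalSpace Z] [ChartedSpace H₁ Z] [TopologicalSpace Υ] [ChartedSpace H₂ Υ]
  {f : Z → Y} {g : Υ → Y} {ξ : Z × Υ → E₁ × E₂ →L[ℝ] ℝ}

variable (I₁ I₂ f g ξ) in
/-- The germ at `x` of the part of the fiber product preceding `x`, when the fiber product is
oriented at `x` by the functional `ξ x` of the preferred chart. -/
noncomputable def leftGerm (x : Z × Υ) : Filter (Z × Υ) :=
  below (fiberProd f g) (ξ x ∘ extChartAt (I₁.prod I₂) x) x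

variable (I₁ I₂ f g ξ) in
/-- The germ at `x` of the part of the fiber product following `x`, when the fiber product is
oriented at `x` by the functional `ξ x` of the preferred chart. -/
noncomputable def rightGerm (x : Z × Υ) : Filter (Z × Υ) :=
  above (fiberProd f g) (ξ x ∘ extChartAt (I₁.prod I₂) x) x

theorem leftGerm_le {x : Z × Υ} : leftGerm I₁ I₂ f g ξ x ≤ 𝓝[fiberProd f g] x :=
  nhdsWithin_mono _ inter_subset_left

theorem rightGerm_le {x : Z × Υ} : rightGerm I₁ I₂ f g ξ x ≤ 𝓝[fiberProd f g] x :=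
  nhdsWithin_mono _ inter_subset_left

end Germs

section FiberDet
variable {E₁ H₁ E₂ H₂ F₁ G₁ F₂ G₂ : Type*}
  [NormedAddCommGroup E₁] [NormedSpace ℝ E₁] [TopologicalSpace H₁]
  [NormedAddCommGroup E₂] [NormedSpace ℝ E₂] [TopologicalSpace H₂]
  [NormedAddCommGroup F₁] [NormedSpace ℝ F₁] [TopologicalSpace G₁]
  [NormedAddCommGroup F₂] [NormedSpace ℝ F₂] [TopologicalSpace G₂]
  {I₁ : ModelWithCorners ℝ E₁ H₁} {I₂ : ModelWithCorners ℝ E₂ H₂}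
  {J₁ : ModelWithCorners ℝ F₁ G₁} {J₂ : ModelWithCorners ℝ F₂ G₂}
  {Z Υ X M : Type*}
  [TopologicalSpace Z] [ChartedSpace H₁ Z] [IsManifold I₁ ∞ Z]
  [TopologicalSpace Υ] [ChartedSpace H₂ Υ] [IsManifold I₂ ∞ Υ]
  [TopologicalSpace X] [ChartedSpace G₁ X] [IsManifold J₁ ∞ X]
  [TopologicalSpace M] [ChartedSpace G₂ M] [IsManifold J₂ ∞ M]
  {f : Z → X × M} {g : Υ → X × M}

theorem diffProd_coordDifferential_tangentEquiv (hf : ContMDiff I₁ (J₁.prod J₂) ∞ f)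
    (hg : ContMDiff I₂ (J₁.prod J₂) ∞ g) (s : E₁ × E₂ →L[ℝ] ℝ) {p x : Z × Υ} {y₀ y : X × M}
    (hfp : f p.1 = y₀) (hgp : g p.2 = y₀) (hfx : f x.1 = y) (hgx : g x.2 = y)
    (hu : x.1 ∈ (trivializationAt E₁ (TangentSpace I₁) p.1).baseSet)
    (hP : x.2 ∈ (trivializationAt E₂ (TangentSpace I₂) p.2).baseSet)
    (hy₁ : y.1 ∈ (trivializationAt F₁ (TangentSpace J₁) y₀.1).baseSet)
    (hy₂ : y.2 ∈ (trivializationAt F₂ (TangentSpace J₂) y₀.2).baseSet) (v : E₁ × E₂) :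
    diffProd (coordDifferential I₁ J₁ J₂ f p.1 x.1).toLinearMap
        (coordDifferential I₂ J₁ J₂ g p.2 x.2).toLinearMap s
        (tangentEquiv I₁ p.1 x.1 hu v.1, tangentEquiv I₂ p.2 x.2 hP v.2)
      = let w := diffProd (differential I₁ (J₁.prod J₂) f x.1)
          (differential I₂ (J₁.prod J₂) g x.2) (chartCovector I₁ I₂ s p x) v
        ((tangentEquiv J₁ y₀.1 y.1 hy₁ w.1.1, tangentEquiv J₂ y₀.2 y.2 hy₂ w.1.2), w.2) := by
  have hs : s (tangentEquiv I₁ p.1 x.1 hu v.1, tangentEquiv I₂ p.2 x.2 hP v.2)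
      = chartCovector I₁ I₂ s p x v := by
    rw [chartCovector, ← coe_tangentEquiv I₁ hu, ← coe_tangentEquiv I₂ hP]
    rfl
  have hA := coordDifferential_tangentEquiv hf hfp hfx hu hy₁ hy₂ v.1
  have hB := coordDifferential_tangentEquiv hg hgp hgx hP hy₁ hy₂ v.2
  simp only [diffProd_apply, ContinuousLinearMap.coe_coe, hs, hA, hB, Prod.mk_sub_mk, Prod.fst_sub,
    Prod.snd_sub, map_sub]

variable [FiniteDimensional ℝ E₁] [FiniteDimensional ℝ E₂]
  [FiniteDimensional ℝ F₁] [FiniteDimensional ℝ F₂]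

/-- The oriented determinant of the difference of the differentials of `f` and `g` at `p`, completed
by the functional `s`. At a point of a transverse fiber product, where the kernel of the difference
is a line, its sign tells on which side of that line `s` is positive. -/
noncomputable def fiberDet (o₁ : RelOrientation I₁ J₁ (fun u => (f u).1))
    (o₂ : RelOrientation I₂ J₂ (fun P => (g P).2))
    (h : finrank ℝ F₁ + finrank ℝ F₂ + 1 = finrank ℝ E₁ + finrank ℝ E₂)
    (p : Z × Υ) (s : E₁ × E₂ →L[ℝ] ℝ) : ℝ :=
  orientedDet (o₁.linear p.1) (o₂.linear p.2) h (finBasis ℝ E₁) (finBasis ℝ E₂) (finBasis ℝ F₁)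
    (finBasis ℝ F₂) (diffProd (differential I₁ (J₁.prod J₂) f p.1)
      (differential I₂ (J₁.prod J₂) g p.2) s)

/-- The determinant `fiberDet` at `p`, with the differentials replaced by those at `x`, read in
tangent coordinates at `p`. -/
noncomputable def coordFiberDet (o₁ : RelOrientation I₁ J₁ (fun u => (f u).1))
    (o₂ : RelOrientation I₂ J₂ (fun P => (g P).2))
    (h : finrank ℝ F₁ + finrank ℝ F₂ + 1 = finrank ℝ E₁ + finrank ℝ E₂)
    (p : Z × Υ) (s : E₁ × E₂ →L[ℝ] ℝ) (x : Z × Υ) : ℝ :=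
  orientedDet (o₁.linear p.1) (o₂.linear p.2) h (finBasis ℝ E₁) (finBasis ℝ E₂) (finBasis ℝ F₁)
    (finBasis ℝ F₂) (diffProd (coordDifferential I₁ J₁ J₂ f p.1 x.1)
      (coordDifferential I₂ J₁ J₂ g p.2 x.2) s)

variable (o₁ : RelOrientation I₁ J₁ (fun u => (f u).1))
  (o₂ : RelOrientation I₂ J₂ (fun P => (g P).2))
  (h : finrank ℝ F₁ + finrank ℝ F₂ + 1 = finrank ℝ E₁ + finrank ℝ E₂) {p : Z × Υ}
  (s : E₁ × E₂ →L[ℝ] ℝ)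

theorem continuousAt_coordFiberDet (hf : ContMDiff I₁ (J₁.prod J₂) ∞ f)
    (hg : ContMDiff I₂ (J₁.prod J₂) ∞ g) : ContinuousAt (coordFiberDet o₁ o₂ h p s) p :=
  continuousAt_orientedDet _ _ h _ _ _ _ _
    (fun v => (continuousAt_coordDifferential_apply hf p.1 v).comp continuousAt_fst)
    (fun v => (continuousAt_coordDifferential_apply hg p.2 v).comp continuousAt_snd)

theorem eventually_exists_mul_fiberDet_eq (hf : ContMDiff I₁ (J₁.prod J₂) ∞ f)
    (hg : ContMDiff I₂ (J₁.prod J₂) ∞ g) (hp : p ∈ fiberProd f g) :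
    ∀ᶠ x in 𝓝[fiberProd f g] p, ∃ r : ℝ, 0 < r ∧
      coordFiberDet o₁ o₂ h p s x = r * fiberDet o₁ o₂ h x (chartCovector I₁ I₂ s p x) := by
  have hfp : f p.1 = g p.2 := hp
  have ho₁ := continuousAt_fst.eventually
    (o₁.eventually_map_eq I₁ J₁ (congrArg Prod.fst hfp))
  have ho₂ := continuousAt_snd.eventually (o₂.eventually_map_eq I₂ J₂ (u₀ := p.2) rfl)
  have hy := (hg.continuous.comp continuous_snd).continuousAt (x := p)
  filter_upwards [self_mem_nhdsWithin, nhdsWithin_le_nhds ho₁, nhdsWithin_le_nhds ho₂,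
    nhdsWithin_le_nhds (continuousAt_fst.eventually (eventually_mem_baseSet I₁ p.1)),
    nhdsWithin_le_nhds (continuousAt_snd.eventually (eventually_mem_baseSet I₂ p.2)),
    nhdsWithin_le_nhds (hy.fst.eventually (eventually_mem_baseSet J₁ (g p.2).1)),
    nhdsWithin_le_nhds (hy.snd.eventually (eventually_mem_baseSet J₂ (g p.2).2))]
    with x hx ho₁ ho₂ hu hP hy₁ hy₂
  have hfx : f x.1 = g x.2 := hx
  let T₁ := (tangentEquiv I₁ p.1 x.1 hu).toLinearEquiv
  let T₂ := (tangentEquiv I₂ p.2 x.2 hP).toLinearEquiv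
  let S₁ := (tangentEquiv J₁ (g p.2).1 (g x.2).1 hy₁).toLinearEquiv
  let S₂ := (tangentEquiv J₂ (g p.2).2 (g x.2).2 hy₂).toLinearEquiv
  obtain ⟨r, hr, hchange⟩ := orientedDet_change (o₁.linear p.1) (o₂.linear p.2) h
    ((finBasis ℝ E₁).map T₁) ((finBasis ℝ E₂).map T₂)
    ((finBasis ℝ F₁).map S₁) (finBasis ℝ F₁) ((finBasis ℝ F₂).map S₂) (finBasis ℝ F₂)
    (Basis.isUnit_det _ (finBasis ℝ E₁)).ne_zero (Basis.isUnit_det _ (finBasis ℝ E₂)).ne_zero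
  refine ⟨r, hr, ?_⟩
  rw [coordFiberDet, hchange, fiberDet]
  congr 1
  exact orientedDet_map h _ _ _ _ T₁ T₂ S₁ S₂ (ho₁ _ (congrArg Prod.fst hfx) hu hy₁)
    (ho₂ _ rfl hP hy₂)
    (diffProd_coordDifferential_tangentEquiv hf hg s hfp rfl hfx rfl hu hP hy₁ hy₂)

theorem eventually_fiberDet_pos (hf : ContMDiff I₁ (J₁.prod J₂) ∞ f)
    (hg : ContMDiff I₂ (J₁.prod J₂) ∞ g) (hp : p ∈ fiberProd f g)
    (hs : 0 < fiberDet o₁ o₂ h p s) :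
    ∀ᶠ x in 𝓝[fiberProd f g] p, 0 < fiberDet o₁ o₂ h x (chartCovector I₁ I₂ s p x) := by
  have hev := eventually_exists_mul_fiberDet_eq o₁ o₂ h s hf hg hp
  have hpos : 0 < coordFiberDet o₁ o₂ h p s p := by
    obtain ⟨r, hr, he⟩ := hev.self_of_nhdsWithin hp
    rw [he, chartCovector_self]
    exact mul_pos hr hs
  filter_upwards [hev, nhdsWithin_le_nhds
    ((continuousAt_coordFiberDet o₁ o₂ h s hf hg).eventually (lt_mem_nhds hpos))]
    with x ⟨r, hr, he⟩ hx
  rw [he] at hx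
  exact (mul_pos_iff_of_pos_left hr).1 hx

variable {o₁ : RelOrientation I₁ J₁ (fun u => (f u).1)}
  {o₂ : RelOrientation I₂ J₂ (fun P => (g P).2)}
  {h : finrank ℝ F₁ + finrank ℝ F₂ + 1 = finrank ℝ E₁ + finrank ℝ E₂}
  {p : Z × Υ} {s : E₁ × E₂ →L[ℝ] ℝ} {ξ : Z × Υ → E₁ × E₂ →L[ℝ] ℝ}

theorem bijective_levelDeriv_prod (hs : 0 < fiberDet o₁ o₂ h p s) :
    Function.Bijective ((levelDeriv I₁ I₂ (J₁.prod J₂) f g p).prod s) := by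
  have hbij := (orientedDet_ne_zero_iff_bijective _ _ h _ _ _ _).1 hs.ne'
  have hcoe : ⇑((levelDeriv I₁ I₂ (J₁.prod J₂) f g p).prod s)
      = diffProd (differential I₁ (J₁.prod J₂) f p.1) (differential I₂ (J₁.prod J₂) g p.2) s :=
    funext fun v => by rw [diffProd_apply]; rfl
  rwa [hcoe]

theorem below_eq_and_above_eq_of_fiberDet_pos (hf : ContMDiff I₁ (J₁.prod J₂) ∞ f)
    (hg : ContMDiff I₂ (J₁.prod J₂) ∞ g) (hp : p ∈ fiberProd f g)
    {r₁ r₂ : Z × Υ → ℝ} {r₁' r₂' : E₁ × E₂ →L[ℝ] ℝ}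
    (h₁ : HasFDerivWithinAt (r₁ ∘ (extChartAt (I₁.prod I₂) p).symm) r₁' (range (I₁.prod I₂))
      (extChartAt (I₁.prod I₂) p p))
    (h₂ : HasFDerivWithinAt (r₂ ∘ (extChartAt (I₁.prod I₂) p).symm) r₂' (range (I₁.prod I₂))
      (extChartAt (I₁.prod I₂) p p))
    (hr₁ : 0 < fiberDet o₁ o₂ h p r₁') (hr₂ : 0 < fiberDet o₁ o₂ h p r₂') :
    below (fiberProd f g) r₁ p = below (fiberProd f g) r₂ p ∧
      above (fiberProd f g) r₁ p = above (fiberProd f g) r₂ p := by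
  obtain ⟨c, hc, q, hq⟩ := exists_eq_mul_add_of_orientedDet_pos hr₁ hr₂
  have hlevel := eventually_lt_iff_lt_of_level (hasFDerivWithinAt_levelMap hf hg p) h₁ h₂
    (bijective_levelDeriv_prod hr₁).1 hc (q := q.toContinuousLinearMap)
    (ContinuousLinearMap.ext hq)
  have hN := eventually_levelMap_eq_zero_iff (I₁ := I₁) (I₂ := I₂) (J := J₁.prod J₂)
    hf.continuous hg.continuous hp
  have hsides : ∀ᶠ z in 𝓝 p, z ∈ fiberProd f g →
      ((r₁ z < r₁ p ↔ r₂ z < r₂ p) ∧ (r₁ p < r₁ z ↔ r₂ p < r₂ z)) := by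
    rw [nhdsWithin_inter', eventually_inf_principal, ← map_extChartAt_nhds, eventually_map]
      at hlevel
    filter_upwards [hlevel, hN, extChartAt_source_mem_nhds (I := I₁.prod I₂) p]
      with z hz hzN hzs hzm
    have hz' := hz ((hzN.2 hzm).trans (hN.self_of_nhds.2 hp).symm)
    simpa only [Function.comp_apply, (extChartAt (I₁.prod I₂) p).left_inv hzs,
      extChartAt_to_inv] using hz'
  exact ⟨nhdsWithin_eq_iff_eventuallyEq.2
      (hsides.mono fun z hz => propext (and_congr_right fun hm => (hz hm).1)),
    nhdsWithin_eq_iff_eventuallyEq.2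
      (hsides.mono fun z hz => propext (and_congr_right fun hm => (hz hm).2))⟩

theorem eventually_germs_eq (hf : ContMDiff I₁ (J₁.prod J₂) ∞ f)
    (hg : ContMDiff I₂ (J₁.prod J₂) ∞ g) (hξ : ∀ x ∈ fiberProd f g, 0 < fiberDet o₁ o₂ h x (ξ x))
    (hp : p ∈ fiberProd f g) (hs : 0 < fiberDet o₁ o₂ h p s) :
    ∀ᶠ x in 𝓝[fiberProd f g] p,
      leftGerm I₁ I₂ f g ξ x = below (fiberProd f g) (s ∘ extChartAt (I₁.prod I₂) p) x ∧
      rightGerm I₁ I₂ f g ξ x = above (fiberProd f g) (s ∘ extChartAt (I₁.prod I₂) p) x := by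
  filter_upwards [self_mem_nhdsWithin, eventually_fiberDet_pos o₁ o₂ h s hf hg hp hs,
    nhdsWithin_le_nhds (continuousAt_fst.eventually (chart_source_mem_nhds H₁ p.1)),
    nhdsWithin_le_nhds (continuousAt_snd.eventually (chart_source_mem_nhds H₂ p.2))]
    with x hx hsx hx₁ hx₂
  have hderiv := hasFDerivWithinAt_chartCovector (I₁ := I₁) (I₂ := I₂) (ξ x)
    (mem_chart_source H₁ x.1) (mem_chart_source H₂ x.2)
  rw [chartCovector_self] at hderiv
  exact below_eq_and_above_eq_of_fiberDet_pos hf hg hx hderiv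
    (hasFDerivWithinAt_chartCovector s hx₁ hx₂) (hξ x hx) hsx

theorem exists_isLocalCoordinate_fiberProd (hf : ContMDiff I₁ (J₁.prod J₂) ∞ f)
    (hg : ContMDiff I₂ (J₁.prod J₂) ∞ g) (hK : Convex ℝ (range (I₁.prod I₂)))
    (hp : p ∈ fiberProd f g) (hs : 0 < fiberDet o₁ o₂ h p s) {T : Set ℝ}
    (hT : ∀ᶠ v in 𝓝 (extChartAt (I₁.prod I₂) p p), v ∈ range (I₁.prod I₂) ↔ s v ∈ T) :
    ∃ γ, IsLocalCoordinate (fiberProd f g) T (s ∘ extChartAt (I₁.prod I₂) p) γ p := by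
  have hrange (y : Z × Υ) : extChartAt (I₁.prod I₂) p y ∈ range (I₁.prod I₂) :=
    ⟨chartAt (ModelProd H₁ H₂) p y, rfl⟩
  have hN := eventually_levelMap_eq_zero_iff (I₁ := I₁) (I₂ := I₂) (J := J₁.prod J₂)
    hf.continuous hg.continuous hp
  obtain ⟨γ, hγ⟩ := exists_isLocalCoordinate_level hK (hrange p)
    ((I₁.prod I₂).uniqueDiffOn _ (hrange p)) (contDiffWithinAt_levelMap hf hg p)
    (hasFDerivWithinAt_levelMap hf hg p) (bijective_levelDeriv_prod hs) (hN.self_of_nhds.2 hp) hT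
  exact ⟨_, hγ.comp_extChartAt (fun _ => And.left)
    (hN.mono fun y hy => (and_iff_right (hrange y)).trans hy)⟩

theorem fiberDet_neg (s : E₁ × E₂ →L[ℝ] ℝ) :
    fiberDet o₁ o₂ h p (-s) = -fiberDet o₁ o₂ h p s :=
  orientedDet_diffProd_neg ..

theorem fiberDet_ne_zero_of_surjective
    (hs : Function.Surjective (diffProd (differential I₁ (J₁.prod J₂) f p.1)
      (differential I₂ (J₁.prod J₂) g p.2) s)) : fiberDet o₁ o₂ h p s ≠ 0 :=
  (orientedDet_ne_zero_iff_bijective ..).2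
    (bijective_of_surjective h (finBasis ℝ E₁) (finBasis ℝ E₂) (finBasis ℝ F₁) (finBasis ℝ F₂) hs)

variable (o₁ o₂ h) in
theorem Transverse.exists_fiberDet_pos (ht : Transverse I₁ I₂ (J₁.prod J₂) f g) :
    ∃ ξ : Z × Υ → E₁ × E₂ →L[ℝ] ℝ, ∀ x ∈ fiberProd f g, 0 < fiberDet o₁ o₂ h x (ξ x) := by
  have hpos : ∀ x ∈ fiberProd f g, ∃ s, 0 < fiberDet o₁ o₂ h x s := fun x hx => by
    obtain ⟨s, hs⟩ := exists_surjective_diffProd h (ht x.1 x.2 hx)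
    have hne : fiberDet o₁ o₂ h x s.toContinuousLinearMap ≠ 0 := fiberDet_ne_zero_of_surjective hs
    rcases hne.lt_or_gt with hneg | hpos
    · exact ⟨-s.toContinuousLinearMap, by rwa [fiberDet_neg, neg_pos]⟩
    · exact ⟨_, hpos⟩
  choose! ξ hξ using hpos
  exact ⟨ξ, hξ⟩

theorem hasArcNhd_and_endSign_eq_zero_of_notMem_boundary (hf : ContMDiff I₁ (J₁.prod J₂) ∞ f)
    (hg : ContMDiff I₂ (J₁.prod J₂) ∞ g) (hK : Convex ℝ (range (I₁.prod I₂)))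
    (hξ : ∀ x ∈ fiberProd f g, 0 < fiberDet o₁ o₂ h x (ξ x)) (hp : p ∈ fiberProd f g)
    (hp₁ : p.1 ∉ I₁.boundary Z) (hp₂ : p.2 ∉ I₂.boundary Υ) :
    HasArcNhd (fiberProd f g) (leftGerm I₁ I₂ f g ξ) (rightGerm I₁ I₂ f g ξ) p ∧
      endSign (leftGerm I₁ I₂ f g ξ) (rightGerm I₁ I₂ f g ξ) p = 0 := by
  have hT : ∀ᶠ v in 𝓝 (extChartAt (I₁.prod I₂) p p),
      v ∈ range (I₁.prod I₂) ↔ ξ p v ∈ univ := by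
    rw [ModelWithCorners.range_prod]
    filter_upwards [prod_mem_nhds (range_mem_nhds_of_notMem_boundary hp₁)
      (range_mem_nhds_of_notMem_boundary hp₂)] with v hv using iff_of_true hv (mem_univ _)
  obtain ⟨γ, hγ⟩ := exists_isLocalCoordinate_fiberProd hf hg hK hp (hξ p hp) hT
  have hgerm := eventually_germs_eq hf hg hξ hp (hξ p hp)
  have hgerm_p := hgerm.self_of_nhdsWithin hp
  exact ⟨hγ.hasArcNhd (.inl rfl) (hgerm.mono fun _ => And.left) (hgerm.mono fun _ => And.right),
    hγ.endSign_univ hgerm_p.1 hgerm_p.2⟩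

theorem hasArcNhd_and_endSign_eq_of_halfSpace (hf : ContMDiff I₁ (J₁.prod J₂) ∞ f)
    (hg : ContMDiff I₂ (J₁.prod J₂) ∞ g) (hK : Convex ℝ (range (I₁.prod I₂)))
    (hξ : ∀ x ∈ fiberProd f g, 0 < fiberDet o₁ o₂ h x (ξ x)) (hp : p ∈ fiberProd f g)
    (hs : fiberDet o₁ o₂ h p s ≠ 0)
    (hT : ∀ᶠ v in 𝓝 (extChartAt (I₁.prod I₂) p p),
      v ∈ range (I₁.prod I₂) ↔ s (extChartAt (I₁.prod I₂) p p) ≤ s v) :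
    HasArcNhd (fiberProd f g) (leftGerm I₁ I₂ f g ξ) (rightGerm I₁ I₂ f g ξ) p ∧
      endSign (leftGerm I₁ I₂ f g ξ) (rightGerm I₁ I₂ f g ξ) p
        = -signOf (0 < fiberDet o₁ o₂ h p s) := by
  rcases hs.lt_or_gt with hneg | hpos
  · have hpos : 0 < fiberDet o₁ o₂ h p (-s) := by rwa [fiberDet_neg, neg_pos]
    obtain ⟨γ, hγ⟩ := exists_isLocalCoordinate_fiberProd hf hg hK hp hpos
      (T := Iic ((-s) (extChartAt (I₁.prod I₂) p p)))
      (hT.mono fun v hv => hv.trans neg_le_neg_iff.symm)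
    have hgerm := eventually_germs_eq hf hg hξ hp hpos
    have hgerm_p := hgerm.self_of_nhdsWithin hp
    refine ⟨hγ.hasArcNhd (.inr (.inr rfl)) (hgerm.mono fun _ => And.left)
      (hgerm.mono fun _ => And.right), (hγ.endSign_Iic hgerm_p.1 hgerm_p.2).trans ?_⟩
    rw [signOf, if_neg hneg.not_gt, neg_neg]
  · obtain ⟨γ, hγ⟩ := exists_isLocalCoordinate_fiberProd hf hg hK hp hpos
      (T := Ici (s (extChartAt (I₁.prod I₂) p p))) hT
    have hgerm := eventually_germs_eq hf hg hξ hp hpos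
    have hgerm_p := hgerm.self_of_nhdsWithin hp
    refine ⟨hγ.hasArcNhd (.inr (.inl rfl)) (hgerm.mono fun _ => And.left)
      (hgerm.mono fun _ => And.right), (hγ.endSign_Ici hgerm_p.1 hgerm_p.2).trans ?_⟩
    rw [signOf, if_pos hpos]

theorem hasArcNhd_and_signRight_eq (hf : ContMDiff I₁ (J₁.prod J₂) ∞ f)
    (hg : ContMDiff I₂ (J₁.prod J₂) ∞ g) (hK : Convex ℝ (range (I₁.prod I₂)))
    (hξ : ∀ x ∈ fiberProd f g, 0 < fiberDet o₁ o₂ h x (ξ x)) (hI₂ : IsBorderedModel I₂)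
    (ht : TransverseBoundary I₁ I₂ (J₁.prod J₂) f g) (hp : p ∈ fiberProd f g)
    (hp₁ : p.1 ∉ I₁.boundary Z) (hp₂ : p.2 ∈ I₂.boundary Υ) :
    HasArcNhd (fiberProd f g) (leftGerm I₁ I₂ f g ξ) (rightGerm I₁ I₂ f g ξ) p ∧
      endSign (leftGerm I₁ I₂ f g ξ) (rightGerm I₁ I₂ f g ξ) p ≠ 0 ∧
      signRight f g o₁ o₂ p
        = -((-1) ^ finrank ℝ E₂ * endSign (leftGerm I₁ I₂ f g ξ) (rightGerm I₁ I₂ f g ξ) p) := by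
  obtain ⟨l, hl⟩ := hI₂
  have hl0 := ne_zero_of_mem_boundary hl hp₂
  have hne : fiberDet o₁ o₂ h p (l ∘L ContinuousLinearMap.snd ℝ E₁ E₂) ≠ 0 :=
    fiberDet_ne_zero_of_surjective (surjective_diffProd_snd hl hl0 (ht p.1 p.2 hp₂ hp))
  have hT : ∀ᶠ v in 𝓝 (extChartAt (I₁.prod I₂) p p), v ∈ range (I₁.prod I₂) ↔
      (l ∘L ContinuousLinearMap.snd ℝ E₁ E₂) (extChartAt (I₁.prod I₂) p p)
        ≤ (l ∘L ContinuousLinearMap.snd ℝ E₁ E₂) v := by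
    filter_upwards [continuousAt_fst.eventually (range_mem_nhds_of_notMem_boundary hp₁)] with v hv
    have hzero : (l ∘L ContinuousLinearMap.snd ℝ E₁ E₂) (extChartAt (I₁.prod I₂) p p) = 0 :=
      (apply_extChartAt_eq_zero hl hp₂ :)
    rw [ModelWithCorners.range_prod, mem_prod, hl, hzero]
    exact and_iff_right hv
  obtain ⟨harc, hend⟩ := hasArcNhd_and_endSign_eq_of_halfSpace hf hg hK hξ hp hne hT
  refine ⟨harc, ?_, ?_⟩
  · rw [hend]
    exact neg_ne_zero.2 (signOf_ne_zero _)
  · rw [hend, mul_neg, neg_neg]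
    exact crossSign_boundary_right hl hl0 _ _ h _ _ _ _ _ _ hne

theorem hasArcNhd_and_signLeft_eq (hf : ContMDiff I₁ (J₁.prod J₂) ∞ f)
    (hg : ContMDiff I₂ (J₁.prod J₂) ∞ g) (hK : Convex ℝ (range (I₁.prod I₂)))
    (hξ : ∀ x ∈ fiberProd f g, 0 < fiberDet o₁ o₂ h x (ξ x)) (hI₁ : IsBorderedModel I₁)
    (ht : TransverseBoundary I₂ I₁ (J₁.prod J₂) g f) (hp : p ∈ fiberProd f g)
    (hp₁ : p.1 ∈ I₁.boundary Z) (hp₂ : p.2 ∉ I₂.boundary Υ) :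
    HasArcNhd (fiberProd f g) (leftGerm I₁ I₂ f g ξ) (rightGerm I₁ I₂ f g ξ) p ∧
      endSign (leftGerm I₁ I₂ f g ξ) (rightGerm I₁ I₂ f g ξ) p ≠ 0 ∧
      signLeft f g o₁ o₂ p = endSign (leftGerm I₁ I₂ f g ξ) (rightGerm I₁ I₂ f g ξ) p := by
  obtain ⟨l, hl⟩ := hI₁
  have hl0 := ne_zero_of_mem_boundary hl hp₁
  have hne : fiberDet o₁ o₂ h p (l ∘L ContinuousLinearMap.fst ℝ E₁ E₂) ≠ 0 :=
    fiberDet_ne_zero_of_surjective (surjective_diffProd_fst hl hl0 (ht p.2 p.1 hp₁ (Eq.symm hp)))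
  have hT : ∀ᶠ v in 𝓝 (extChartAt (I₁.prod I₂) p p), v ∈ range (I₁.prod I₂) ↔
      (l ∘L ContinuousLinearMap.fst ℝ E₁ E₂) (extChartAt (I₁.prod I₂) p p)
        ≤ (l ∘L ContinuousLinearMap.fst ℝ E₁ E₂) v := by
    filter_upwards [continuousAt_snd.eventually (range_mem_nhds_of_notMem_boundary hp₂)] with v hv
    have hzero : (l ∘L ContinuousLinearMap.fst ℝ E₁ E₂) (extChartAt (I₁.prod I₂) p p) = 0 :=
      (apply_extChartAt_eq_zero hl hp₁ :)
    rw [ModelWithCorners.range_prod, mem_prod, hl, hzero]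
    exact and_iff_left hv
  obtain ⟨harc, hend⟩ := hasArcNhd_and_endSign_eq_of_halfSpace hf hg hK hξ hp hne hT
  refine ⟨harc, ?_, ?_⟩
  · rw [hend]
    exact neg_ne_zero.2 (signOf_ne_zero _)
  · rw [hend]
    exact crossSign_boundary_left hl hl0 _ _ h _ _ _ _ _ _ hne

theorem StronglyTransverse.exists_arcs_endSigns (hI₁ : IsBorderedModel I₁)
    (hI₂ : IsBorderedModel I₂) (o₁ : RelOrientation I₁ J₁ (fun u => (f u).1))
    (o₂ : RelOrientation I₂ J₂ (fun P => (g P).2))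
    (hdim : finrank ℝ E₁ + finrank ℝ E₂ = finrank ℝ F₁ + finrank ℝ F₂ + 1)
    (hfg : StronglyTransverse I₁ I₂ (J₁.prod J₂) f g) :
    ∃ ξ : Z × Υ → E₁ × E₂ →L[ℝ] ℝ,
      (∀ p ∈ fiberProd f g,
        HasArcNhd (fiberProd f g) (leftGerm I₁ I₂ f g ξ) (rightGerm I₁ I₂ f g ξ) p) ∧
      (∀ p ∈ fiberProd f g, p ∉ fiberProdBoundary I₂ f g → p ∉ boundaryFiberProd I₁ f g →
        endSign (leftGerm I₁ I₂ f g ξ) (rightGerm I₁ I₂ f g ξ) p = 0) ∧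
      (∀ p ∈ fiberProdBoundary I₂ f g,
        endSign (leftGerm I₁ I₂ f g ξ) (rightGerm I₁ I₂ f g ξ) p ≠ 0 ∧
        signRight f g o₁ o₂ p =
          -((-1) ^ finrank ℝ E₂ * endSign (leftGerm I₁ I₂ f g ξ) (rightGerm I₁ I₂ f g ξ) p)) ∧
      ∀ p ∈ boundaryFiberProd I₁ f g,
        endSign (leftGerm I₁ I₂ f g ξ) (rightGerm I₁ I₂ f g ξ) p ≠ 0 ∧
        signLeft f g o₁ o₂ p =
          endSign (leftGerm I₁ I₂ f g ξ) (rightGerm I₁ I₂ f g ξ) p := by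
  obtain ⟨ξ, hξ⟩ := hfg.transverse.exists_fiberDet_pos o₁ o₂ hdim.symm
  have hK := hI₁.convex_range_prod hI₂
  have hnot : ∀ p ∈ fiberProd f g, p.1 ∈ I₁.boundary Z → p.2 ∉ I₂.boundary Υ := fun p =>
    hfg.boundary_transverse_boundary.notMem_boundary hI₁ hI₂ (by rw [finrank_prod, hdim])
  have hright := fun p (hp : p ∈ fiberProdBoundary I₂ f g) =>
    hasArcNhd_and_signRight_eq hfg.smooth_left hfg.smooth_right hK hξ hI₂
      hfg.transverse_boundary hp.2 (fun hp₁ => hnot p hp.2 hp₁ hp.1) hp.1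
  have hleft := fun p (hp : p ∈ boundaryFiberProd I₁ f g) =>
    hasArcNhd_and_signLeft_eq hfg.smooth_left hfg.smooth_right hK hξ hI₁
      hfg.boundary_transverse hp.2 hp.1 (hnot p hp.2 hp.1)
  have hinner := fun p (hp : p ∈ fiberProd f g) (hR : p ∉ fiberProdBoundary I₂ f g)
      (hL : p ∉ boundaryFiberProd I₁ f g) =>
    hasArcNhd_and_endSign_eq_zero_of_notMem_boundary hfg.smooth_left hfg.smooth_right hK hξ hp
      (fun hp₁ => hL ⟨hp₁, hp⟩) fun hp₂ => hR ⟨hp₂, hp⟩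
  refine ⟨ξ, fun p hp => ?_, fun p hp hR hL => (hinner p hp hR hL).2,
    fun p hp => (hright p hp).2, fun p hp => (hleft p hp).2⟩
  by_cases hR : p ∈ fiberProdBoundary I₂ f g
  · exact (hright p hR).1
  by_cases hL : p ∈ boundaryFiberProd I₁ f g
  exacts [(hleft p hL).1, (hinner p hp hR hL).1]

end FiberDet

theorem finsum_mem_eq_add_finsum_mem {α A : Type*} [AddCommMonoid A] {e : α → A} {N S T : Set α}
    (hST : Disjoint S T) (hS : S ⊆ N) (hT : T ⊆ N) (hfinS : S.Finite) (hfinT : T.Finite)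
    (h0 : ∀ x ∈ N, x ∉ S → x ∉ T → e x = 0) :
    ∑ᶠ x ∈ N, e x = ∑ᶠ x ∈ S, e x + ∑ᶠ x ∈ T, e x := by
  rw [← finsum_mem_union hST hfinS hfinT]
  refine finsum_mem_inter_support_eq _ _ _ (Set.ext fun x => and_congr_left fun hx => ?_)
  refine ⟨fun hxN => ?_, fun hxST => hxST.elim (@hS x) (@hT x)⟩
  by_contra hxST
  exact hx (h0 x hxN (fun hxS => hxST (.inl hxS)) fun hxT => hxST (.inr hxT))

end Steenrod

theorem lemma3p4_general
    {E₁ H₁ E₂ H₂ F₁ G₁ F₂ G₂ Z Υ X M : Type*}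
    [NormedAddCommGroup E₁] [NormedSpace ℝ E₁] [FiniteDimensional ℝ E₁] [TopologicalSpace H₁]
    [NormedAddCommGroup E₂] [NormedSpace ℝ E₂] [FiniteDimensional ℝ E₂] [TopologicalSpace H₂]
    [NormedAddCommGroup F₁] [NormedSpace ℝ F₁] [FiniteDimensional ℝ F₁] [TopologicalSpace G₁]
    [NormedAddCommGroup F₂] [NormedSpace ℝ F₂] [FiniteDimensional ℝ F₂] [TopologicalSpace G₂]
    {I₁ : ModelWithCorners ℝ E₁ H₁} {I₂ : ModelWithCorners ℝ E₂ H₂}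
    {J₁ : ModelWithCorners ℝ F₁ G₁} {J₂ : ModelWithCorners ℝ F₂ G₂}
    (hI₁ : Steenrod.IsBorderedModel I₁) (hI₂ : Steenrod.IsBorderedModel I₂)
    [TopologicalSpace Z] [T2Space Z] [ChartedSpace H₁ Z] [IsManifold I₁ ∞ Z]
    [TopologicalSpace Υ] [T2Space Υ] [ChartedSpace H₂ Υ] [IsManifold I₂ ∞ Υ]
    [TopologicalSpace X] [ChartedSpace G₁ X] [IsManifold J₁ ∞ X]
    [TopologicalSpace M] [ChartedSpace G₂ M] [IsManifold J₂ ∞ M]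
    {f : Z → X × M} {g : Υ → X × M}
    (o₁ : Steenrod.RelOrientation I₁ J₁ (fun u => (f u).1))
    (o₂ : Steenrod.RelOrientation I₂ J₂ (fun P => (g P).2))
    (hdim : finrank ℝ E₁ + finrank ℝ E₂ = finrank ℝ F₁ + finrank ℝ F₂ + 1)
    (hfg : Steenrod.StronglyTransverse I₁ I₂ (J₁.prod J₂) f g)
    (hN : IsCompact (Steenrod.fiberProd f g)) :
    (Steenrod.fiberProdBoundary I₂ f g).Finite ∧
    (Steenrod.boundaryFiberProd I₁ f g).Finite ∧
    ∑ᶠ p ∈ Steenrod.fiberProdBoundary I₂ f g, Steenrod.signRight f g o₁ o₂ p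
      = (-1) ^ finrank ℝ E₂ *
        ∑ᶠ p ∈ Steenrod.boundaryFiberProd I₁ f g, Steenrod.signLeft f g o₁ o₂ p := by
  obtain ⟨ξ, harc, hinner, hright, hleft⟩ := hfg.exists_arcs_endSigns hI₁ hI₂ o₁ o₂ hdim
  have hdisj : Disjoint (Steenrod.fiberProdBoundary I₂ f g) (Steenrod.boundaryFiberProd I₁ f g) :=
    disjoint_left.2 fun p hR hL => hfg.boundary_transverse_boundary.notMem_boundary hI₁ hI₂
      (by rw [finrank_prod, hdim]) hL.2 hL.1 hR.1
  have hfin := Steenrod.finite_endSign_ne_zero hN (fun _ _ => Steenrod.leftGerm_le)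
    (fun _ _ => Steenrod.rightGerm_le) harc
  have hfinR := hfin.subset fun p hp => ⟨hp.2, (hright p hp).1⟩
  have hfinL := hfin.subset fun p hp => ⟨hp.2, (hleft p hp).1⟩
  have hsum := Steenrod.finsum_mem_eq_add_finsum_mem hdisj (N := Steenrod.fiberProd f g)
    (fun _ => And.right) (fun _ => And.right) hfinR hfinL hinner
  rw [Steenrod.finsum_endSign_eq_zero hN (fun _ _ => Steenrod.leftGerm_le)
    (fun _ _ => Steenrod.rightGerm_le) harc] at hsum
  refine ⟨hfinR, hfinL, ?_⟩
  rw [finsum_mem_congr rfl fun p hp => (hright p hp).2,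
    finsum_mem_congr rfl fun p hp => (hleft p hp).2, finsum_mem_neg_distrib _ hfinR,
    ← mul_finsum_mem, eq_neg_of_add_eq_zero_right hsum.symm, mul_neg]

theorem lemma3p4
    {E₁ H₁ E₂ H₂ F₁ G₁ F₂ G₂ Z Υ X M : Type*}
    [NormedAddCommGroup E₁] [NormedSpace ℝ E₁] [FiniteDimensional ℝ E₁] [TopologicalSpace H₁]
    [NormedAddCommGroup E₂] [NormedSpace ℝ E₂] [FiniteDimensional ℝ E₂] [TopologicalSpace H₂]
    [NormedAddCommGroup F₁] [NormedSpace ℝ F₁] [FiniteDimensional ℝ F₁] [TopologicalSpace G₁]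
    [NormedAddCommGroup F₂] [NormedSpace ℝ F₂] [FiniteDimensional ℝ F₂] [TopologicalSpace G₂]
    (I₁ : ModelWithCorners ℝ E₁ H₁) (I₂ : ModelWithCorners ℝ E₂ H₂)
    (J₁ : ModelWithCorners ℝ F₁ G₁) (J₂ : ModelWithCorners ℝ F₂ G₂)
    (hI₁ : Steenrod.IsBorderedModel I₁) (hI₂ : Steenrod.IsBorderedModel I₂)
    (hJ₁ : Steenrod.IsBorderedModel J₁) (hJ₂ : Steenrod.IsBorderedModel J₂)
    [TopologicalSpace Z] [T2Space Z] [SecondCountableTopology Z]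
    [ChartedSpace H₁ Z] [IsManifold I₁ ∞ Z]
    [TopologicalSpace Υ] [T2Space Υ] [SecondCountableTopology Υ]
    [ChartedSpace H₂ Υ] [IsManifold I₂ ∞ Υ]
    [TopologicalSpace X] [T2Space X] [SecondCountableTopology X]
    [ChartedSpace G₁ X] [IsManifold J₁ ∞ X]
    [TopologicalSpace M] [T2Space M] [SecondCountableTopology M]
    [ChartedSpace G₂ M] [IsManifold J₂ ∞ M]
    (f : Z → X × M) (g : Υ → X × M)
    (o₁ : Steenrod.RelOrientation I₁ J₁ (fun u => (f u).1))
    (o₂ : Steenrod.RelOrientation I₂ J₂ (fun P => (g P).2))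
    (hdim : Module.finrank ℝ E₁ + Module.finrank ℝ E₂
      = Module.finrank ℝ F₁ + Module.finrank ℝ F₂ + 1)
    (Z₀ : Set Z) (hf : Steenrod.IsBorderedPseudocycle I₁ (J₁.prod J₂) f Z₀)
    (Υ₀ : Set Υ) (hg : Steenrod.IsBorderedPseudocycle I₂ (J₁.prod J₂) g Υ₀)
    (hfg : Steenrod.TransversePseudocycles I₁ I₂ (J₁.prod J₂) f g) :
    (Steenrod.fiberProdBoundary I₂ f g).Finite ∧
    (Steenrod.boundaryFiberProd I₁ f g).Finite ∧
    ∑ᶠ p ∈ Steenrod.fiberProdBoundary I₂ f g, Steenrod.signRight f g o₁ o₂ p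
      = (-1) ^ Module.finrank ℝ E₂ *
        ∑ᶠ p ∈ Steenrod.boundaryFiberProd I₁ f g, Steenrod.signLeft f g o₁ o₂ p := by
  have hN := hfg.isCompact_fiberProd (by rw [finrank_prod, hdim]) hf.isCompact_closure
  exact lemma3p4_general hI₁ hI₂ o₁ o₂ hdim hfg.stronglyTransverse hN
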